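/- A pentagon is a simple closed polygon in the Euclidean plane with five vertices, convex or not. A pentagon is called *Cairo* (respectively *Prismatic*) if it is circumscribed about a circle and has three angles equal to $2\pi/3$ and two right angles that are nonadjacent (respectively adjacent). All unit-area Cairo and Prismatic pentagons have the same perimeter $p_{\mathrm{CP}}=2\sqrt{2+\sqrt3}$. A pentagon is *efficient* if it has unit area and perimeter at most $p_{\mathrm{CP}}$. A non-convex pentagon is of *Type 2* if exactly two of its interior angles are larger than $\pi$. **Theorem.** Let $P$ be an efficient pentagon and $Q$ a unit-area Type 2 non-convex pentagon. Let a flat torus $\mathbb R^2/\Lambda$, where $\Lambda$ is a lattice in $\mathbb R^2$, be tiled edge-to-edge by $n$ tiles congruent to $P$ and $m$ tiles congruent to $Q$; reflected copies are allowed, and $n$ or $m$ may be zero. Edge-to-edge means that in the lifted tiling of the plane two different tiles meet only in common vertices and along common entire edges. Then the perimeter per tile of the tiling, that is, the total length of its edges (each edge counted once) divided by the number $n+m$ of tiles, is at least half the perimeter of a unit-area Cairo or Prismatic pentagon: $$\frac{\text{total length of the edges}}{n+m}\ \ge\ \frac{p_{\mathrm{CP}}}{2}=\sqrt{2+\sqrt3}.$$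 -/

import Mathlib

open MeasureTheory

noncomputable section

/-! The Euclidean plane is `ℂ`. Vertices of a pentagon are indexed cyclically by `Fin 5`
(addition in `Fin 5` is modulo 5). -/

/-- The `i`-th edge of the closed polygonal path with vertices `v 0, …, v 4`. -/
def pentEdge (v : Fin 5 → ℂ) (i : Fin 5) : Set ℂ := segment ℝ (v i) (v (i + 1))

/-- The closed polygonal path itself. -/
def pentBoundary (v : Fin 5 → ℂ) : Set ℂ := ⋃ i, pentEdge v i

/-- The path is simple: consecutive edges meet exactly in their common vertex, and
non-consecutive edges (those whose indices differ by `±2`) are disjoint. Straight angles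
are not excluded. -/
def IsSimplePent (v : Fin 5 → ℂ) : Prop :=
  (∀ i, pentEdge v i ∩ pentEdge v (i + 1) = {v (i + 1)}) ∧
    ∀ i, Disjoint (pentEdge v i) (pentEdge v (i + 2))

/-- The winding number of the path around a point `z` off the path: each edge contributes
the signed angle, in `(-π, π)`, under which it is seen from `z`. -/
def pentWinding (v : Fin 5 → ℂ) (z : ℂ) : ℝ :=
  (∑ i, Complex.arg ((v (i + 1) - z) / (v i - z))) / (2 * Real.pi)

/-- The closed region bounded by the path: the path together with the points that it
winds around. -/
def pentRegion (v : Fin 5 → ℂ) : Set ℂ :=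
  pentBoundary v ∪ {z | z ∉ pentBoundary v ∧ pentWinding v z ≠ 0}

/-- The signed area (shoelace formula); it is positive iff a simple path runs
counterclockwise. -/
def pentSignedArea (v : Fin 5 → ℂ) : ℝ :=
  (∑ i, ((v i).re * (v (i + 1)).im - (v (i + 1)).re * (v i).im)) / 2

/-- A pentagon, convex or not: a simple closed polygon with five vertices, which are listed
in counterclockwise order. -/
structure Pentagon where
  vertex : Fin 5 → ℂ
  simple : IsSimplePent vertex
  ccw : 0 < pentSignedArea vertex

namespace Pentagon

/-- The closed region of the plane occupied by the pentagon. -/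
def region (P : Pentagon) : Set ℂ := pentRegion P.vertex

def HasUnitArea (P : Pentagon) : Prop := volume P.region = 1

def perimeter (P : Pentagon) : ℝ := ∑ i, dist (P.vertex i) (P.vertex (i + 1))

/-- The interior angle at the `i`-th vertex, in `[0, 2π)`: as the vertices run
counterclockwise, it is swept out by turning counterclockwise from the edge towards the next
vertex to the edge towards the previous vertex. -/
def angle (P : Pentagon) (i : Fin 5) : ℝ :=
  toIcoMod Real.two_pi_pos 0
    (Complex.arg ((P.vertex (i - 1) - P.vertex i) / (P.vertex (i + 1) - P.vertex i)))

/-- The pentagon is circumscribed about a circle: it contains a disk whose bounding circle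
touches all five edges. -/
def IsCircumscribed (P : Pentagon) : Prop :=
  ∃ (c : ℂ) (r : ℝ), 0 < r ∧ Metric.ball c r ⊆ P.region ∧
    ∀ i, ∃ z ∈ pentEdge P.vertex i, dist z c = r

/-- Cairo: circumscribed about a circle, two nonadjacent right angles, three angles `2π/3`. -/
def IsCairo (P : Pentagon) : Prop :=
  P.IsCircumscribed ∧ ∃ k : Fin 5,
    P.angle k = Real.pi / 2 ∧ P.angle (k + 2) = Real.pi / 2 ∧
    P.angle (k + 1) = 2 * Real.pi / 3 ∧ P.angle (k + 3) = 2 * Real.pi / 3 ∧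
    P.angle (k + 4) = 2 * Real.pi / 3

/-- Prismatic: circumscribed about a circle, two adjacent right angles, three angles
`2π/3`. -/
def IsPrismatic (P : Pentagon) : Prop :=
  P.IsCircumscribed ∧ ∃ k : Fin 5,
    P.angle k = Real.pi / 2 ∧ P.angle (k + 1) = Real.pi / 2 ∧
    P.angle (k + 2) = 2 * Real.pi / 3 ∧ P.angle (k + 3) = 2 * Real.pi / 3 ∧
    P.angle (k + 4) = 2 * Real.pi / 3

/-- Efficient: of unit area, with perimeter at most that of a unit-area Cairo pentagon. -/
def IsEfficient (P : Pentagon) : Prop :=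
  P.HasUnitArea ∧ ∃ C : Pentagon, C.IsCairo ∧ C.HasUnitArea ∧ P.perimeter ≤ C.perimeter

/-- Type 2 non-convex: exactly two interior angles are larger than `π`. -/
def IsType2 (P : Pentagon) : Prop := {i | Real.pi < P.angle i}.ncard = 2

end Pentagon

/-! Tilings of the flat torus `ℂ / Λ` by `n` copies of `P` and `m` copies of `Q`, described by
their lifts to the plane: one lift of each tile is chosen, and the lifted tiles are the
translates of these by `Λ`. -/

/-- The tiles of the torus: `n` copies of `P`, then `m` copies of `Q`. -/
def protoTile (P Q : Pentagon) {n m : ℕ} (i : Fin n ⊕ Fin m) : Pentagon :=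
  Sum.elim (fun _ => P) (fun _ => Q) i

section placed

variable (Λ : Submodule ℤ ℂ) (P Q : Pentagon) {n m : ℕ}
  (g : Fin n ⊕ Fin m → (ℂ ≃ᵃⁱ[ℝ] ℂ))

/-- The rigid motion (a reflection is allowed) that puts the prototile in the place of the
lifted tile `a = (i, l)`. -/
def placement (a : (Fin n ⊕ Fin m) × Λ) (z : ℂ) : ℂ := g a.1 z + (a.2 : ℂ)

def placedRegion (a : (Fin n ⊕ Fin m) × Λ) : Set ℂ :=
  placement Λ g a '' (protoTile P Q a.1).region

def placedVertex (a : (Fin n ⊕ Fin m) × Λ) (k : Fin 5) : ℂ :=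
  placement Λ g a ((protoTile P Q a.1).vertex k)

def placedEdge (a : (Fin n ⊕ Fin m) × Λ) (k : Fin 5) : Set ℂ :=
  pentEdge (placedVertex Λ P Q g a) k

end placed

/-- An edge-to-edge tiling of the flat torus `ℂ / Λ` by `n` tiles congruent to `P` and `m`
tiles congruent to `Q`. -/
structure TorusTiling (Λ : Submodule ℤ ℂ) (P Q : Pentagon) (n m : ℕ) where
  motion : Fin n ⊕ Fin m → (ℂ ≃ᵃⁱ[ℝ] ℂ)
  covers : ⋃ a, placedRegion Λ P Q motion a = Set.univ
  disjoint : ∀ a b, a ≠ b →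
    Disjoint (interior (placedRegion Λ P Q motion a)) (interior (placedRegion Λ P Q motion b))
  /-- Two different tiles meet only in common vertices and along common entire edges. -/
  edge_to_edge : ∀ a b, a ≠ b →
    ∀ z ∈ placedRegion Λ P Q motion a ∩ placedRegion Λ P Q motion b,
      (∃ k l, placedVertex Λ P Q motion a k = z ∧ placedVertex Λ P Q motion b l = z) ∨
      (∃ k l, placedEdge Λ P Q motion a k = placedEdge Λ P Q motion b l ∧
        z ∈ placedEdge Λ P Q motion a k)

namespace TorusTiling

variable {Λ : Submodule ℤ ℂ} {P Q : Pentagon} {n m : ℕ}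

/-- All lifts to the plane of the `k`-th side of the `i`-th tile, where `p = (i, k)`. -/
def lifts (T : TorusTiling Λ P Q n m) (p : (Fin n ⊕ Fin m) × Fin 5) : Set (Set ℂ) :=
  Set.range fun l : Λ => placedEdge Λ P Q T.motion (p.1, l) p.2

/-- Two sides of tiles are the same edge of the tiled torus iff they have the same lifts. -/
def sameEdge (T : TorusTiling Λ P Q n m) : Setoid ((Fin n ⊕ Fin m) × Fin 5) :=
  Setoid.ker T.lifts

/-- The edges of the tiled torus. -/
def Edge (T : TorusTiling Λ P Q n m) : Type := Quotient T.sameEdge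

def sideLength (_T : TorusTiling Λ P Q n m) (p : (Fin n ⊕ Fin m) × Fin 5) : ℝ :=
  dist ((protoTile P Q p.1).vertex p.2) ((protoTile P Q p.1).vertex (p.2 + 1))

theorem hausdorff_placedEdge (T : TorusTiling Λ P Q n m)
    (p : (Fin n ⊕ Fin m) × Fin 5) (l : Λ) :
    Measure.hausdorffMeasure 1 (placedEdge Λ P Q T.motion (p.1, l) p.2) =
      ENNReal.ofReal (T.sideLength p) := by
  unfold placedEdge pentEdge sideLength
  rw [hausdorffMeasure_segment, edist_dist]
  simp [placedVertex, placement]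

theorem sideLength_eq (T : TorusTiling Λ P Q n m) (p q : (Fin n ⊕ Fin m) × Fin 5)
    (h : T.sameEdge p q) : T.sideLength p = T.sideLength q := by
  have h1 : T.lifts p = T.lifts q := h
  have h2 : placedEdge Λ P Q T.motion (p.1, 0) p.2 ∈ T.lifts q := by
    rw [← h1]; exact ⟨0, rfl⟩
  obtain ⟨l, hl⟩ := h2
  have h3 := T.hausdorff_placedEdge q l
  have hl' : placedEdge Λ P Q T.motion (q.1, l) q.2 =
    placedEdge Λ P Q T.motion (p.1, 0) p.2 := hl
  rw [hl', T.hausdorff_placedEdge p 0] at h3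
  exact (ENNReal.ofReal_eq_ofReal_iff dist_nonneg dist_nonneg).1 h3

def edgeLength (T : TorusTiling Λ P Q n m) (e : T.Edge) : ℝ :=
  Quotient.lift T.sideLength T.sideLength_eq e

instance (T : TorusTiling Λ P Q n m) : Finite T.Edge :=
  inferInstanceAs (Finite (Quotient T.sameEdge))

/-- The perimeter of the tiling: the total length of its (finitely many) edges, each edge
of the torus being counted once. -/
def perimeter (T : TorusTiling Λ P Q n m) : ℝ := ∑ᶠ e : T.Edge, T.edgeLength e

def perimeterPerTile (T : TorusTiling Λ P Q n m) : ℝ := T.perimeter / ((n : ℝ) + (m : ℝ))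

end TorusTiling

end

/-!
The theorem holds because the loss of perimeter that `P` can achieve against the Cairo pentagon has
to be paid for in angles, and a full turn around a vertex leaves no angles to spare.

By Lindelöf's inequality (`IsStrictlyConvexPent.isoperimetric`), a convex pentagon of unit area with
angles `α k` has `perimeter ^ 2 ≥ 4 * ∑ cot (α k / 2)`, with equality if it is circumscribed about a
circle. For Cairo and Prismatic pentagons the right-hand side is `4 * (2 + √3)`
(`Pentagon.perimeter_sq_of_cairo_or_prismatic`). An efficient pentagon is strictly convex
(`Pentagon.IsEfficient.isStrictlyConvex`): otherwise its convex hull is a quadrilateral or a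
triangle of no larger perimeter and at least unit area, and its perimeter is at least `4`. For a
Type 2 pentagon the hull is a triangle, so the perimeter is at least `4.55`
(`Pentagon.IsType2.perimeter_ge`). Both facts rest on the trichotomy `Pentagon.shape`.

To each corner of a copy of `P` with angle `x` give the weight `cot (x / 2) - (a - b * x)`, where the
affine function is the chord through `π / 2` and `2π / 3`. At a vertex where only copies of `P` meet,
the angles add up to `2π` (seen by comparing areas of small sectors), and convexity of the cotangent
makes the total weight nonnegative: with three or fewer corners by the tangent at `2π / 3`, with
four or more by the tangent at `π / 2`. At a vertex that touches a copy of `Q` the angles of the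
copies of `P` add up to at most `2π` and the total weight is at least `-1 / 6`; there are at most
`5 * m` such vertices. As the angles of `P` sum to `3π`, the sum of all weights is
`n * (∑ cot (α k / 2) - (2 + √3))`, which is therefore at least `-5 * m / 6`
(`TorusTiling.sum_halfCot_ge`). So the copies of `P` together save less than the copies of `Q`, each
about `0.69` longer than a Cairo pentagon, cost. Finally, half-discs on the two sides of an edge
show that each edge belongs to at most two tiles (`TorusTiling.perimeters_le`), so that the total
length is at least half the sum of the perimeters.
-/

noncomputable section

/-! ### Orientation of point triples -/

/-- Twice the signed area of the triangle `a b c`; it is positive iff `c` lies strictly to the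
left of the line directed from `a` to `b`. -/
def orient (a b c : ℂ) : ℝ := (b.re - a.re) * (c.im - a.im) - (b.im - a.im) * (c.re - a.re)

theorem orient_rotate (a b c : ℂ) : orient b c a = orient a b c := by
  unfold orient; ring

theorem orient_swap (a b c : ℂ) : orient b a c = -orient a b c := by
  unfold orient; ring

theorem orient_comb (p q x y : ℂ) {s t : ℝ} (h : s + t = 1) :
    orient p q (s • x + t • y) = s * orient p q x + t * orient p q y := by
  obtain rfl : t = 1 - s := by linarith
  unfold orient
  simp only [Complex.add_re, Complex.add_im, Complex.real_smul, Complex.mul_re, Complex.mul_im,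
    Complex.ofReal_re, Complex.ofReal_im]
  ring

theorem convex_orient_nonneg (p q : ℂ) : Convex ℝ {z | 0 ≤ orient p q z} := by
  intro x hx y hy s t hs ht hst
  simp only [Set.mem_ofPred_eq] at *
  rw [orient_comb p q x y hst]
  positivity

theorem orient_nonneg_of_mem_convexHull {p q x : ℂ} {s : Set ℂ}
    (h : ∀ z ∈ s, 0 ≤ orient p q z) (hx : x ∈ convexHull ℝ s) : 0 ≤ orient p q x :=
  convexHull_min h (convex_orient_nonneg p q) hx

theorem exists_real_of_orient_eq_zero {a b c : ℂ} (hab : a ≠ b) (h : orient a b c = 0) :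
    ∃ s : ℝ, c = (1 - s) • a + s • b := by
  have h0 : (b.re - a.re) ^ 2 + (b.im - a.im) ^ 2 ≠ 0 := by
    intro h0
    apply hab
    apply Complex.ext <;> nlinarith [sq_nonneg (b.re - a.re), sq_nonneg (b.im - a.im)]
  unfold orient at h
  refine ⟨((b.re - a.re) * (c.re - a.re) + (b.im - a.im) * (c.im - a.im)) /
    ((b.re - a.re) ^ 2 + (b.im - a.im) ^ 2), ?_⟩
  apply Complex.ext
  · simp only [Complex.add_re, Complex.real_smul, Complex.mul_re, Complex.ofReal_re,
      Complex.ofReal_im]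
    field_simp
    linear_combination (-(b.im - a.im)) * h
  · simp only [Complex.add_im, Complex.real_smul, Complex.mul_im, Complex.ofReal_re,
      Complex.ofReal_im]
    field_simp
    linear_combination (b.re - a.re) * h

/-- The three ways in which a point of a line can lie relative to two others. -/
theorem mem_segment_trichotomy (a b : ℂ) (s : ℝ) :
    a ∈ segment ℝ b ((1 - s) • a + s • b) ∨ b ∈ segment ℝ a ((1 - s) • a + s • b) ∨
      (1 - s) • a + s • b ∈ segment ℝ a b := by
  rcases lt_or_ge s 0 with hs | hs
  · left
    refine ⟨-s / (1 - s), 1 / (1 - s), div_nonneg (by linarith) (by linarith),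
      div_nonneg (by linarith) (by linarith), ?_, ?_⟩
    · have : (1 - s) ≠ 0 := by linarith
      field_simp
      ring
    · have : (1 - s) ≠ 0 := by linarith
      rw [smul_add, smul_smul, smul_smul, ← add_assoc, add_right_comm, ← add_smul]
      rw [show -s / (1 - s) + 1 / (1 - s) * s = 0 by field_simp; ring,
        show 1 / (1 - s) * (1 - s) = 1 by field_simp]
      simp
  rcases le_or_gt s 1 with hs1 | hs1
  · right; right
    exact ⟨1 - s, s, by linarith, hs, by ring, rfl⟩
  · right; left
    have : s ≠ 0 := by linarith
    refine ⟨(s - 1) / s, 1 / s, div_nonneg (by linarith) (by linarith),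
      div_nonneg (by linarith) (by linarith), ?_, ?_⟩
    · field_simp
      ring
    · rw [smul_add, smul_smul, smul_smul, ← add_assoc, ← add_smul]
      rw [show (s - 1) / s + 1 / s * (1 - s) = 0 by field_simp; ring,
        show 1 / s * s = 1 by field_simp]
      simp

theorem mem_segment_of_orient_eq_zero {a b c : ℂ} (h : orient a b c = 0) :
    a ∈ segment ℝ b c ∨ b ∈ segment ℝ a c ∨ c ∈ segment ℝ a b := by
  rcases eq_or_ne a b with rfl | hab
  · exact Or.inl (left_mem_segment ℝ _ _)
  obtain ⟨s, rfl⟩ := exists_real_of_orient_eq_zero hab h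
  exact mem_segment_trichotomy a b s

/-- If a segment reaches from one side of the line `p q` to the other but misses the segment
`[p, q]`, then one of `p`, `q` lies in the triangle spanned by the other one and the segment. -/
theorem mem_convexHull_of_separated {p q a b : ℂ} (hd : Disjoint (segment ℝ p q) (segment ℝ a b))
    (h : orient p q a * orient p q b ≤ 0) (ha : orient p q a ≠ 0) :
    q ∈ convexHull ℝ {p, a, b} ∨ p ∈ convexHull ℝ {q, a, b} := by
  have hpq : p ≠ q := by
    rintro rfl
    apply ha
    unfold orient
    ring
  have hne : orient p q a - orient p q b ≠ 0 := by
    intro h0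
    have : orient p q b = orient p q a := by linarith
    rw [this] at h
    exact ha (by nlinarith [mul_self_nonneg (orient p q a)])
  set x := orient p q a
  set y := orient p q b
  set t := x / (x - y) with ht
  have ht0 : 0 ≤ t := by
    rw [ht, div_eq_mul_inv]
    have : x * (x - y)⁻¹ = (x * (x - y)) * ((x - y)⁻¹ * (x - y)⁻¹) := by
      field_simp
    rw [this]
    exact mul_nonneg (by nlinarith [mul_self_nonneg x]) (mul_self_nonneg _)
  have ht1 : 0 ≤ 1 - t := by
    have : 1 - t = (y * (y - x)) * ((x - y)⁻¹ * (x - y)⁻¹) := by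
      rw [ht]; field_simp; ring
    rw [this]
    exact mul_nonneg (by nlinarith [mul_self_nonneg y]) (mul_self_nonneg _)
  have hz : orient p q ((1 - t) • a + t • b) = 0 := by
    rw [orient_comb p q a b (by ring)]
    change (1 - t) * x + t * y = 0
    rw [ht]; field_simp; ring
  obtain ⟨s, hs⟩ := exists_real_of_orient_eq_zero hpq hz
  have hmem : (1 - t) • a + t • b ∈ segment ℝ a b := ⟨1 - t, t, ht1, ht0, by ring, rfl⟩
  have hsub : ∀ r : ℂ, segment ℝ r ((1 - t) • a + t • b) ⊆ convexHull ℝ {r, a, b} := by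
    intro r
    refine (convex_convexHull ℝ _).segment_subset (subset_convexHull ℝ _ (by simp)) ?_
    refine convexHull_mono (s := {a, b}) (by intro z; simp; tauto) ?_
    rwa [convexHull_pair]
  rcases mem_segment_trichotomy p q s with h1 | h1 | h1
  · right; rw [← hs] at h1; exact hsub _ h1
  · left; rw [← hs] at h1; exact hsub _ h1
  · rw [← hs] at h1
    exact absurd hmem (Set.disjoint_left.1 hd h1)

/-- The anti-exchange property of convex hulls. -/
theorem mem_convexHull_of_exchange {x y : ℂ} {s : Set ℂ} (hne : x ≠ y) (hs : s.Nonempty)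
    (hy : y ∈ convexHull ℝ (insert x s)) (hx : x ∈ convexHull ℝ (insert y s)) :
    x ∈ convexHull ℝ s := by
  rw [convexHull_insert hs] at hx hy
  simp only [convexJoin_singleton_left, Set.mem_iUnion] at hx hy
  obtain ⟨u, hu, a, b, ha, hb, hab, rfl⟩ := hy
  obtain ⟨w, hw, c, d, hc, hd, hcd, hx⟩ := hx
  have hb0 : b ≠ 0 := by
    rintro rfl
    apply hne
    obtain rfl : a = 1 := by linarith
    simp
  have hd0 : d ≠ 0 := by
    rintro rfl
    obtain rfl : c = 1 := by linarith
    rw [one_smul, zero_smul, add_zero] at hx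
    exact hne hx.symm
  have hbp : 0 < b := lt_of_le_of_ne hb (Ne.symm hb0)
  have hdp : 0 < d := lt_of_le_of_ne hd (Ne.symm hd0)
  have hden : 0 < c * b + d := by positivity
  have key : x = (c * b / (c * b + d)) • u + (d / (c * b + d)) • w := by
    have h1 : (c * b + d) • x = (c * b) • u + d • w := by
      have : x = (c * a) • x + (c * b) • u + d • w := by
        conv_lhs => rw [← hx]
        module
      have h2 : (c * b + d) = 1 - c * a := by
        have : a = 1 - b := by linarith
        rw [this]; linarith
      rw [h2, sub_smul, one_smul]
      nth_rewrite 1 [this]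
      module
    have : x = (c * b + d)⁻¹ • ((c * b + d) • x) := by
      rw [smul_smul, inv_mul_cancel₀ hden.ne', one_smul]
    rw [this, h1, smul_add, smul_smul, smul_smul]
    congr 2 <;> field_simp
  rw [key]
  exact (convex_convexHull ℝ s) hu hw (by positivity) (by positivity) (by field_simp)

/-! ### The shape of simple pentagons -/

/-- In a polygonal path `a b c d` whose vertices are in convex position, closed up inside the
convex hull by a further vertex `o`, all turns are in the same direction: the path runs around
the quadrilateral. -/
theorem orient_same_sign_of_path {o a b c d : ℂ}
    (h1 : Disjoint (segment ℝ a b) (segment ℝ c d))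
    (h2 : Disjoint (segment ℝ b c) (segment ℝ d o))
    (h3 : Disjoint (segment ℝ b c) (segment ℝ o a))
    (ho : o ∈ convexHull ℝ {a, b, c, d})
    (ha : a ∉ convexHull ℝ {b, c, d}) (hb : b ∉ convexHull ℝ {a, c, d})
    (hc : c ∉ convexHull ℝ {a, b, d}) (hd : d ∉ convexHull ℝ {a, b, c}) :
    (0 < orient a b c ∧ 0 < orient a b d ∧ 0 < orient a c d ∧ 0 < orient b c d) ∨
    (orient a b c < 0 ∧ orient a b d < 0 ∧ orient a c d < 0 ∧ orient b c d < 0) := by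
  have hseg : ∀ x y : ℂ, ∀ s : Set ℂ, x ∈ s → y ∈ s → segment ℝ x y ⊆ convexHull ℝ s :=
    fun x y s hx hy => (convex_convexHull ℝ s).segment_subset (subset_convexHull ℝ s hx)
      (subset_convexHull ℝ s hy)
  have n1 : orient a b c ≠ 0 := by
    intro h
    rcases mem_segment_of_orient_eq_zero h with h | h | h
    · exact ha (hseg _ _ _ (by simp) (by simp) h)
    · exact hb (hseg _ _ _ (by simp) (by simp) h)
    · exact hc (hseg _ _ _ (by simp) (by simp) h)
  have n2 : orient a b d ≠ 0 := by
    intro h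
    rcases mem_segment_of_orient_eq_zero h with h | h | h
    · exact ha (hseg _ _ _ (by simp) (by simp) h)
    · exact hb (hseg _ _ _ (by simp) (by simp) h)
    · exact hd (hseg _ _ _ (by simp) (by simp) h)
  have n3 : orient a c d ≠ 0 := by
    intro h
    rcases mem_segment_of_orient_eq_zero h with h | h | h
    · exact ha (hseg _ _ _ (by simp) (by simp) h)
    · exact hc (hseg _ _ _ (by simp) (by simp) h)
    · exact hd (hseg _ _ _ (by simp) (by simp) h)
  have n4 : orient b c d ≠ 0 := by
    intro h
    rcases mem_segment_of_orient_eq_zero h with h | h | h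
    · exact hb (hseg _ _ _ (by simp) (by simp) h)
    · exact hc (hseg _ _ _ (by simp) (by simp) h)
    · exact hd (hseg _ _ _ (by simp) (by simp) h)
  have e1 : orient c d a = orient a c d := (orient_rotate a c d)
  have e2 : orient c d b = orient b c d := (orient_rotate b c d)
  have e3 : orient b c a = orient a b c := (orient_rotate a b c)
  have p1 : 0 < orient a b c * orient a b d := by
    by_contra h
    rcases mem_convexHull_of_separated h1 (not_lt.1 h) n1 with h | h
    · exact hb (by convert h using 2)
    · exact ha h
  have p2 : 0 < orient c d a * orient c d b := by
    by_contra h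
    rcases mem_convexHull_of_separated h1.symm (not_lt.1 h) (e1 ▸ n3) with h | h
    · exact hd (by convert h using 2; ext; simp; tauto)
    · exact hc (by convert h using 2; ext; simp; tauto)
  have hba : b ≠ a := by rintro rfl; exact hb (subset_convexHull ℝ _ (by simp))
  have hob : o ≠ b := by
    rintro rfl
    exact Set.disjoint_left.1 h2 (left_mem_segment ℝ _ _) (right_mem_segment ℝ _ _)
  have hoc : o ≠ c := by
    rintro rfl
    exact Set.disjoint_left.1 h2 (right_mem_segment ℝ _ _) (right_mem_segment ℝ _ _)
  -- neither `b` nor `c` can be enclosed by the other vertices together with `o`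
  have xb : b ∉ convexHull ℝ (insert o {a, c, d}) := fun h =>
    hb (mem_convexHull_of_exchange hob.symm (by simp)
      (by convert ho using 2; ext; simp; tauto) h)
  have xc : c ∉ convexHull ℝ (insert o {a, b, d}) := fun h =>
    hc (mem_convexHull_of_exchange hoc.symm (by simp)
      (by convert ho using 2; ext; simp; tauto) h)
  have p3 : 0 < orient b c a * orient b c d := by
    by_contra h
    have h := not_lt.1 h
    have n5 : orient b c a ≠ 0 := e3 ▸ n1
    by_cases h6 : orient b c a * orient b c o ≤ 0
    · rw [segment_symm ℝ o a] at h3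
      rcases mem_convexHull_of_separated h3 h6 n5 with h | h
      · exact xc (convexHull_mono (by intro z; simp; tauto) h)
      · exact xb (convexHull_mono (by intro z; simp; tauto) h)
    · have h7 : orient b c d * orient b c o ≤ 0 := by
        by_contra h7
        have : 0 < (orient b c a * orient b c o) * (orient b c d * orient b c o) :=
          mul_pos (not_le.1 h6) (not_le.1 h7)
        nlinarith [mul_self_nonneg (orient b c o)]
      rcases mem_convexHull_of_separated h2 h7 n4 with h | h
      · exact xc (convexHull_mono (by intro z; simp; tauto) h)
      · exact xb (convexHull_mono (by intro z; simp; tauto) h)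
  rw [e1, e2] at p2
  rw [e3] at p3
  rcases lt_or_gt_of_ne n1 with h | h
  · right
    have h4 := (neg_iff_neg_of_mul_pos p3).1 h
    exact ⟨h, (neg_iff_neg_of_mul_pos p1).1 h, (neg_iff_neg_of_mul_pos p2).2 h4, h4⟩
  · left
    have h4 := (pos_iff_pos_of_mul_pos p3).1 h
    exact ⟨h, (pos_iff_pos_of_mul_pos p1).1 h, (pos_iff_pos_of_mul_pos p2).2 h4, h4⟩

/-- The closed path `v` runs counterclockwise around a strictly convex pentagon: all other vertices
lie strictly to the left of each edge. -/
def IsStrictlyConvexPent (v : Fin 5 → ℂ) : Prop :=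
  ∀ i j, j ≠ i → j ≠ i + 1 → 0 < orient (v i) (v (i + 1)) (v j)

theorem pentSignedArea_eq_fan (v : Fin 5 → ℂ) (o : ℂ) :
    pentSignedArea v = (∑ i, orient o (v i) (v (i + 1))) / 2 := by
  simp only [pentSignedArea, orient, Fin.sum_univ_five, Fin.isValue, Fin.reduceAdd, zero_add]
  ring

theorem pentSignedArea_eq_triangles (v : Fin 5 → ℂ) (i : Fin 5) :
    pentSignedArea v = (orient (v i) (v (i + 1)) (v (i + 2)) +
      orient (v i) (v (i + 2)) (v (i + 3)) + orient (v i) (v (i + 3)) (v (i + 4))) / 2 := by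
  have : pentSignedArea v = pentSignedArea fun k => v (k + i) := by
    unfold pentSignedArea
    rw [← Equiv.sum_comp (Equiv.addRight i)]
    simp [add_right_comm]
  rw [this, pentSignedArea_eq_fan _ (v i)]
  simp only [Fin.sum_univ_five, Fin.isValue, Fin.reduceAdd, add_comm _ i, add_zero]
  unfold orient
  ring

theorem IsSimplePent.disjoint_edges {v : Fin 5 → ℂ} (hv : IsSimplePent v) (i : Fin 5) :
    Disjoint (segment ℝ (v i) (v (i + 1))) (segment ℝ (v (i + 2)) (v (i + 3))) := by
  have := hv.2 i
  rwa [pentEdge, pentEdge, add_assoc i 2 1] at this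

theorem IsSimplePent.injective {v : Fin 5 → ℂ} (hv : IsSimplePent v) : Function.Injective v := by
  have h1 : ∀ i, v i ≠ v (i + 1) := by
    intro i h
    have h2 : v i ∈ pentEdge v (i + 4) ∩ pentEdge v (i + 4 + 1) := by
      refine ⟨?_, ?_⟩
      · rw [pentEdge, add_assoc i 4 1, show (4 : Fin 5) + 1 = 0 from rfl, add_zero]
        exact right_mem_segment ℝ _ _
      · rw [add_assoc i 4 1, show (4 : Fin 5) + 1 = 0 from rfl, add_zero]
        exact left_mem_segment ℝ _ _
    have h3 : v i ∈ pentEdge v (i + 1) := by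
      rw [h]; exact left_mem_segment ℝ _ _
    have h4 : v i ∈ pentEdge v (i + 4) := h2.1
    have h5 := hv.2 (i + 4)
    rw [show i + 4 + 2 = i + 1 by rw [add_assoc]; rfl] at h5
    exact Set.disjoint_left.1 h5 h4 h3
  have h2 : ∀ i, v i ≠ v (i + 2) := by
    intro i h
    refine Set.disjoint_left.1 (hv.2 i) (left_mem_segment ℝ _ _) ?_
    rw [h]; exact left_mem_segment ℝ _ _
  intro i j hij
  have h3 : ∀ i j : Fin 5, i = j ∨ j = i + 1 ∨ j = i + 2 ∨ i = j + 1 ∨ i = j + 2 := by decide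
  rcases h3 i j with h | h | h | h | h
  · exact h
  · exact absurd hij (h ▸ h1 i)
  · exact absurd hij (h ▸ h2 i)
  · exact absurd hij.symm (h ▸ h1 j)
  · exact absurd hij.symm (h ▸ h2 j)

/-- A simple path through five points in convex position runs around their convex hull. -/
theorem IsSimplePent.isStrictlyConvexPent {v : Fin 5 → ℂ} (hv : IsSimplePent v)
    (hA : 0 < pentSignedArea v) (hc : ∀ i, v i ∉ convexHull ℝ (v '' {i}ᶜ)) :
    IsStrictlyConvexPent v := by
  have hmem : ∀ i j : Fin 5, j ≠ i → v j ∈ v '' {i}ᶜ := fun i j h => ⟨j, h, rfl⟩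
  have hn : ∀ i j k : Fin 5, i ≠ j → i ≠ k → j ≠ k → orient (v i) (v j) (v k) ≠ 0 := by
    intro i j k hij hik hjk h
    have hseg : ∀ x y z : Fin 5, x ≠ y → x ≠ z → v x ∉ segment ℝ (v y) (v z) :=
      fun x y z hy hz h => hc x ((convex_convexHull ℝ _).segment_subset
        (subset_convexHull ℝ _ (hmem x y hy.symm)) (subset_convexHull ℝ _ (hmem x z hz.symm)) h)
    rcases mem_segment_of_orient_eq_zero h with h | h | h
    · exact hseg _ _ _ hij hik h
    · exact hseg _ _ _ hij.symm hjk h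
    · exact hseg _ _ _ hik.symm hjk.symm h
  have hsep : ∀ i k l : Fin 5, k ≠ i → k ≠ i + 1 → l ≠ i → l ≠ i + 1 →
      Disjoint (segment ℝ (v i) (v (i + 1))) (segment ℝ (v k) (v l)) →
      0 < orient (v i) (v (i + 1)) (v k) * orient (v i) (v (i + 1)) (v l) := by
    intro i k l hk hk1 hl hl1 hd
    have hi : i ≠ i + 1 := by clear * -; revert i; decide
    by_contra h
    rcases mem_convexHull_of_separated hd (not_lt.1 h) (hn _ _ _ hi hk.symm hk1.symm) with h | h
    · refine hc (i + 1) (convexHull_mono ?_ h)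
      rintro z (rfl | rfl | rfl)
      · exact hmem _ _ hi
      · exact hmem _ _ hk1
      · exact hmem _ _ hl1
    · refine hc i (convexHull_mono ?_ h)
      rintro z (rfl | rfl | rfl)
      · exact hmem _ _ hi.symm
      · exact hmem _ _ hk
      · exact hmem _ _ hl
  have p1 : ∀ i, 0 < orient (v i) (v (i + 1)) (v (i + 2)) * orient (v i) (v (i + 1)) (v (i + 3)) :=
    fun i => hsep i _ _ (by revert i; decide) (by revert i; decide) (by revert i; decide)
      (by revert i; decide) (hv.disjoint_edges i)
  have p2 : ∀ i, 0 < orient (v i) (v (i + 1)) (v (i + 3)) * orient (v i) (v (i + 1)) (v (i + 4)) := by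
    intro i
    refine hsep i _ _ (by revert i; decide) (by revert i; decide) (by revert i; decide)
      (by revert i; decide) ?_
    have := (hv.disjoint_edges (i + 3)).symm
    rwa [add_assoc i 3 1, add_assoc i 3 2, add_assoc i 3 3, show (3 : Fin 5) + 1 = 4 from rfl,
      show (3 : Fin 5) + 2 = 0 from rfl, show (3 : Fin 5) + 3 = 1 from rfl, add_zero] at this
  have e : ∀ i, orient (v i) (v (i + 1)) (v (i + 4)) =
      orient (v (i + 4)) (v (i + 4 + 1)) (v (i + 4 + 2)) := by
    intro i
    rw [add_assoc i 4 1, add_assoc i 4 2, show (4 : Fin 5) + 1 = 0 from rfl,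
      show (4 : Fin 5) + 2 = 1 from rfl, add_zero, orient_rotate]
  have step : ∀ i, 0 < orient (v i) (v (i + 1)) (v (i + 2)) →
      0 < orient (v (i + 4)) (v (i + 4 + 1)) (v (i + 4 + 2)) := by
    intro i h
    rw [← e]
    exact (pos_iff_pos_of_mul_pos (p2 i)).1 ((pos_iff_pos_of_mul_pos (p1 i)).1 h)
  have all : ∀ i, 0 < orient (v i) (v (i + 1)) (v (i + 2)) →
      ∀ j, 0 < orient (v j) (v (j + 1)) (v (j + 2)) := by
    intro i h0 j
    have h1 := step _ h0
    have h2 := step _ h1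
    have h3 := step _ h2
    have h4 := step _ h3
    have : ∀ i j : Fin 5, j = i ∨ j = i + 4 ∨ j = i + 4 + 4 ∨ j = i + 4 + 4 + 4 ∨
      j = i + 4 + 4 + 4 + 4 := by decide
    rcases this i j with h | h | h | h | h <;> rw [h] <;> assumption
  have pos : ∀ j, 0 < orient (v j) (v (j + 1)) (v (j + 2)) := by
    by_contra hneg
    push Not at hneg
    obtain ⟨j, hj⟩ := hneg
    have hneg : ∀ k, orient (v k) (v (k + 1)) (v (k + 2)) < 0 := by
      intro k
      refine lt_of_le_of_ne ?_ (hn _ _ _ (by revert k; decide) (by revert k; decide)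
        (by revert k; decide))
      by_contra hk
      exact absurd (all k (not_le.1 hk) j) (not_lt.2 hj)
    have h1 := hneg 0
    have h2 := (neg_iff_neg_of_mul_pos (p1 2)).1 (hneg 2)
    have h3 := hneg 3
    have := pentSignedArea_eq_triangles v 0
    simp only [zero_add, Fin.isValue, Fin.reduceAdd] at h1 h2 h3 this
    rw [orient_rotate] at h2 h3
    linarith
  intro i j hj hj1
  have h2 := (pos_iff_pos_of_mul_pos (p1 i)).1 (pos i)
  have h3 := (pos_iff_pos_of_mul_pos (p2 i)).1 h2
  have : ∀ i j : Fin 5, j ≠ i → j ≠ i + 1 → j = i + 2 ∨ j = i + 3 ∨ j = i + 4 := by decide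
  rcases this i j hj hj1 with rfl | rfl | rfl
  exacts [pos i, h2, h3]

/-- The three possible shapes of a pentagon, according to its convex hull: a strictly convex
pentagon, a strictly convex quadrilateral with the remaining vertex inside or on its boundary, or
a (possibly degenerate) triangle. -/
theorem Pentagon.shape (P : Pentagon) :
    IsStrictlyConvexPent P.vertex ∨
    (∃ i, P.vertex i ∈ convexHull ℝ
        {P.vertex (i + 1), P.vertex (i + 2), P.vertex (i + 3), P.vertex (i + 4)} ∧
      0 < orient (P.vertex (i + 1)) (P.vertex (i + 2)) (P.vertex (i + 3)) ∧
      0 < orient (P.vertex (i + 1)) (P.vertex (i + 2)) (P.vertex (i + 4)) ∧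
      0 < orient (P.vertex (i + 1)) (P.vertex (i + 3)) (P.vertex (i + 4)) ∧
      0 < orient (P.vertex (i + 2)) (P.vertex (i + 3)) (P.vertex (i + 4))) ∨
    (∃ i, Set.range P.vertex ⊆
        convexHull ℝ {P.vertex i, P.vertex (i + 1), P.vertex (i + 2)} ∨
      Set.range P.vertex ⊆
        convexHull ℝ {P.vertex i, P.vertex (i + 1), P.vertex (i + 3)}) := by
  set v := P.vertex with hvdef
  by_cases hc : ∀ i, v i ∉ convexHull ℝ (v '' {i}ᶜ)
  · exact Or.inl (P.simple.isStrictlyConvexPent P.ccw hc)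
  right
  push Not at hc
  obtain ⟨i, hi⟩ := hc
  have himg : v '' {i}ᶜ = {v (i + 1), v (i + 2), v (i + 3), v (i + 4)} := by
    ext z
    constructor
    · rintro ⟨j, hj, rfl⟩
      have : ∀ i j : Fin 5, j ≠ i → j = i + 1 ∨ j = i + 2 ∨ j = i + 3 ∨ j = i + 4 := by decide
      rcases this i j hj with rfl | rfl | rfl | rfl <;> simp
    · rintro (rfl | rfl | rfl | rfl)
      all_goals exact ⟨_, by simp only [Set.mem_compl_iff, Set.mem_singleton_iff]; clear * -; revert i; decide, rfl⟩
  rw [himg] at hi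
  have hrange : ∀ s : Set ℂ, {v (i + 1), v (i + 2), v (i + 3), v (i + 4)} ⊆ convexHull ℝ s →
      Set.range v ⊆ convexHull ℝ s := by
    rintro s hs _ ⟨j, rfl⟩
    have : ∀ i j : Fin 5, j = i ∨ j = i + 1 ∨ j = i + 2 ∨ j = i + 3 ∨ j = i + 4 := by decide
    rcases this i j with rfl | rfl | rfl | rfl | rfl
    · exact convexHull_min hs (convex_convexHull ℝ s) hi
    all_goals exact hs (by simp)
  have hself : ∀ (z : ℂ) (s : Set ℂ), z ∈ s → z ∈ convexHull ℝ s :=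
    fun z s h => subset_convexHull ℝ s h
  by_cases ha : v (i + 1) ∈ convexHull ℝ {v (i + 2), v (i + 3), v (i + 4)}
  · right
    refine ⟨i + 2, Or.inl ?_⟩
    rw [add_assoc i 2 1, add_assoc i 2 2]
    refine hrange _ ?_
    rintro z (rfl | rfl | rfl | rfl)
    exacts [ha, hself _ _ (by simp), hself _ _ (by simp), hself _ _ (by simp)]
  by_cases hb : v (i + 2) ∈ convexHull ℝ {v (i + 1), v (i + 3), v (i + 4)}
  · right
    refine ⟨i + 3, Or.inr ?_⟩
    rw [add_assoc i 3 1, add_assoc i 3 3, show (3 : Fin 5) + 1 = 4 from rfl,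
      show (3 : Fin 5) + 3 = 1 from rfl]
    refine hrange _ ?_
    have : ({v (i + 3), v (i + 4), v (i + 1)} : Set ℂ) = {v (i + 1), v (i + 3), v (i + 4)} := by
      ext; simp; tauto
    rw [this]
    rintro z (rfl | rfl | rfl | rfl)
    exacts [hself _ _ (by simp), hb, hself _ _ (by simp), hself _ _ (by simp)]
  by_cases hc : v (i + 3) ∈ convexHull ℝ {v (i + 1), v (i + 2), v (i + 4)}
  · right
    refine ⟨i + 1, Or.inr ?_⟩
    rw [add_assoc i 1 1, add_assoc i 1 3, show (1 : Fin 5) + 1 = 2 from rfl,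
      show (1 : Fin 5) + 3 = 4 from rfl]
    refine hrange _ ?_
    rintro z (rfl | rfl | rfl | rfl)
    exacts [hself _ _ (by simp), hself _ _ (by simp), hc, hself _ _ (by simp)]
  by_cases hd : v (i + 4) ∈ convexHull ℝ {v (i + 1), v (i + 2), v (i + 3)}
  · right
    refine ⟨i + 1, Or.inl ?_⟩
    rw [add_assoc i 1 1, add_assoc i 1 2, show (1 : Fin 5) + 1 = 2 from rfl,
      show (1 : Fin 5) + 2 = 3 from rfl]
    refine hrange _ ?_
    rintro z (rfl | rfl | rfl | rfl)
    exacts [hself _ _ (by simp), hself _ _ (by simp), hself _ _ (by simp), hd]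
  left
  refine ⟨i, hi, ?_⟩
  have d1 := P.simple.disjoint_edges (i + 1)
  have d2 := P.simple.disjoint_edges (i + 2)
  have d3 := (P.simple.disjoint_edges i).symm
  rw [add_assoc i 1 1, add_assoc i 1 2, add_assoc i 1 3, show (1 : Fin 5) + 1 = 2 from rfl,
    show (1 : Fin 5) + 2 = 3 from rfl, show (1 : Fin 5) + 3 = 4 from rfl, ← hvdef] at d1
  rw [add_assoc i 2 1, add_assoc i 2 2, add_assoc i 2 3, show (2 : Fin 5) + 1 = 3 from rfl,
    show (2 : Fin 5) + 2 = 4 from rfl, show (2 : Fin 5) + 3 = 0 from rfl, add_zero, ← hvdef] at d2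
  rw [← hvdef] at d3
  rcases orient_same_sign_of_path d1 d2 d3 hi ha hb hc hd with h | ⟨h1, h2, h3, h4⟩
  · exact h
  -- the path around the quadrilateral cannot run clockwise, as the signed area is positive
  exfalso
  have hneg : ∀ p q : ℂ, (∀ z ∈ ({v (i + 1), v (i + 2), v (i + 3), v (i + 4)} : Set ℂ),
      0 ≤ orient q p z) → orient p q (v i) ≤ 0 := by
    intro p q h
    have := orient_nonneg_of_mem_convexHull h hi
    rw [orient_swap] at this
    linarith
  have k1 : orient (v (i + 1)) (v (i + 2)) (v i) ≤ 0 := by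
    apply hneg
    rintro z (rfl | rfl | rfl | rfl) <;> unfold orient at * <;> nlinarith
  have k2 : orient (v (i + 2)) (v (i + 3)) (v i) ≤ 0 := by
    apply hneg
    rintro z (rfl | rfl | rfl | rfl) <;> unfold orient at * <;> nlinarith
  have k3 : orient (v (i + 3)) (v (i + 4)) (v i) ≤ 0 := by
    apply hneg
    rintro z (rfl | rfl | rfl | rfl) <;> unfold orient at * <;> nlinarith
  have := pentSignedArea_eq_triangles v i
  rw [orient_rotate] at k1 k2 k3
  have hA : 0 < pentSignedArea v := P.ccw
  linarith

/-! ### Areas of triangles and of strictly convex pentagons -/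

theorem volume_unitTriangle :
    volume {z : ℂ | 0 ≤ z.re ∧ 0 ≤ z.im ∧ z.re + z.im ≤ 1} = ENNReal.ofReal (1 / 2) := by
  have hS : MeasurableSet {p : ℝ × ℝ | 0 ≤ p.1 ∧ 0 ≤ p.2 ∧ p.1 + p.2 ≤ 1} := by
    apply IsClosed.measurableSet
    exact (isClosed_le continuous_const continuous_fst).inter
      ((isClosed_le continuous_const continuous_snd).inter
        (isClosed_le (continuous_fst.add continuous_snd) continuous_const))
  have h1 : {z : ℂ | 0 ≤ z.re ∧ 0 ≤ z.im ∧ z.re + z.im ≤ 1} =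
      Complex.measurableEquivRealProd ⁻¹' {p : ℝ × ℝ | 0 ≤ p.1 ∧ 0 ≤ p.2 ∧ p.1 + p.2 ≤ 1} := by
    ext z; simp [Complex.measurableEquivRealProd_apply]
  rw [h1, Complex.volume_preserving_equiv_real_prod.measure_preimage hS.nullMeasurableSet,
    Measure.volume_eq_prod, Measure.prod_apply hS]
  have h2 : ∀ x : ℝ, volume (Prod.mk x ⁻¹' {p : ℝ × ℝ | 0 ≤ p.1 ∧ 0 ≤ p.2 ∧ p.1 + p.2 ≤ 1}) =
      (Set.Icc (0 : ℝ) 1).indicator (fun x => ENNReal.ofReal (1 - x)) x := by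
    intro x
    by_cases hx : x ∈ Set.Icc (0 : ℝ) 1
    · rw [Set.indicator_of_mem hx]
      have : Prod.mk x ⁻¹' {p : ℝ × ℝ | 0 ≤ p.1 ∧ 0 ≤ p.2 ∧ p.1 + p.2 ≤ 1} =
          Set.Icc 0 (1 - x) := by
        ext y
        simp only [Set.mem_preimage, Set.mem_ofPred_eq, Set.mem_Icc]
        constructor
        · rintro ⟨_, h, h'⟩; exact ⟨h, by linarith⟩
        · rintro ⟨h, h'⟩; exact ⟨hx.1, h, by linarith⟩
      rw [this, Real.volume_Icc, sub_zero]
    · rw [Set.indicator_of_notMem hx]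
      have : Prod.mk x ⁻¹' {p : ℝ × ℝ | 0 ≤ p.1 ∧ 0 ≤ p.2 ∧ p.1 + p.2 ≤ 1} = ∅ := by
        ext y
        simp only [Set.mem_preimage, Set.mem_ofPred_eq, Set.mem_empty_iff_false, iff_false]
        rintro ⟨h0, h, h'⟩
        exact hx ⟨h0, by linarith⟩
      rw [this, measure_empty]
  simp_rw [h2]
  rw [lintegral_indicator measurableSet_Icc, ← ofReal_integral_eq_lintegral_ofReal]
  · congr 1
    rw [integral_Icc_eq_integral_Ioc, ← intervalIntegral.integral_of_le zero_le_one,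
      intervalIntegral.integral_sub intervalIntegrable_const intervalIntegral.intervalIntegrable_id]
    norm_num [integral_id]
  · exact (continuous_const.sub continuous_id).continuousOn.integrableOn_Icc
  · filter_upwards [self_mem_ae_restrict measurableSet_Icc] with x hx
    simpa using hx.2

/-- The linear part of the affine map that takes `0, 1, i` to `a, b, c`. -/
def triangleMap (a b c : ℂ) : ℂ →ₗ[ℝ] ℂ :=
  Complex.reLm.smulRight (b - a) + Complex.imLm.smulRight (c - a)

theorem triangleMap_apply (a b c z : ℂ) :
    triangleMap a b c z = z.re • (b - a) + z.im • (c - a) := by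
  simp [triangleMap]

theorem det_triangleMap (a b c : ℂ) : LinearMap.det (triangleMap a b c) = orient a b c := by
  rw [← LinearMap.det_toMatrix Complex.basisOneI, Matrix.det_fin_two]
  simp [LinearMap.toMatrix_apply, triangleMap_apply, orient]
  ring

theorem volume_image_triangleMap (a b c : ℂ) (s : Set ℂ) :
    volume ((fun z => a + triangleMap a b c z) '' s) =
      ENNReal.ofReal |orient a b c| * volume s := by
  have : (fun z => a + triangleMap a b c z) '' s = (fun z => a + z) '' (triangleMap a b c '' s) := by
    rw [Set.image_image]
  rw [this, Set.image_add_left, measure_preimage_add, Measure.addHaar_image_linearMap,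
    det_triangleMap]

theorem convexHull_triple_eq_image (a b c : ℂ) :
    convexHull ℝ {a, b, c} =
      (fun z => a + triangleMap a b c z) '' {z : ℂ | 0 ≤ z.re ∧ 0 ≤ z.im ∧ z.re + z.im ≤ 1} := by
  apply Set.Subset.antisymm
  · apply convexHull_min
    · rintro z (rfl | rfl | rfl)
      · exact ⟨0, by simp, by simp⟩
      · exact ⟨1, by simp, by simp [triangleMap_apply]⟩
      · exact ⟨Complex.I, by simp, by simp [triangleMap_apply]⟩
    · have hc : Convex ℝ {z : ℂ | 0 ≤ z.re ∧ 0 ≤ z.im ∧ z.re + z.im ≤ 1} := by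
        rintro x ⟨h1, h2, h3⟩ y ⟨h4, h5, h6⟩ s t hs ht hst
        simp only [Set.mem_ofPred_eq, Complex.add_re, Complex.add_im, Complex.real_smul,
          Complex.mul_re, Complex.mul_im, Complex.ofReal_re, Complex.ofReal_im, zero_mul, sub_zero,
          add_zero]
        refine ⟨by positivity, by positivity, ?_⟩
        nlinarith
      have := (hc.linear_image (triangleMap a b c)).translate a
      rwa [Set.image_image] at this
  · rintro _ ⟨z, ⟨h1, h2, h3⟩, rfl⟩
    have : a + triangleMap a b c z = (1 - z.re - z.im) • a + z.re • b + z.im • c := by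
      rw [triangleMap_apply]; module
    simp only [this]
    have hm : ∀ x ∈ ({a, b, c} : Set ℂ), x ∈ convexHull ℝ ({a, b, c} : Set ℂ) :=
      fun x hx => subset_convexHull ℝ _ hx
    have hsum := (convex_convexHull ℝ ({a, b, c} : Set ℂ)).sum_mem (t := Finset.univ)
      (w := ![1 - z.re - z.im, z.re, z.im]) (z := ![a, b, c])
      (by intro i _; fin_cases i <;> simp <;> linarith)
      (by simp [Fin.sum_univ_three]; ring)
      (by intro i _; fin_cases i <;> exact hm _ (by simp))
    simpa [Fin.sum_univ_three] using hsum

theorem volume_convexHull_triple (a b c : ℂ) :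
    volume (convexHull ℝ {a, b, c}) = ENNReal.ofReal (|orient a b c| / 2) := by
  rw [convexHull_triple_eq_image, volume_image_triangleMap, volume_unitTriangle,
    ← ENNReal.ofReal_mul (abs_nonneg _)]
  congr 1
  ring

theorem volume_line {p q : ℂ} (h : p ≠ q) : volume {z | orient p q z = 0} = 0 := by
  refine measure_mono_null (t := (fun z => p + triangleMap p q p z) '' Set.univ) ?_ ?_
  · intro z hz
    obtain ⟨s, rfl⟩ := exists_real_of_orient_eq_zero h hz
    refine ⟨s, trivial, ?_⟩
    simp only [triangleMap_apply, Complex.ofReal_re, Complex.ofReal_im]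
    module
  · rw [volume_image_triangleMap]
    simp [orient]

theorem mem_convexHull_triple {a b c z : ℂ} (h : 0 < orient a b c) (h1 : 0 ≤ orient a b z)
    (h2 : 0 ≤ orient b c z) (h3 : 0 ≤ orient c a z) : z ∈ convexHull ℝ {a, b, c} := by
  rw [convexHull_triple_eq_image]
  refine ⟨⟨orient c a z / orient a b c, orient a b z / orient a b c⟩, ⟨?_, ?_, ?_⟩, ?_⟩
  · exact div_nonneg h3 h.le
  · exact div_nonneg h1 h.le
  · simp only
    rw [← add_div, div_le_one h]
    have : orient c a z + orient a b z + orient b c z = orient a b c := by unfold orient; ring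
    linarith
  · simp only [triangleMap_apply]
    have h0 : orient a b c ≠ 0 := h.ne'
    apply Complex.ext <;>
    · simp only [Complex.add_re, Complex.add_im, Complex.real_smul, Complex.mul_re, Complex.mul_im,
        Complex.ofReal_re, Complex.ofReal_im, Complex.sub_re, Complex.sub_im]
      field_simp
      unfold orient
      ring

theorem continuous_orient (p q : ℂ) : Continuous (orient p q) := by
  unfold orient
  fun_prop

/-- A strictly convex quadrilateral is covered by the two triangles cut off by a diagonal. -/
theorem volume_convexHull_quadruple_le {a b c d : ℂ} (h1 : 0 < orient a b c)
    (h2 : 0 < orient a b d) (h3 : 0 < orient a c d) (h4 : 0 < orient b c d) :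
    volume (convexHull ℝ {a, b, c, d}) ≤ ENNReal.ofReal ((orient a b c + orient a c d) / 2) := by
  have hsub : convexHull ℝ {a, b, c, d} ⊆ convexHull ℝ {a, b, c} ∪ convexHull ℝ {a, c, d} := by
    intro z hz
    have k1 : 0 ≤ orient a b z := by
      refine orient_nonneg_of_mem_convexHull ?_ hz
      rintro z (rfl | rfl | rfl | rfl) <;> unfold orient at * <;> nlinarith
    have k2 : 0 ≤ orient b c z := by
      refine orient_nonneg_of_mem_convexHull ?_ hz
      rintro z (rfl | rfl | rfl | rfl) <;> unfold orient at * <;> nlinarith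
    have k3 : 0 ≤ orient c d z := by
      refine orient_nonneg_of_mem_convexHull ?_ hz
      rintro z (rfl | rfl | rfl | rfl) <;> unfold orient at * <;> nlinarith
    have k4 : 0 ≤ orient d a z := by
      refine orient_nonneg_of_mem_convexHull ?_ hz
      rintro z (rfl | rfl | rfl | rfl) <;> unfold orient at * <;> nlinarith
    rcases le_total 0 (orient a c z) with h | h
    · exact Or.inr (mem_convexHull_triple h3 h k3 k4)
    · refine Or.inl (mem_convexHull_triple h1 k1 k2 ?_)
      rw [orient_swap]; linarith
  refine (measure_mono hsub).trans ((measure_union_le _ _).trans ?_)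
  rw [volume_convexHull_triple, volume_convexHull_triple, abs_of_pos h1, abs_of_pos h3, add_div,
    ENNReal.ofReal_add (by linarith) (by linarith)]

/-- The intersection of the closed half-planes to the left of the edges of `v`. -/
def leftRegion (v : Fin 5 → ℂ) : Set ℂ := {z | ∀ i, 0 ≤ orient (v i) (v (i + 1)) z}

theorem convex_leftRegion (v : Fin 5 → ℂ) : Convex ℝ (leftRegion v) := by
  have : leftRegion v = ⋂ i, {z | 0 ≤ orient (v i) (v (i + 1)) z} := by
    ext; simp [leftRegion]
  rw [this]
  exact convex_iInter fun i => convex_orient_nonneg _ _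

theorem IsStrictlyConvexPent.vertex_mem_leftRegion {v : Fin 5 → ℂ} (hv : IsStrictlyConvexPent v)
    (j : Fin 5) : v j ∈ leftRegion v := by
  intro i
  by_cases h1 : j = i
  · rw [h1]; unfold orient; apply le_of_eq; ring
  by_cases h2 : j = i + 1
  · rw [h2]; unfold orient; apply le_of_eq; ring
  exact (hv i j h1 h2).le

theorem IsStrictlyConvexPent.volume_leftRegion {v : Fin 5 → ℂ} (hv : IsStrictlyConvexPent v) :
    volume (leftRegion v) = ENNReal.ofReal (pentSignedArea v) := by
  have t1 : 0 < orient (v 0) (v 1) (v 2) := hv 0 2 (by decide) (by decide)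
  have t2 : 0 < orient (v 0) (v 2) (v 3) := by
    rw [← orient_rotate]; exact hv 2 0 (by decide) (by decide)
  have t3 : 0 < orient (v 0) (v 3) (v 4) := by
    rw [← orient_rotate]; exact hv 3 0 (by decide) (by decide)
  have hsub : ∀ i j k, convexHull ℝ {v i, v j, v k} ⊆ leftRegion v := by
    intro i j k
    apply convexHull_min _ (convex_leftRegion v)
    rintro z (rfl | rfl | rfl) <;> exact hv.vertex_mem_leftRegion _
  have heq : leftRegion v = convexHull ℝ {v 0, v 1, v 2} ∪
      (convexHull ℝ {v 0, v 2, v 3} ∪ convexHull ℝ {v 0, v 3, v 4}) := by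
    apply Set.Subset.antisymm
    · intro z hz
      have e0 : 0 ≤ orient (v 0) (v 1) z := hz 0
      have e1 : 0 ≤ orient (v 1) (v 2) z := hz 1
      have e2 : 0 ≤ orient (v 2) (v 3) z := hz 2
      have e3 : 0 ≤ orient (v 3) (v 4) z := hz 3
      have e4 : 0 ≤ orient (v 4) (v 0) z := hz 4
      rcases le_total 0 (orient (v 0) (v 2) z) with h | h
      · rcases le_total 0 (orient (v 0) (v 3) z) with h' | h'
        · exact Or.inr (Or.inr (mem_convexHull_triple t3 h' e3 e4))
        · refine Or.inr (Or.inl (mem_convexHull_triple t2 h e2 ?_))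
          rw [orient_swap]; linarith
      · refine Or.inl (mem_convexHull_triple t1 e0 e1 ?_)
        rw [orient_swap]; linarith
    · exact Set.union_subset (hsub _ _ _) (Set.union_subset (hsub _ _ _) (hsub _ _ _))
  have hself1 : ∀ a b : ℂ, orient a b a = 0 := fun a b => by unfold orient; ring
  have hself2 : ∀ a b : ℂ, orient a b b = 0 := fun a b => by unfold orient; ring
  have s02 : ∀ z ∈ convexHull ℝ {v 0, v 1, v 2}, 0 ≤ orient (v 2) (v 0) z := fun z hz => by
    refine orient_nonneg_of_mem_convexHull ?_ hz
    rintro z (rfl | rfl | rfl)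
    exacts [(hself2 _ _).ge, by rw [orient_rotate (v 1), orient_rotate (v 0)]; exact t1.le, (hself1 _ _).ge]
  have s03 : ∀ z ∈ convexHull ℝ {v 0, v 2, v 3}, 0 ≤ orient (v 3) (v 0) z := fun z hz => by
    refine orient_nonneg_of_mem_convexHull ?_ hz
    rintro z (rfl | rfl | rfl)
    exacts [(hself2 _ _).ge, by rw [orient_rotate (v 2), orient_rotate (v 0)]; exact t2.le, (hself1 _ _).ge]
  have s02' : ∀ z ∈ convexHull ℝ {v 0, v 2, v 3} ∪ convexHull ℝ {v 0, v 3, v 4},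
      0 ≤ orient (v 0) (v 2) z := fun z hz => by
    have hz' : z ∈ convexHull ℝ {v 0, v 2, v 3, v 4} := by
      rcases hz with h | h
      · exact convexHull_mono (by intro z; simp; tauto) h
      · exact convexHull_mono (by intro z; simp; tauto) h
    refine orient_nonneg_of_mem_convexHull ?_ hz'
    have t4 : 0 ≤ orient (v 0) (v 2) (v 4) := by
      have := hv 4 2 (by decide) (by decide)
      have h : orient (v 4) (v (4 + 1)) (v 2) = orient (v 0) (v 2) (v 4) :=
        (orient_rotate (v 4) (v 0) (v 2)).symm
      linarith
    rintro z (rfl | rfl | rfl | rfl)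
    exacts [(hself1 _ _).ge, (hself2 _ _).ge, t2.le, t4]
  have s03' : ∀ z ∈ convexHull ℝ {v 0, v 3, v 4}, 0 ≤ orient (v 0) (v 3) z := fun z hz => by
    refine orient_nonneg_of_mem_convexHull ?_ hz
    rintro z (rfl | rfl | rfl)
    exacts [(hself1 _ _).ge, (hself2 _ _).ge, t3.le]
  have ne02 : v 0 ≠ v 2 := by
    intro h; rw [h] at t2; unfold orient at t2; nlinarith
  have ne03 : v 0 ≠ v 3 := by
    intro h; rw [h] at t3; unfold orient at t3; nlinarith
  have meas : ∀ a b c : ℂ, NullMeasurableSet (convexHull ℝ {a, b, c}) volume := fun a b c =>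
    (Set.Finite.isClosed_convexHull ℝ (Set.toFinite _)).measurableSet.nullMeasurableSet
  have d1 : AEDisjoint volume (convexHull ℝ {v 0, v 1, v 2})
      (convexHull ℝ {v 0, v 2, v 3} ∪ convexHull ℝ {v 0, v 3, v 4}) := by
    refine measure_mono_null ?_ (volume_line ne02)
    rintro z ⟨h1, h2⟩
    have k1 := s02 z h1
    have k2 := s02' z h2
    rw [orient_swap] at k1
    exact le_antisymm (by linarith) k2
  have d2 : AEDisjoint volume (convexHull ℝ {v 0, v 2, v 3}) (convexHull ℝ {v 0, v 3, v 4}) := by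
    refine measure_mono_null ?_ (volume_line ne03)
    rintro z ⟨h1, h2⟩
    have k1 := s03 z h1
    have k2 := s03' z h2
    rw [orient_swap] at k1
    exact le_antisymm (by linarith) k2
  rw [heq, measure_union₀ ((meas _ _ _).union (meas _ _ _)) d1, measure_union₀ (meas _ _ _) d2,
    volume_convexHull_triple, volume_convexHull_triple, volume_convexHull_triple,
    abs_of_pos t1, abs_of_pos t2, abs_of_pos t3, ← ENNReal.ofReal_add (by linarith) (by linarith),
    ← ENNReal.ofReal_add (by linarith) (by linarith)]
  congr 1
  have := pentSignedArea_eq_triangles v 0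
  simp only [zero_add] at this
  rw [this]
  ring

/-! ### Winding numbers and the region bounded by a pentagon -/

theorem div_sub_mem_slitPlane {p q z : ℂ} (h : z ∉ segment ℝ p q) :
    (q - z) / (p - z) ∈ Complex.slitPlane := by
  by_contra hn
  have hpz : p - z ≠ 0 := by
    intro h0
    exact h (by rw [← sub_eq_zero.1 h0]; exact left_mem_segment ℝ _ _)
  rw [Complex.mem_slitPlane_iff] at hn
  push Not at hn
  obtain ⟨h1, h2⟩ := hn
  set s := -((q - z) / (p - z)).re with hs
  have hr : (q - z) / (p - z) = ((-s : ℝ) : ℂ) := by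
    apply Complex.ext <;> simp [hs, h2]
  rw [div_eq_iff hpz] at hr
  have hs0 : 0 ≤ s := by linarith
  apply h
  have h1s : (1 + s) ≠ 0 := by positivity
  refine ⟨s / (1 + s), 1 / (1 + s), by positivity, by positivity, by field_simp; ring, ?_⟩
  have hq : q = z - (s : ℂ) * (p - z) := by
    push_cast at hr
    linear_combination hr
  rw [hq]
  have : ((1 + s : ℝ) : ℂ) ≠ 0 := by exact_mod_cast h1s
  simp only [Complex.real_smul]
  push_cast at this ⊢
  field_simp
  ring

theorem im_div_sub (p q z : ℂ) :
    ((q - z) / (p - z)).im = orient p q z / Complex.normSq (p - z) := by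
  rw [Complex.div_im]
  simp only [Complex.sub_im, Complex.sub_re, orient]
  ring

theorem orient_eq_zero_of_mem_segment {p q z : ℂ} (h : z ∈ segment ℝ p q) : orient p q z = 0 := by
  obtain ⟨a, b, _, _, hab, rfl⟩ := h
  rw [orient_comb p q p q hab]
  unfold orient; ring

theorem isClosed_pentBoundary (v : Fin 5 → ℂ) : IsClosed (pentBoundary v) := by
  refine isClosed_iUnion_of_finite fun i => ?_
  rw [pentEdge, ← convexHull_pair]
  exact (Set.toFinite _).isClosed_convexHull ℝ

theorem vertex_mem_pentBoundary (v : Fin 5 → ℂ) (i : Fin 5) : v i ∈ pentBoundary v :=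
  Set.mem_iUnion.2 ⟨i, left_mem_segment ℝ _ _⟩

/-- The winding number is an integer. -/
theorem exists_pentWinding_eq (v : Fin 5 → ℂ) {z : ℂ} (hz : z ∉ pentBoundary v) :
    ∃ k : ℤ, pentWinding v z = k := by
  have hne : ∀ i, v i - z ≠ 0 := by
    intro i h
    exact hz (sub_eq_zero.1 h ▸ vertex_mem_pentBoundary v i)
  have h : ((∑ i, Complex.arg ((v (i + 1) - z) / (v i - z)) : ℝ) : Real.Angle) = (0 : ℝ) := by
    have h1 : ((∑ i, Complex.arg ((v (i + 1) - z) / (v i - z)) : ℝ) : Real.Angle) =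
        ∑ i, (Complex.arg ((v (i + 1) - z) / (v i - z)) : Real.Angle) :=
      map_sum Real.Angle.coeHom _ _
    rw [h1]
    simp_rw [Complex.arg_div_coe_angle (hne _) (hne _)]
    have h2 := Equiv.sum_comp (Equiv.addRight (1 : Fin 5))
      fun i => (Complex.arg (v i - z) : Real.Angle)
    simp only [Equiv.coe_addRight] at h2
    rw [Finset.sum_sub_distrib, h2, sub_self, Real.Angle.coe_zero]
  obtain ⟨k, hk⟩ := Real.Angle.angle_eq_iff_two_pi_dvd_sub.1 h
  refine ⟨k, ?_⟩
  rw [pentWinding, div_eq_iff (by positivity)]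
  linarith

theorem continuousAt_arg_div_sub {p q z : ℂ} (h : z ∉ segment ℝ p q) :
    ContinuousAt (fun w => Complex.arg ((q - w) / (p - w))) z := by
  have hpz : p - z ≠ 0 := by
    intro h0
    exact h (by rw [← sub_eq_zero.1 h0]; exact left_mem_segment ℝ _ _)
  refine ContinuousAt.comp (f := fun w => (q - w) / (p - w)) (g := Complex.arg)
    (Complex.continuousAt_arg (div_sub_mem_slitPlane h)) ?_
  exact ContinuousAt.div (by fun_prop) (by fun_prop) hpz

theorem continuousAt_pentWinding (v : Fin 5 → ℂ) {z : ℂ} (hz : z ∉ pentBoundary v) :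
    ContinuousAt (pentWinding v) z := by
  unfold pentWinding
  refine ContinuousAt.div_const ?_ _
  refine tendsto_finsetSum _ fun i _ => continuousAt_arg_div_sub fun h => ?_
  exact hz (Set.mem_iUnion.2 ⟨i, h⟩)

theorem isClosed_pentRegion (v : Fin 5 → ℂ) : IsClosed (pentRegion v) := by
  rw [← isOpen_compl_iff, isOpen_iff_mem_nhds]
  intro z hz
  have hz1 : z ∉ pentBoundary v := fun h => hz (Or.inl h)
  have hz2 : pentWinding v z = 0 := by
    by_contra h; exact hz (Or.inr ⟨hz1, h⟩)
  have h1 := (isClosed_pentBoundary v).isOpen_compl.mem_nhds hz1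
  have h2 := Metric.continuousAt_iff'.1 (continuousAt_pentWinding v hz1) 1 one_pos
  filter_upwards [h1, h2] with w hw1 hw2
  rintro (h | ⟨_, h⟩)
  · exact hw1 h
  · obtain ⟨k, hk⟩ := exists_pentWinding_eq v hw1
    rw [hz2, Real.dist_eq, sub_zero, hk] at hw2
    apply h
    rw [hk]
    have : |k| < 1 := by exact_mod_cast hw2
    rw [Int.abs_lt_one_iff] at this
    simp [this]

theorem arg_div_of_re_pos {x y : ℂ} (hx : 0 < x.re) (hy : 0 < y.re) :
    Complex.arg (x / y) = Complex.arg x - Complex.arg y := by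
  have hx0 : x ≠ 0 := by rintro rfl; simp at hx
  have hy0 : y ≠ 0 := by rintro rfl; simp at hy
  have h1 := abs_lt.1 (Complex.abs_arg_lt_pi_div_two_iff.2 (Or.inl hx))
  have h2 := abs_lt.1 (Complex.abs_arg_lt_pi_div_two_iff.2 (Or.inl hy))
  have h := congrArg Real.Angle.toReal (Complex.arg_div_coe_angle hx0 hy0)
  rw [← Real.Angle.coe_sub, Complex.arg_coe_angle_toReal_eq_arg,
    Real.Angle.toReal_coe_eq_self_iff.2 ⟨by linarith, by linarith⟩] at h
  exact h

theorem pentWinding_eq_zero (v : Fin 5 → ℂ) {z : ℂ} (hz : z ∉ convexHull ℝ (Set.range v)) :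
    pentWinding v z = 0 := by
  obtain ⟨f, u, hf, hu⟩ := geometric_hahn_banach_closed_point (convex_convexHull ℝ _)
    ((Set.finite_range v).isClosed_convexHull ℝ) hz
  set d : ℂ := ⟨f 1, -f Complex.I⟩ with hd
  have hfd : ∀ w : ℂ, (w * d).re = f w := by
    intro w
    have : w = w.re • (1 : ℂ) + w.im • Complex.I := by
      apply Complex.ext <;> simp
    conv_rhs => rw [this, map_add, map_smul, map_smul]
    simp [hd]
  have hpos : ∀ i, 0 < ((z - v i) * d).re := by
    intro i
    rw [hfd, map_sub]
    have := hf (v i) (subset_convexHull ℝ _ ⟨i, rfl⟩)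
    linarith
  have hd0 : d ≠ 0 := by
    intro h; have := hpos 0; rw [h] at this; simp at this
  have harg : ∀ i, Complex.arg ((v (i + 1) - z) / (v i - z)) =
      Complex.arg ((z - v (i + 1)) * d) - Complex.arg ((z - v i) * d) := by
    intro i
    rw [← arg_div_of_re_pos (hpos _) (hpos _), mul_div_mul_right _ _ hd0, ← neg_sub z (v (i + 1)),
      ← neg_sub z (v i), neg_div_neg_eq]
  unfold pentWinding
  simp_rw [harg]
  have h := Equiv.sum_comp (Equiv.addRight (1 : Fin 5)) fun i => Complex.arg ((z - v i) * d)
  simp only [Equiv.coe_addRight] at h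
  rw [Finset.sum_sub_distrib, h, sub_self, zero_div]

theorem pentBoundary_subset_convexHull (v : Fin 5 → ℂ) :
    pentBoundary v ⊆ convexHull ℝ (Set.range v) :=
  Set.iUnion_subset fun _ => (convex_convexHull ℝ _).segment_subset
    (subset_convexHull ℝ _ ⟨_, rfl⟩) (subset_convexHull ℝ _ ⟨_, rfl⟩)

theorem pentRegion_subset_convexHull (v : Fin 5 → ℂ) :
    pentRegion v ⊆ convexHull ℝ (Set.range v) := by
  rintro z (h | ⟨_, h⟩)
  · exact pentBoundary_subset_convexHull v h
  · by_contra hz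
    exact h (pentWinding_eq_zero v hz)

theorem IsStrictlyConvexPent.pentRegion_eq {v : Fin 5 → ℂ} (hv : IsStrictlyConvexPent v) :
    pentRegion v = leftRegion v := by
  apply Set.Subset.antisymm
  · refine (pentRegion_subset_convexHull v).trans (convexHull_min ?_ (convex_leftRegion v))
    rintro _ ⟨j, rfl⟩
    exact hv.vertex_mem_leftRegion j
  intro z hz
  by_cases hb : z ∈ pentBoundary v
  · exact Or.inl hb
  refine Or.inr ⟨hb, ?_⟩
  have hpos : ∀ i, 0 < orient (v i) (v (i + 1)) z := by
    intro i
    refine lt_of_le_of_ne (hz i) fun h0 => hb ?_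
    have hi : i ≠ i + 1 := by clear * -; revert i; decide
    have hi2 : i + 2 ≠ i := by clear * -; revert i; decide
    have hi3 : i + 2 ≠ i + 1 := by clear * -; revert i; decide
    have hi4 : i + 1 ≠ i + 4 := by clear * -; revert i; decide
    have p1 := hv i (i + 2) hi2 hi3
    have hne : v i ≠ v (i + 1) := by
      intro h; rw [h] at p1; unfold orient at p1; nlinarith
    obtain ⟨s, hs⟩ := exists_real_of_orient_eq_zero hne h0.symm
    have q1 := hz (i + 1)
    have q2 := hz (i + 4)
    have p2 := hv (i + 4) (i + 1) hi4 (by clear * -; revert i; decide)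
    rw [add_assoc i 1 1, show (1 : Fin 5) + 1 = 2 from rfl] at q1
    rw [add_assoc i 4 1, show (4 : Fin 5) + 1 = 0 from rfl, add_zero] at q2 p2
    have hs1 : 0 ≤ (1 - s) * orient (v i) (v (i + 1)) (v (i + 2)) := by
      have e : orient (v (i + 1)) (v (i + 2)) z =
          (1 - s) * orient (v i) (v (i + 1)) (v (i + 2)) := by
        rw [hs, orient_comb _ _ _ _ (by ring), orient_rotate (v i)]
        unfold orient; ring
      rw [← e]; exact q1
    have hs0 : 0 ≤ s * orient (v (i + 4)) (v i) (v (i + 1)) := by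
      have e : orient (v (i + 4)) (v i) z = s * orient (v (i + 4)) (v i) (v (i + 1)) := by
        rw [hs, orient_comb _ _ _ _ (by ring)]
        unfold orient; ring
      rw [← e]; exact q2
    have hs1' := nonneg_of_mul_nonneg_left hs1 p1
    have hs0' := nonneg_of_mul_nonneg_left hs0 p2
    exact Set.mem_iUnion.2 ⟨i, 1 - s, s, hs1', hs0', by ring, hs.symm⟩
  have harg : ∀ i, 0 < Complex.arg ((v (i + 1) - z) / (v i - z)) := by
    intro i
    have hvz : v i - z ≠ 0 := by
      intro h
      exact hb (sub_eq_zero.1 h ▸ vertex_mem_pentBoundary v i)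
    have him : 0 < ((v (i + 1) - z) / (v i - z)).im := by
      rw [im_div_sub]
      exact div_pos (hpos i) (Complex.normSq_pos.2 hvz)
    refine lt_of_le_of_ne (Complex.arg_nonneg_iff.2 him.le) fun h => ?_
    have := (Complex.arg_eq_zero_iff.1 h.symm).2
    linarith
  have : 0 < pentWinding v z :=
    div_pos (Finset.sum_pos (fun i _ => harg i) Finset.univ_nonempty) (by positivity)
  exact this.ne'

theorem IsStrictlyConvexPent.volume_pentRegion {v : Fin 5 → ℂ} (hv : IsStrictlyConvexPent v) :
    volume (pentRegion v) = ENNReal.ofReal (pentSignedArea v) := by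
  rw [hv.pentRegion_eq, hv.volume_leftRegion]

theorem isBounded_pentRegion (v : Fin 5 → ℂ) : Bornology.IsBounded (pentRegion v) :=
  (isBounded_convexHull.2 (Set.finite_range v).isBounded).subset (pentRegion_subset_convexHull v)

open Filter Topology in
/-- Near an inner point of an edge, the region contains all points on at least one side of the edge:
the winding number jumps by `1` across the edge, so it cannot vanish on both sides. -/
theorem IsSimplePent.exists_side {v : Fin 5 → ℂ} (hv : IsSimplePent v) {i : Fin 5} {z : ℂ}
    (hz : z ∈ pentEdge v i) (h1 : z ≠ v i) (h2 : z ≠ v (i + 1)) :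
    (∀ᶠ w in 𝓝 z, 0 < orient (v i) (v (i + 1)) w → w ∈ pentRegion v) ∨
    (∀ᶠ w in 𝓝 z, orient (v i) (v (i + 1)) w < 0 → w ∈ pentRegion v) := by
  have hother : ∀ j, j ≠ i → z ∉ pentEdge v j := by
    intro j hj hzj
    have : ∀ i j : Fin 5, j ≠ i → j = i + 1 ∨ j = i + 2 ∨ i = j + 2 ∨ i = j + 1 := by decide
    rcases this i j hj with rfl | rfl | rfl | rfl
    · have : z ∈ pentEdge v i ∩ pentEdge v (i + 1) := ⟨hz, hzj⟩
      rw [hv.1 i] at this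
      exact h2 this
    · exact Set.disjoint_left.1 (hv.2 i) hz hzj
    · exact Set.disjoint_left.1 (hv.2 j) hzj hz
    · have : z ∈ pentEdge v j ∩ pentEdge v (j + 1) := ⟨hzj, hz⟩
      rw [hv.1 j] at this
      exact h1 this
  set G : ℂ → ℝ := fun w => ∑ j ∈ Finset.univ.erase i, Complex.arg ((v (j + 1) - w) / (v j - w))
    with hG
  have hGc : ContinuousAt G z := by
    refine tendsto_finsetSum _ fun j hj => continuousAt_arg_div_sub ?_
    exact hother j (Finset.ne_of_mem_erase hj)
  have hGnear := Metric.continuousAt_iff'.1 hGc 1 one_pos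
  have hvz : v i - z ≠ 0 := sub_ne_zero.2 (Ne.symm h1)
  have hquot : ContinuousAt (fun w => (v (i + 1) - w) / (v i - w)) z :=
    ContinuousAt.div (by fun_prop) (by fun_prop) hvz
  have him : ((v (i + 1) - z) / (v i - z)).im = 0 := by
    rw [im_div_sub, orient_eq_zero_of_mem_segment hz, zero_div]
  have hre : ((v (i + 1) - z) / (v i - z)).re < 0 := by
    obtain ⟨a, b, ha, hb, hab, rfl⟩ := hz
    have hb0 : b ≠ 0 := by
      rintro rfl; apply h1
      obtain rfl : a = 1 := by linarith
      simp
    have ha0 : a ≠ 0 := by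
      rintro rfl; apply h2
      obtain rfl : b = 1 := by linarith
      simp
    have e : (v (i + 1) - (a • v i + b • v (i + 1))) / (v i - (a • v i + b • v (i + 1))) =
        ((-(a / b) : ℝ) : ℂ) := by
      rw [div_eq_iff hvz]
      obtain rfl : a = 1 - b := by linarith
      have : (b : ℂ) ≠ 0 := by exact_mod_cast hb0
      simp only [Complex.real_smul]
      push_cast
      field_simp
      ring
    rw [e, Complex.ofReal_re]
    have : 0 < a / b := div_pos (lt_of_le_of_ne ha ha0.symm) (lt_of_le_of_ne hb hb0.symm)
    linarith
  have hpi := Real.pi_gt_three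
  have hsum : ∀ w, pentWinding v w * (2 * Real.pi) =
      Complex.arg ((v (i + 1) - w) / (v i - w)) + G w := by
    intro w
    rw [pentWinding, div_mul_cancel₀ _ (by positivity), hG]
    exact (Finset.add_sum_erase _ _ (Finset.mem_univ i)).symm
  rcases le_or_gt 0 (G z) with h0 | h0
  · left
    have ht := Complex.tendsto_arg_nhdsWithin_im_nonneg_of_re_neg_of_im_zero hre him
    have ev := ht.eventually (lt_mem_nhds (show (1 : ℝ) < Real.pi by linarith))
    rw [eventually_nhdsWithin_iff] at ev
    filter_upwards [hquot.eventually ev, hGnear] with w hw1 hw2 hw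
    by_cases hb : w ∈ pentBoundary v
    · exact Or.inl hb
    refine Or.inr ⟨hb, fun hwind => ?_⟩
    have h3 := hw1 (by
      rw [im_div_sub]
      exact div_nonneg hw.le (Complex.normSq_nonneg _))
    have h4 := hsum w
    rw [hwind, zero_mul] at h4
    have h5 := (abs_lt.1 (Real.dist_eq _ _ ▸ hw2)).1
    linarith
  · right
    have ht := Complex.tendsto_arg_nhdsWithin_im_neg_of_re_neg_of_im_zero hre him
    have ev := ht.eventually (gt_mem_nhds (show -Real.pi < (-1 : ℝ) by linarith))
    rw [eventually_nhdsWithin_iff] at ev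
    have hne : ∀ᶠ w in 𝓝 z, v i - w ≠ 0 :=
      (continuousAt_const.sub continuousAt_id).eventually_ne hvz
    filter_upwards [hquot.eventually ev, hGnear, hne] with w hw1 hw2 hw3 hw
    by_cases hb : w ∈ pentBoundary v
    · exact Or.inl hb
    refine Or.inr ⟨hb, fun hwind => ?_⟩
    have h3 := hw1 (by
      rw [im_div_sub]
      exact div_neg_of_neg_of_pos hw (Complex.normSq_pos.2 hw3))
    have h4 := hsum w
    rw [hwind, zero_mul] at h4
    have h5 := (abs_lt.1 (Real.dist_eq _ _ ▸ hw2)).2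
    linarith

/-! ### The isoperimetric inequality for pentagons with prescribed angles -/

/-- The cross product of two plane vectors. -/
def cross (a b : ℂ) : ℝ := a.re * b.im - a.im * b.re

/-- The scalar product of two plane vectors. -/
def dot (a b : ℂ) : ℝ := a.re * b.re + a.im * b.im

theorem orient_eq_cross (a b c : ℂ) : orient a b c = cross (b - a) (c - a) := by
  simp [orient, cross]

/-- The unit direction vector of the `i`-th edge. -/
def edgeDir (v : Fin 5 → ℂ) (i : Fin 5) : ℂ := ((dist (v i) (v (i + 1)))⁻¹ : ℝ) • (v (i + 1) - v i)

theorem edgeDir_smul {v : Fin 5 → ℂ} {i : Fin 5} (h : v i ≠ v (i + 1)) :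
    v (i + 1) - v i = dist (v i) (v (i + 1)) • edgeDir v i := by
  rw [edgeDir, smul_smul, mul_inv_cancel₀ (dist_ne_zero.2 h), one_smul]

theorem edgeDir_sq {v : Fin 5 → ℂ} {i : Fin 5} (h : v i ≠ v (i + 1)) :
    (edgeDir v i).re ^ 2 + (edgeDir v i).im ^ 2 = 1 := by
  have h1 : ‖edgeDir v i‖ = 1 := by
    rw [edgeDir, norm_smul, dist_comm, dist_eq_norm, norm_inv, norm_norm, inv_mul_cancel₀]
    exact norm_ne_zero_iff.2 (sub_ne_zero.2 h.symm)
  have h2 : Complex.normSq (edgeDir v i) = 1 := by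
    rw [Complex.normSq_eq_norm_sq, h1]; norm_num
  rw [Complex.normSq_apply] at h2
  linarith

/-- The sine of the exterior angle at the `i`-th vertex. -/
def turnSin (v : Fin 5 → ℂ) (i : Fin 5) : ℝ := cross (edgeDir v (i + 4)) (edgeDir v i)

/-- The cosine of the exterior angle at the `i`-th vertex. -/
def turnCos (v : Fin 5 → ℂ) (i : Fin 5) : ℝ := dot (edgeDir v (i + 4)) (edgeDir v i)

/-- The tangent of half the exterior angle at the `i`-th vertex. -/
def turnTan (v : Fin 5 → ℂ) (i : Fin 5) : ℝ := (1 - turnCos v i) / turnSin v i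

/-- The signed distance of `o` from the line through the `i`-th edge. -/
def supportDist (v : Fin 5 → ℂ) (o : ℂ) (i : Fin 5) : ℝ := cross (edgeDir v i) (o - v i)

theorem IsStrictlyConvexPent.ne {v : Fin 5 → ℂ} (hv : IsStrictlyConvexPent v) (i : Fin 5) :
    v i ≠ v (i + 1) := by
  intro h
  have p1 := hv i (i + 2) (by clear * -; revert i; decide) (by clear * -; revert i; decide)
  rw [h] at p1; unfold orient at p1; nlinarith

theorem orient_eq_dist_mul_cross {v : Fin 5 → ℂ} {i : Fin 5} (h : v i ≠ v (i + 1)) (z : ℂ) :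
    orient (v i) (v (i + 1)) z = dist (v i) (v (i + 1)) * supportDist v z i := by
  rw [orient_eq_cross, edgeDir_smul h, supportDist]
  simp only [cross, Complex.real_smul, Complex.mul_re, Complex.mul_im, Complex.ofReal_re,
    Complex.ofReal_im]
  ring

theorem orient_eq_turnSin {v : Fin 5 → ℂ} (hv : ∀ i, v i ≠ v (i + 1)) (i : Fin 5) :
    orient (v (i + 4)) (v i) (v (i + 1)) =
      dist (v (i + 4)) (v i) * dist (v i) (v (i + 1)) * turnSin v i := by
  have h4 : i + 4 + 1 = i := by clear * -; revert i; decide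
  have e1 := edgeDir_smul (hv (i + 4))
  have e2 := edgeDir_smul (hv i)
  rw [h4] at e1
  have : orient (v (i + 4)) (v i) (v (i + 1)) = cross (v i - v (i + 4)) (v (i + 1) - v i) := by
    simp only [orient, cross, Complex.sub_re, Complex.sub_im]; ring
  rw [this, e1, e2, turnSin]
  simp only [cross, Complex.real_smul, Complex.mul_re, Complex.mul_im, Complex.ofReal_re,
    Complex.ofReal_im]
  ring

theorem IsStrictlyConvexPent.turnSin_pos {v : Fin 5 → ℂ} (hv : IsStrictlyConvexPent v)
    (i : Fin 5) : 0 < turnSin v i := by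
  have h := hv (i + 4) (i + 1) (by clear * -; revert i; decide) (by clear * -; revert i; decide)
  have h4 : i + 4 + 1 = i := by clear * -; revert i; decide
  rw [h4, orient_eq_turnSin hv.ne] at h
  exact pos_of_mul_pos_right h (mul_nonneg dist_nonneg dist_nonneg)

theorem turnSin_sq_add {v : Fin 5 → ℂ} (hv : ∀ i, v i ≠ v (i + 1)) (i : Fin 5) :
    turnSin v i ^ 2 + turnCos v i ^ 2 = 1 := by
  have h1 := edgeDir_sq (hv i)
  have h2 := edgeDir_sq (hv (i + 4))
  unfold turnSin turnCos cross dot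
  linear_combination ((edgeDir v (i + 4)).re ^ 2 + (edgeDir v (i + 4)).im ^ 2) * h1 + h2

theorem IsStrictlyConvexPent.turnTan_pos {v : Fin 5 → ℂ} (hv : IsStrictlyConvexPent v)
    (i : Fin 5) : 0 < turnTan v i := by
  have h1 := hv.turnSin_pos i
  have h2 := turnSin_sq_add hv.ne i
  refine div_pos ?_ h1
  nlinarith

/-- The foot of the perpendicular from `o` to an edge divides it into two parts; the lengths of the
parts are determined by the distances of `o` from the adjacent edges. -/
theorem IsStrictlyConvexPent.exists_foot {v : Fin 5 → ℂ} (hv : IsStrictlyConvexPent v) (o : ℂ) :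
    ∃ x y : Fin 5 → ℝ, (∀ i, x i + y i = dist (v i) (v (i + 1))) ∧
      (∀ i, x i = (supportDist v o (i + 4) - turnCos v i * supportDist v o i) / turnSin v i) ∧
      (∀ i, y (i + 4) =
        (supportDist v o i - turnCos v i * supportDist v o (i + 4)) / turnSin v i) := by
  have h4 : ∀ i : Fin 5, i + 4 + 1 = i := by decide
  refine ⟨fun i => dot (edgeDir v i) (o - v i), fun i => dot (edgeDir v i) (v (i + 1) - o),
    ?_, ?_, ?_⟩
  · intro i
    have h1 := edgeDir_sq (hv.ne i)
    have h2 := edgeDir_smul (hv.ne i)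
    have h3 : dot (edgeDir v i) (v (i + 1) - v i) = dist (v i) (v (i + 1)) := by
      conv_lhs => rw [h2]
      simp only [dot, Complex.real_smul, Complex.mul_re, Complex.mul_im, Complex.ofReal_re,
        Complex.ofReal_im]
      linear_combination (dist (v i) (v (i + 1))) * h1
    rw [← h3]
    simp only [dot, Complex.sub_re, Complex.sub_im]
    ring
  · intro i
    rw [eq_div_iff (hv.turnSin_pos i).ne']
    have h1 := edgeDir_sq (hv.ne i)
    have e2 := edgeDir_smul (hv.ne (i + 4))
    rw [h4] at e2
    have e3 : v (i + 4) = v i - dist (v (i + 4)) (v i) • edgeDir v (i + 4) := by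
      rw [← e2]; ring
    have e4 : supportDist v o (i + 4) = cross (edgeDir v (i + 4)) (o - v i) := by
      unfold supportDist
      rw [e3]
      simp only [cross, Complex.sub_re, Complex.sub_im, Complex.real_smul, Complex.mul_re,
        Complex.mul_im, Complex.ofReal_re, Complex.ofReal_im]
      ring
    rw [e4]
    simp only [turnSin, turnCos, supportDist, cross, dot, Complex.sub_re, Complex.sub_im]
    linear_combination ((edgeDir v (i + 4)).re * (o.im - (v i).im) -
      (edgeDir v (i + 4)).im * (o.re - (v i).re)) * h1
  · intro i
    rw [eq_div_iff (hv.turnSin_pos i).ne']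
    have h1 := edgeDir_sq (hv.ne (i + 4))
    have e2 := edgeDir_smul (hv.ne (i + 4))
    rw [h4] at e2
    have e3 : v (i + 4) = v i - dist (v (i + 4)) (v i) • edgeDir v (i + 4) := by
      rw [← e2]; ring
    have e4 : supportDist v o (i + 4) = cross (edgeDir v (i + 4)) (o - v i) := by
      unfold supportDist
      rw [e3]
      simp only [cross, Complex.sub_re, Complex.sub_im, Complex.real_smul, Complex.mul_re,
        Complex.mul_im, Complex.ofReal_re, Complex.ofReal_im]
      ring
    rw [e4]
    beta_reduce
    rw [h4]
    simp only [turnSin, turnCos, supportDist, cross, dot, Complex.sub_re, Complex.sub_im]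
    linear_combination ((edgeDir v i).re * (o.im - (v i).im) -
      (edgeDir v i).im * (o.re - (v i).re)) * h1

theorem IsStrictlyConvexPent.area_eq_support {v : Fin 5 → ℂ} (hv : IsStrictlyConvexPent v)
    (o : ℂ) : 2 * pentSignedArea v = ∑ i, supportDist v o i * dist (v i) (v (i + 1)) := by
  rw [pentSignedArea_eq_fan v o, mul_div_cancel₀ _ (two_ne_zero)]
  refine Finset.sum_congr rfl fun i _ => ?_
  rw [mul_comm, ← orient_eq_dist_mul_cross (hv.ne i), orient_rotate o]

/-- The turns from edge `j + 1` to edge `j + 3` and from there to edge `j` cannot both exceed a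
half-turn, as the five exterior angles together make one full turn. -/
theorem IsStrictlyConvexPent.not_two_wide {v : Fin 5 → ℂ} (hv : IsStrictlyConvexPent v)
    (j : Fin 5) : ¬ (cross (edgeDir v (j + 1)) (edgeDir v (j + 3)) < 0 ∧
      cross (edgeDir v (j + 3)) (edgeDir v j) < 0) := by
  rintro ⟨h1, h2⟩
  have h3 := hv.turnSin_pos (j + 1)
  rw [turnSin, show j + 1 + 4 = j by clear * -; revert j; decide] at h3
  have k0 := hv j (j + 3) (by clear * -; revert j; decide) (by clear * -; revert j; decide)
  have k1 := hv (j + 1) (j + 3) (by clear * -; revert j; decide) (by clear * -; revert j; decide)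
  have k3 := hv (j + 3) (j + 1) (by clear * -; revert j; decide) (by clear * -; revert j; decide)
  have e0 := orient_eq_dist_mul_cross (hv.ne j) (v (j + 3))
  have e1 := orient_eq_dist_mul_cross (hv.ne (j + 1)) (v (j + 3))
  have e3 := orient_eq_dist_mul_cross (hv.ne (j + 3)) (v (j + 1))
  have m0 : 0 < supportDist v (v (j + 3)) j := pos_of_mul_pos_right (e0 ▸ k0) dist_nonneg
  have m1 : 0 < supportDist v (v (j + 3)) (j + 1) := pos_of_mul_pos_right (e1 ▸ k1) dist_nonneg
  have m3 : 0 < supportDist v (v (j + 1)) (j + 3) := pos_of_mul_pos_right (e3 ▸ k3) dist_nonneg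
  have m0' : supportDist v (v (j + 3)) j = cross (edgeDir v j) (v (j + 3) - v (j + 1)) := by
    have : v j = v (j + 1) - dist (v j) (v (j + 1)) • edgeDir v j := by
      rw [← edgeDir_smul (hv.ne j)]; ring
    unfold supportDist
    rw [show v (j + 3) - v j = v (j + 3) - v (j + 1) + dist (v j) (v (j + 1)) • edgeDir v j by
      rw [← edgeDir_smul (hv.ne j)]; ring]
    simp only [cross, Complex.add_re, Complex.add_im, Complex.real_smul, Complex.mul_re,
        Complex.mul_im, Complex.ofReal_re, Complex.ofReal_im]
    ring
  rw [m0'] at m0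
  unfold supportDist at m1 m3
  set w := v (j + 3) - v (j + 1) with hw
  have hw' : v (j + 1) - v (j + 3) = -w := by rw [hw]; ring
  rw [hw'] at m3
  have id : cross (edgeDir v j) (edgeDir v (j + 1)) * cross (edgeDir v (j + 3)) (-w) =
      cross (edgeDir v (j + 1)) w * cross (edgeDir v (j + 3)) (edgeDir v j) +
      cross (edgeDir v j) w * cross (edgeDir v (j + 1)) (edgeDir v (j + 3)) := by
    simp only [cross, Complex.neg_re, Complex.neg_im]; ring
  have p1 := mul_pos h3 m3
  have p2 := mul_neg_of_pos_of_neg m1 h2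
  have p3 := mul_neg_of_pos_of_neg m0 h1
  linarith

/-- There is a circle tangent to the lines of three edges whose directions positively span the
plane. -/
theorem IsStrictlyConvexPent.exists_tangent_circle {v : Fin 5 → ℂ} (hv : IsStrictlyConvexPent v)
    (h1 : 0 ≤ cross (edgeDir v 1) (edgeDir v 3)) (h2 : 0 ≤ cross (edgeDir v 3) (edgeDir v 0)) :
    ∃ (o : ℂ) (r : ℝ), supportDist v o 0 = r ∧ supportDist v o 1 = r ∧ supportDist v o 3 = r := by
  have h3 : 0 < turnSin v 1 := hv.turnSin_pos 1
  have h3' : turnSin v 1 = cross (edgeDir v 0) (edgeDir v 1) := rfl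
  set w : ℂ := (turnSin v 1)⁻¹ • (edgeDir v 1 - edgeDir v 0) with hw
  have w0 : cross (edgeDir v 0) w = 1 := by
    have : cross (edgeDir v 0) w = (turnSin v 1)⁻¹ * turnSin v 1 := by
      rw [h3', hw, h3']
      simp only [cross, Complex.real_smul, Complex.mul_re,
        Complex.mul_im, Complex.ofReal_re, Complex.ofReal_im, Complex.sub_re, Complex.sub_im]
      ring
    rw [this, inv_mul_cancel₀ h3.ne']
  have w1 : cross (edgeDir v 1) w = 1 := by
    have : cross (edgeDir v 1) w = (turnSin v 1)⁻¹ * turnSin v 1 := by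
      rw [h3', hw, h3']
      simp only [cross, Complex.real_smul, Complex.mul_re,
        Complex.mul_im, Complex.ofReal_re, Complex.ofReal_im, Complex.sub_re, Complex.sub_im]
      ring
    rw [this, inv_mul_cancel₀ h3.ne']
  have w3 : cross (edgeDir v 3) w ≤ 0 := by
    have : cross (edgeDir v 3) w = -((turnSin v 1)⁻¹ *
        (cross (edgeDir v 1) (edgeDir v 3) + cross (edgeDir v 3) (edgeDir v 0))) := by
      rw [hw]
      simp only [cross, Complex.real_smul, Complex.mul_re,
        Complex.mul_im, Complex.ofReal_re, Complex.ofReal_im, Complex.sub_re, Complex.sub_im]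
      ring
    rw [this]
    have := mul_nonneg (inv_nonneg.2 h3.le) (add_nonneg h1 h2)
    linarith
  set r := cross (edgeDir v 3) (v 1 - v 3) / (1 - cross (edgeDir v 3) w) with hr
  have hr' : r * (1 - cross (edgeDir v 3) w) = cross (edgeDir v 3) (v 1 - v 3) := by
    rw [hr, div_mul_cancel₀]; linarith
  have lin : ∀ (u a : ℂ), cross u (a + r • w) = cross u a + r * cross u w := by
    intro u a
    simp only [cross, Complex.add_re, Complex.add_im, Complex.real_smul, Complex.mul_re,
        Complex.mul_im, Complex.ofReal_re, Complex.ofReal_im]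
    ring
  refine ⟨v 1 + r • w, r, ?_, ?_, ?_⟩
  · have e := edgeDir_smul (hv.ne 0)
    have : v 1 + r • w - v 0 = (v (0 + 1) - v 0) + r • w := by
      rw [zero_add]; ring
    rw [supportDist, this, lin, w0, e]
    simp only [cross, Complex.real_smul, Complex.mul_re,
        Complex.mul_im, Complex.ofReal_re, Complex.ofReal_im]
    ring
  · have : v 1 + r • w - v 1 = 0 + r • w := by ring
    rw [supportDist, this, lin, w1]
    simp [cross]
  · have : v 1 + r • w - v 3 = (v 1 - v 3) + r • w := by ring
    rw [supportDist, this, lin]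
    linarith

/-- Lindelöf's inequality for a pentagon in which edges `0`, `1` and `3` are tangent to a common
circle: in terms of this circle, the area is at most `r * L - r ^ 2 * F`, where `L` is the perimeter
and `F` the sum of the `turnTan`, and this quadratic in `r` is at most `L ^ 2 / (4 * F)`. -/
theorem IsStrictlyConvexPent.isoperimetric_aux {v : Fin 5 → ℂ} (hv : IsStrictlyConvexPent v)
    (h1 : 0 ≤ cross (edgeDir v 1) (edgeDir v 3)) (h2 : 0 ≤ cross (edgeDir v 3) (edgeDir v 0)) :
    4 * pentSignedArea v * ∑ i, turnTan v i ≤ (∑ i, dist (v i) (v (i + 1))) ^ 2 := by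
  obtain ⟨o, r, r0, r1, r3⟩ := hv.exists_tangent_circle h1 h2
  obtain ⟨x, y, hxy, hx, hy⟩ := hv.exists_foot o
  have hA := hv.area_eq_support o
  have s0 := hv.turnSin_pos 0
  have s1 := hv.turnSin_pos 1
  have s2 := hv.turnSin_pos 2
  have s3 := hv.turnSin_pos 3
  have s4 := hv.turnSin_pos 4
  have F0 : 0 ≤ ∑ i, turnTan v i := Finset.sum_nonneg fun i _ => (hv.turnTan_pos i).le
  have g2 : 0 ≤ turnCos v 2 / turnSin v 2 + turnCos v 3 / turnSin v 3 := by
    have e : turnCos v 2 * turnSin v 3 + turnCos v 3 * turnSin v 2 =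
        cross (edgeDir v 1) (edgeDir v 3) := by
      have := edgeDir_sq (hv.ne 2)
      simp only [turnCos, turnSin, dot, cross, Fin.isValue, Fin.reduceAdd]
      linear_combination ((edgeDir v 1).re * (edgeDir v 3).im -
        (edgeDir v 1).im * (edgeDir v 3).re) * this
    rw [div_add_div _ _ s2.ne' s3.ne']
    refine div_nonneg ?_ (by positivity)
    linarith
  have g4 : 0 ≤ turnCos v 4 / turnSin v 4 + turnCos v 0 / turnSin v 0 := by
    have e : turnCos v 4 * turnSin v 0 + turnCos v 0 * turnSin v 4 =
        cross (edgeDir v 3) (edgeDir v 0) := by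
      have := edgeDir_sq (hv.ne 4)
      simp only [turnCos, turnSin, dot, cross, Fin.isValue, Fin.reduceAdd]
      linear_combination ((edgeDir v 3).re * (edgeDir v 0).im -
        (edgeDir v 3).im * (edgeDir v 0).re) * this
    rw [div_add_div _ _ s4.ne' s0.ne']
    refine div_nonneg ?_ (by positivity)
    linarith
  have x0 := hx 0
  have x1 := hx 1
  have x2 := hx 2
  have x3 := hx 3
  have x4 := hx 4
  have y0 := hy 1
  have y1 := hy 2
  have y2 := hy 3
  have y3 := hy 4
  have y4 := hy 0
  simp only [← hxy] at hA ⊢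
  simp only [Fin.sum_univ_five, Fin.isValue, Fin.reduceAdd, zero_add] at hA F0 ⊢ x0 x1 x2 x3 x4
  simp only [Fin.isValue, Fin.reduceAdd, zero_add] at y0 y1 y2 y3 y4
  rw [r0] at hA x0 x1 y0 y4
  rw [r1] at hA x1 x2 y0 y1
  rw [r3] at hA x3 x4 y2 y3
  set a := supportDist v o 2
  set b := supportDist v o 4
  set L := x 0 + y 0 + (x 1 + y 1) + (x 2 + y 2) + (x 3 + y 3) + (x 4 + y 4) with hL
  set F := turnTan v 0 + turnTan v 1 + turnTan v 2 + turnTan v 3 + turnTan v 4 with hF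
  -- `A - (r * L - r ^ 2 * F)` is a negative semidefinite form in the distances from the circle to
  -- the lines of the two edges that it need not touch
  have key : 2 * pentSignedArea v - 2 * (r * L) + 2 * (r ^ 2 * F) =
      -((a - r) ^ 2 * (turnCos v 2 / turnSin v 2 + turnCos v 3 / turnSin v 3)) -
      (b - r) ^ 2 * (turnCos v 4 / turnSin v 4 + turnCos v 0 / turnSin v 0) := by
    rw [hA, hL, hF, x0, x1, x2, x3, x4, y0, y1, y2, y3, y4]
    unfold turnTan
    ring
  have k1 := mul_nonneg (sq_nonneg (a - r)) g2
  have k2 := mul_nonneg (sq_nonneg (b - r)) g4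
  have k3 : pentSignedArea v ≤ r * L - r ^ 2 * F := by linarith
  have k4 := mul_le_mul_of_nonneg_right k3 F0
  have k5 := sq_nonneg (L - 2 * r * F)
  clear_value L F
  linarith

/-- Lindelöf's inequality: among the pentagons with given angles, the circumscribed one has the
least perimeter for its area. -/
theorem IsStrictlyConvexPent.isoperimetric {v : Fin 5 → ℂ} (hv : IsStrictlyConvexPent v) :
    4 * pentSignedArea v * ∑ i, turnTan v i ≤ (∑ i, dist (v i) (v (i + 1))) ^ 2 := by
  have hsel : ∃ j, 0 ≤ cross (edgeDir v (j + 1)) (edgeDir v (j + 3)) ∧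
      0 ≤ cross (edgeDir v (j + 3)) (edgeDir v j) := by
    have n := hv.not_two_wide
    have n0 := n 0
    have n1 := n 1
    have n2 := n 2
    have n3 := n 3
    have n4 := n 4
    by_contra hcon
    push Not at hcon
    have m0 := hcon 0
    have m1 := hcon 1
    have m2 := hcon 2
    have m3 := hcon 3
    have m4 := hcon 4
    simp only [Fin.isValue, Fin.reduceAdd, zero_add, ← not_lt] at *
    tauto
  obtain ⟨j, hj1, hj2⟩ := hsel
  -- renumber the vertices so that the tangent edges become `0`, `1` and `3`
  set v' : Fin 5 → ℂ := fun k => v (k + j) with hv'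
  have hadd : ∀ k : Fin 5, k + 1 + j = k + j + 1 := fun k => add_right_comm _ _ _
  have hadd4 : ∀ k : Fin 5, k + 4 + j = k + j + 4 := fun k => add_right_comm _ _ _
  have hdir : ∀ k, edgeDir v' k = edgeDir v (k + j) := by
    intro k; simp only [edgeDir, hv', hadd]
  have hc : IsStrictlyConvexPent v' := by
    intro i k h1 h2
    simp only [hv', hadd]
    refine hv _ _ (fun h => h1 (add_right_cancel h)) (fun h => h2 ?_)
    rw [← hadd] at h
    exact add_right_cancel h
  have htan : ∀ k, turnTan v' k = turnTan v (k + j) := by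
    intro k
    simp only [turnTan, turnSin, turnCos, hdir, hadd4]
  have hA : pentSignedArea v' = pentSignedArea v := by
    unfold pentSignedArea
    rw [← Equiv.sum_comp (Equiv.addRight j)
      (fun i => (v i).re * (v (i + 1)).im - (v (i + 1)).re * (v i).im)]
    simp only [hv', hadd, Equiv.coe_addRight]
  have := hc.isoperimetric_aux (by rw [hdir, hdir, add_comm 1 j, add_comm 3 j]; exact hj1)
    (by rw [hdir, hdir, add_comm 3 j, zero_add]; exact hj2)
  rw [hA] at this
  have s1 := Equiv.sum_comp (Equiv.addRight j) (turnTan v)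
  have s2 := Equiv.sum_comp (Equiv.addRight j) fun i => dist (v i) (v (i + 1))
  simp only [Equiv.coe_addRight] at s1 s2
  simp only [htan] at this
  simp only [hv', hadd] at this
  rwa [s1, s2] at this

/-! ### Interior angles -/

theorem Pentagon.vertex_ne (P : Pentagon) (i : Fin 5) : P.vertex i ≠ P.vertex (i + 1) := by
  intro h
  have := P.simple.injective h
  clear * - this
  revert i; decide

theorem Pentagon.angle_eq_arg (P : Pentagon) (i : Fin 5)
    (h : 0 ≤ orient (P.vertex (i + 4)) (P.vertex i) (P.vertex (i + 1))) :
    P.angle i = Complex.arg ((P.vertex (i + 4) - P.vertex i) /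
      (P.vertex (i + 1) - P.vertex i)) := by
  have h4 : i - 1 = i + 4 := by clear * -; revert i; decide
  rw [Pentagon.angle, h4, toIcoMod_eq_self]
  refine ⟨?_, ?_⟩
  · rw [Complex.arg_nonneg_iff, im_div_sub, orient_rotate (P.vertex i),
      orient_rotate (P.vertex (i + 4)) (P.vertex i)]
    exact div_nonneg h (Complex.normSq_nonneg _)
  · have := Complex.arg_le_pi ((P.vertex (i + 4) - P.vertex i) / (P.vertex (i + 1) - P.vertex i))
    linarith [Real.pi_pos]

theorem Pentagon.angle_le_pi (P : Pentagon) (i : Fin 5)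
    (h : 0 ≤ orient (P.vertex (i + 4)) (P.vertex i) (P.vertex (i + 1))) : P.angle i ≤ Real.pi := by
  rw [P.angle_eq_arg i h]
  exact Complex.arg_le_pi _

/-- The signed angle at the `i`-th vertex is a half-turn minus the exterior angle. -/
theorem arg_corner_eq {v : Fin 5 → ℂ} (hv : ∀ i, v i ≠ v (i + 1)) (i : Fin 5) :
    Complex.arg ((v (i + 4) - v i) / (v (i + 1) - v i)) =
      Complex.arg ⟨-turnCos v i, turnSin v i⟩ := by
  have h4 : i + 4 + 1 = i := by clear * -; revert i; decide
  have e1 := edgeDir_smul (hv (i + 4))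
  have e2 := edgeDir_smul (hv i)
  have h1 := edgeDir_sq (hv i)
  rw [h4] at e1
  have d1 : 0 < dist (v (i + 4)) (v i) := by
    have := hv (i + 4); rw [h4] at this; exact dist_pos.2 this
  have d2 : 0 < dist (v i) (v (i + 1)) := dist_pos.2 (hv i)
  have : (v (i + 4) - v i) / (v (i + 1) - v i) =
      ((dist (v (i + 4)) (v i) / dist (v i) (v (i + 1)) : ℝ) : ℂ) *
        ⟨-turnCos v i, turnSin v i⟩ := by
    rw [div_eq_iff (sub_ne_zero.2 (hv i).symm), e2, ← neg_sub, e1]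
    have hd : (dist (v i) (v (i + 1)) : ℝ) ≠ 0 := d2.ne'
    apply Complex.ext
    · simp only [Complex.neg_re, Complex.real_smul, Complex.mul_re, Complex.mul_im,
        Complex.ofReal_re, Complex.ofReal_im, turnCos, turnSin, dot, cross]
      field_simp
      linear_combination (dist (v (i + 4)) (v i)) * (edgeDir v (i + 4)).re *
        dist (v i) (v (i + 1)) * h1
    · simp only [Complex.neg_im, Complex.real_smul, Complex.mul_re, Complex.mul_im,
        Complex.ofReal_re, Complex.ofReal_im, turnCos, turnSin, dot, cross]
      field_simp
      linear_combination (dist (v (i + 4)) (v i)) * (edgeDir v (i + 4)).im *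
        dist (v i) (v (i + 1)) * h1
  rw [this, Complex.arg_real_mul _ (div_pos d1 d2)]

theorem sin_arg_corner {v : Fin 5 → ℂ} (hv : ∀ i, v i ≠ v (i + 1)) (i : Fin 5) :
    Real.sin (Complex.arg ((v (i + 4) - v i) / (v (i + 1) - v i))) = turnSin v i := by
  have h := turnSin_sq_add hv i
  have hn : ‖(⟨-turnCos v i, turnSin v i⟩ : ℂ)‖ = 1 := by
    rw [Complex.norm_def, Complex.normSq_mk, Real.sqrt_eq_one]
    linarith
  rw [arg_corner_eq hv, Complex.sin_arg, hn, div_one]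

theorem cos_arg_corner {v : Fin 5 → ℂ} (hv : ∀ i, v i ≠ v (i + 1)) (i : Fin 5) :
    Real.cos (Complex.arg ((v (i + 4) - v i) / (v (i + 1) - v i))) = -turnCos v i := by
  have h := turnSin_sq_add hv i
  have hn : ‖(⟨-turnCos v i, turnSin v i⟩ : ℂ)‖ = 1 := by
    rw [Complex.norm_def, Complex.normSq_mk, Real.sqrt_eq_one]
    linarith
  have h0 : (⟨-turnCos v i, turnSin v i⟩ : ℂ) ≠ 0 := by
    intro h0; rw [h0] at hn; simp at hn
  rw [arg_corner_eq hv, Complex.cos_arg h0, hn, div_one]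

/-- The cotangent of half of an angle `x ∈ (0, π)`. -/
def halfCot (x : ℝ) : ℝ := (1 + Real.cos x) / Real.sin x

theorem IsStrictlyConvexPent.orient_pred_pos {v : Fin 5 → ℂ} (hv : IsStrictlyConvexPent v)
    (i : Fin 5) : 0 < orient (v (i + 4)) (v i) (v (i + 1)) := by
  have h := hv (i + 4) (i + 1) (by clear * -; revert i; decide) (by clear * -; revert i; decide)
  rwa [show i + 4 + 1 = i by clear * -; revert i; decide] at h

theorem Pentagon.turnTan_eq_halfCot (P : Pentagon) (hP : IsStrictlyConvexPent P.vertex)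
    (i : Fin 5) : turnTan P.vertex i = halfCot (P.angle i) := by
  rw [halfCot, P.angle_eq_arg i (hP.orient_pred_pos i).le, sin_arg_corner P.vertex_ne,
    cos_arg_corner P.vertex_ne, turnTan, sub_eq_add_neg]

theorem Pentagon.angle_mem_Ioo (P : Pentagon) (hP : IsStrictlyConvexPent P.vertex) (i : Fin 5) :
    P.angle i ∈ Set.Ioo 0 Real.pi := by
  have h := hP.turnSin_pos i
  have hs := sin_arg_corner P.vertex_ne i
  rw [← P.angle_eq_arg i (hP.orient_pred_pos i).le] at hs
  have h1 := P.angle_le_pi i (hP.orient_pred_pos i).le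
  have h0 : 0 ≤ P.angle i := by
    have := left_le_toIcoMod Real.two_pi_pos 0 (Complex.arg
      ((P.vertex (i - 1) - P.vertex i) / (P.vertex (i + 1) - P.vertex i)))
    exact this
  refine ⟨lt_of_le_of_ne h0 fun h0 => ?_, lt_of_le_of_ne h1 fun h1 => ?_⟩
  · rw [← h0, Real.sin_zero] at hs; linarith
  · rw [h1, Real.sin_pi] at hs; linarith

theorem arg_mem_Ioo_of_orient_pos {o x y : ℂ} (h : 0 < orient o x y) :
    Complex.arg ((y - o) / (x - o)) ∈ Set.Ioo 0 Real.pi := by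
  have hne : x - o ≠ 0 := by
    intro h0
    rw [sub_eq_zero.1 h0] at h; unfold orient at h; nlinarith
  have him : 0 < ((y - o) / (x - o)).im := by
    rw [im_div_sub, orient_rotate]
    exact div_pos h (Complex.normSq_pos.2 hne)
  refine ⟨lt_of_le_of_ne (Complex.arg_nonneg_iff.2 him.le) fun h => ?_, ?_⟩
  · have := (Complex.arg_eq_zero_iff.1 h.symm).2
    linarith
  · exact Complex.arg_lt_pi_iff.2 (Or.inr him.ne')

theorem ne_zero_of_orient_pos {o x y : ℂ} (h : 0 < orient o x y) : x - o ≠ 0 ∧ y - o ≠ 0 := by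
  constructor
  · intro h0
    rw [sub_eq_zero.1 h0] at h; unfold orient at h; nlinarith
  · intro h0
    rw [sub_eq_zero.1 h0] at h; unfold orient at h; nlinarith

theorem arg_add_of_orient_pos {o x y z : ℂ} (h1 : 0 < orient o x y) (h2 : 0 < orient o y z)
    (h3 : 0 < orient o x z) :
    Complex.arg ((z - o) / (x - o)) =
      Complex.arg ((y - o) / (x - o)) + Complex.arg ((z - o) / (y - o)) := by
  have a1 := arg_mem_Ioo_of_orient_pos h1
  have a2 := arg_mem_Ioo_of_orient_pos h2
  have a3 := arg_mem_Ioo_of_orient_pos h3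
  obtain ⟨nx, ny⟩ := ne_zero_of_orient_pos h1
  obtain ⟨-, nz⟩ := ne_zero_of_orient_pos h2
  have e : (Complex.arg ((z - o) / (x - o)) : Real.Angle) =
      ((Complex.arg ((y - o) / (x - o)) + Complex.arg ((z - o) / (y - o)) : ℝ) : Real.Angle) := by
    rw [Real.Angle.coe_add, Complex.arg_div_coe_angle nz nx, Complex.arg_div_coe_angle ny nx,
      Complex.arg_div_coe_angle nz ny]
    abel
  obtain ⟨k, hk⟩ := Real.Angle.angle_eq_iff_two_pi_dvd_sub.1 e
  have hpi := Real.pi_pos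
  have k1 : (-1 : ℝ) < k := by nlinarith [a1.1, a1.2, a2.1, a2.2, a3.1, a3.2]
  have k2 : (k : ℝ) < 1 := by nlinarith [a1.1, a1.2, a2.1, a2.2, a3.1, a3.2]
  have k0 : k = 0 := by
    have : (-1 : ℤ) < k := by exact_mod_cast k1
    have : k < (1 : ℤ) := by exact_mod_cast k2
    omega
  rw [k0] at hk
  push_cast at hk
  linarith

theorem arg_triangle_sum {a b c : ℂ} (h : 0 < orient a b c) :
    Complex.arg ((c - a) / (b - a)) + Complex.arg ((a - b) / (c - b)) +
      Complex.arg ((b - c) / (a - c)) = Real.pi := by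
  have hb : 0 < orient b c a := by rwa [orient_rotate]
  have hc : 0 < orient c a b := by rwa [orient_rotate]
  have a1 := arg_mem_Ioo_of_orient_pos h
  have a2 := arg_mem_Ioo_of_orient_pos hb
  have a3 := arg_mem_Ioo_of_orient_pos hc
  obtain ⟨n1, n2⟩ := ne_zero_of_orient_pos h
  obtain ⟨n3, n4⟩ := ne_zero_of_orient_pos hb
  obtain ⟨n5, n6⟩ := ne_zero_of_orient_pos hc
  have e : ((Complex.arg ((c - a) / (b - a)) + Complex.arg ((a - b) / (c - b)) +
      Complex.arg ((b - c) / (a - c)) : ℝ) : Real.Angle) = (Real.pi : Real.Angle) := by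
    rw [Real.Angle.coe_add, Real.Angle.coe_add, ← Complex.arg_mul_coe_angle (div_ne_zero n2 n1)
      (div_ne_zero n4 n3), ← Complex.arg_mul_coe_angle (mul_ne_zero (div_ne_zero n2 n1)
      (div_ne_zero n4 n3)) (div_ne_zero n6 n5)]
    have : (c - a) / (b - a) * ((a - b) / (c - b)) * ((b - c) / (a - c)) = -1 := by
      field_simp
      ring
    rw [this, Complex.arg_neg_one]
  obtain ⟨k, hk⟩ := Real.Angle.angle_eq_iff_two_pi_dvd_sub.1 e
  have hpi := Real.pi_pos
  have k1 : (-1 : ℝ) < k := by nlinarith [a1.1, a1.2, a2.1, a2.2, a3.1, a3.2]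
  have k2 : (k : ℝ) < 1 := by nlinarith [a1.1, a1.2, a2.1, a2.2, a3.1, a3.2]
  have k0 : k = 0 := by
    have : (-1 : ℤ) < k := by exact_mod_cast k1
    have : k < (1 : ℤ) := by exact_mod_cast k2
    omega
  rw [k0] at hk
  push_cast at hk
  linarith

theorem Pentagon.sum_angle (P : Pentagon) (hP : IsStrictlyConvexPent P.vertex) :
    ∑ i, P.angle i = 3 * Real.pi := by
  have e : ∀ i, P.angle i = _ := fun i => P.angle_eq_arg i (hP.orient_pred_pos i).le
  simp only [Fin.sum_univ_five, e, Fin.isValue, Fin.reduceAdd, zero_add]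
  have h : ∀ i j, j ≠ i → j ≠ i + 1 → 0 < orient (P.vertex i) (P.vertex (i + 1)) (P.vertex j) := hP
  set v := P.vertex
  have o012 : 0 < orient (v 0) (v 1) (v 2) := h 0 2 (by decide) (by decide)
  have o013 : 0 < orient (v 0) (v 1) (v 3) := h 0 3 (by decide) (by decide)
  have o014 : 0 < orient (v 0) (v 1) (v 4) := h 0 4 (by decide) (by decide)
  have o230 : 0 < orient (v 2) (v 3) (v 0) := h 2 0 (by decide) (by decide)
  have o231 : 0 < orient (v 2) (v 3) (v 1) := h 2 1 (by decide) (by decide)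
  have o342 : 0 < orient (v 3) (v 4) (v 2) := h 3 2 (by decide) (by decide)
  have o340 : 0 < orient (v 3) (v 4) (v 0) := h 3 0 (by decide) (by decide)
  have o023 : 0 < orient (v 0) (v 2) (v 3) := by rwa [← orient_rotate]
  have o034 : 0 < orient (v 0) (v 3) (v 4) := by rwa [← orient_rotate]
  have o201 : 0 < orient (v 2) (v 0) (v 1) := by rwa [orient_rotate (v 1), orient_rotate (v 0)]
  have o302 : 0 < orient (v 3) (v 0) (v 2) := by rwa [orient_rotate (v 2), orient_rotate (v 0)]
  have s1 := arg_add_of_orient_pos o013 o034 o014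
  have s2 := arg_add_of_orient_pos o012 o023 o013
  have s3 := arg_add_of_orient_pos o230 o201 o231
  have s4 := arg_add_of_orient_pos o340 o302 o342
  have t1 := arg_triangle_sum o012
  have t2 := arg_triangle_sum o023
  have t3 := arg_triangle_sum o034
  linarith

/-! ### Convexity of the half-angle cotangent -/

theorem hasDerivAt_halfCot {x : ℝ} (hx : x ∈ Set.Ioo 0 Real.pi) :
    HasDerivAt halfCot (-(1 - Real.cos x)⁻¹) x := by
  have hs := Real.sin_pos_of_mem_Ioo hx
  have hsq := Real.sin_sq_add_cos_sq x
  have hc : 1 - Real.cos x ≠ 0 := by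
    intro h
    have : Real.cos x = 1 := by linarith
    rw [this] at hsq
    nlinarith
  have := ((Real.hasDerivAt_cos x).const_add 1).div (Real.hasDerivAt_sin x) hs.ne'
  refine this.congr_deriv ?_
  have e : -Real.sin x * Real.sin x - (1 + Real.cos x) * Real.cos x = -(1 + Real.cos x) := by
    linear_combination -hsq
  rw [e]
  have e2 : Real.sin x ^ 2 = (1 - Real.cos x) * (1 + Real.cos x) := by linear_combination hsq
  have hc2 : 1 + Real.cos x ≠ 0 := by
    intro h
    rw [h, mul_zero] at e2
    nlinarith
  rw [e2]
  field_simp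

/-- The graph of `halfCot` lies above its tangents. -/
theorem halfCot_ge_tangent {x y : ℝ} (hx : x ∈ Set.Ioo 0 Real.pi) (hy : y ∈ Set.Ioo 0 Real.pi) :
    halfCot y - (x - y) * (1 - Real.cos y)⁻¹ ≤ halfCot x := by
  have hsub : ∀ a ∈ Set.Ioo 0 Real.pi, ∀ b ∈ Set.Ioo 0 Real.pi, Set.Icc a b ⊆ Set.Ioo 0 Real.pi :=
    fun a ha b hb z hz => ⟨ha.1.trans_le hz.1, hz.2.trans_lt hb.2⟩
  have hcos : ∀ z ∈ Set.Ioo 0 Real.pi, 0 < 1 - Real.cos z := by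
    intro z hz
    have := Real.sin_pos_of_mem_Ioo hz
    nlinarith [Real.sin_sq_add_cos_sq z, Real.cos_le_one z]
  have mono : ∀ a ∈ Set.Ioo 0 Real.pi, ∀ b ∈ Set.Ioo 0 Real.pi, a ≤ b →
      (1 - Real.cos b)⁻¹ ≤ (1 - Real.cos a)⁻¹ := by
    intro a ha b hb hab
    apply inv_anti₀ (hcos a ha)
    have := Real.cos_le_cos_of_nonneg_of_le_pi ha.1.le hb.2.le hab
    linarith
  rcases lt_trichotomy x y with h | rfl | h
  · obtain ⟨c, hc, he⟩ := exists_hasDerivAt_eq_slope halfCot (fun z => -(1 - Real.cos z)⁻¹) h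
      (fun z hz => (hasDerivAt_halfCot (hsub x hx y hy hz)).continuousAt.continuousWithinAt)
      (fun z hz => hasDerivAt_halfCot (hsub x hx y hy (Set.Ioo_subset_Icc_self hz)))
    have hc' := hsub x hx y hy (Set.Ioo_subset_Icc_self hc)
    have m := mono c hc' y hy hc.2.le
    rw [eq_div_iff (by linarith)] at he
    nlinarith
  · simp
  · obtain ⟨c, hc, he⟩ := exists_hasDerivAt_eq_slope halfCot (fun z => -(1 - Real.cos z)⁻¹) h
      (fun z hz => (hasDerivAt_halfCot (hsub y hy x hx hz)).continuousAt.continuousWithinAt)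
      (fun z hz => hasDerivAt_halfCot (hsub y hy x hx (Set.Ioo_subset_Icc_self hz)))
    have hc' := hsub y hy x hx (Set.Ioo_subset_Icc_self hc)
    have m := mono y hy c hc' hc.1.le
    rw [eq_div_iff (by linarith)] at he
    nlinarith

theorem cos_two_pi_div_three : Real.cos (2 * Real.pi / 3) = -(1 / 2) := by
  rw [show 2 * Real.pi / 3 = Real.pi - Real.pi / 3 by ring, Real.cos_pi_sub, Real.cos_pi_div_three]

theorem halfCot_pi_div_two : halfCot (Real.pi / 2) = 1 := by
  simp [halfCot]

theorem halfCot_two_pi_div_three : halfCot (2 * Real.pi / 3) = Real.sqrt 3 / 3 := by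
  have h : Real.sin (2 * Real.pi / 3) = Real.sqrt 3 / 2 := by
    rw [show 2 * Real.pi / 3 = Real.pi - Real.pi / 3 by ring, Real.sin_pi_sub,
      Real.sin_pi_div_three]
  rw [halfCot, h, cos_two_pi_div_three]
  have h3 : Real.sqrt 3 ^ 2 = 3 := Real.sq_sqrt (by norm_num)
  have : Real.sqrt 3 ≠ 0 := by positivity
  field_simp
  linarith

theorem halfCot_ge_tangent_pi_div_two {x : ℝ} (hx : x ∈ Set.Ioo 0 Real.pi) :
    1 + Real.pi / 2 - x ≤ halfCot x := by
  have hpi := Real.pi_pos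
  have := halfCot_ge_tangent hx (y := Real.pi / 2) ⟨by linarith, by linarith⟩
  rw [halfCot_pi_div_two, Real.cos_pi_div_two] at this
  linarith

theorem halfCot_ge_tangent_two_pi_div_three {x : ℝ} (hx : x ∈ Set.Ioo 0 Real.pi) :
    Real.sqrt 3 / 3 + 4 * Real.pi / 9 - 2 / 3 * x ≤ halfCot x := by
  have hpi := Real.pi_pos
  have := halfCot_ge_tangent hx (y := 2 * Real.pi / 3) ⟨by linarith, by linarith⟩
  rw [halfCot_two_pi_div_three, cos_two_pi_div_three] at this
  norm_num at this
  linarith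

/-! ### Perimeters of circumscribed pentagons -/

theorem Pentagon.exists_angle_eq (P : Pentagon) (i : Fin 5) : ∃ k : ℤ, P.angle i =
    Complex.arg ((P.vertex (i + 4) - P.vertex i) / (P.vertex (i + 1) - P.vertex i)) -
      k * (2 * Real.pi) := by
  have h4 : i - 1 = i + 4 := by clear * -; revert i; decide
  refine ⟨toIcoDiv Real.two_pi_pos 0 (Complex.arg
    ((P.vertex (i - 1) - P.vertex i) / (P.vertex (i + 1) - P.vertex i))), ?_⟩
  rw [Pentagon.angle, ← h4, ← zsmul_eq_mul, self_sub_toIcoDiv_zsmul]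

theorem Pentagon.sin_angle (P : Pentagon) (i : Fin 5) :
    Real.sin (P.angle i) = turnSin P.vertex i := by
  obtain ⟨k, hk⟩ := P.exists_angle_eq i
  rw [hk, Real.sin_sub_int_mul_two_pi, sin_arg_corner P.vertex_ne]

theorem Pentagon.cos_angle (P : Pentagon) (i : Fin 5) :
    Real.cos (P.angle i) = -turnCos P.vertex i := by
  obtain ⟨k, hk⟩ := P.exists_angle_eq i
  rw [hk, Real.cos_sub_int_mul_two_pi, cos_arg_corner P.vertex_ne]

/-- A pentagon all of whose interior angles lie between a right and a straight angle is strictly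
convex. -/
theorem Pentagon.isStrictlyConvex_of_obtuse (P : Pentagon)
    (h : ∀ i, Real.pi / 2 ≤ P.angle i ∧ P.angle i < Real.pi) : IsStrictlyConvexPent P.vertex := by
  have hpi := Real.pi_pos
  have hs : ∀ i, 0 < turnSin P.vertex i := fun i => by
    rw [← P.sin_angle]
    exact Real.sin_pos_of_pos_of_lt_pi (by linarith [(h i).1]) (h i).2
  have hc : ∀ i, 0 ≤ turnCos P.vertex i := fun i => by
    have := Real.cos_nonpos_of_pi_div_two_le_of_le (h i).1 (by linarith [(h i).2])
    rw [P.cos_angle] at this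
    linarith
  have hpos : ∀ i, 0 < orient (P.vertex (i + 4)) (P.vertex i) (P.vertex (i + 1)) := fun i => by
    rw [orient_eq_turnSin P.vertex_ne]
    have h4 := P.vertex_ne (i + 4)
    rw [show i + 4 + 1 = i by clear * -; revert i; decide] at h4
    exact mul_pos (mul_pos (dist_pos.2 h4) (dist_pos.2 (P.vertex_ne i))) (hs i)
  have e1 : ∀ i : Fin 5, i + 1 + 4 = i := by decide
  have e2 : ∀ i : Fin 5, i + 1 + 1 = i + 2 := by decide
  have e3 : ∀ i : Fin 5, i + 2 + 4 = i + 1 := by decide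
  have e4 : ∀ i : Fin 5, i + 2 + 1 = i + 3 := by decide
  intro i j hj hj1
  have : ∀ i j : Fin 5, j ≠ i → j ≠ i + 1 → j = i + 2 ∨ j = i + 3 ∨ j = i + 4 := by decide
  rcases this i j hj hj1 with rfl | rfl | rfl
  · have := hpos (i + 1)
    rwa [e1, e2] at this
  · have d1 := edgeDir_smul (P.vertex_ne (i + 1))
    have d2 := edgeDir_smul (P.vertex_ne (i + 2))
    rw [e2] at d1
    rw [e4] at d2
    have n2 := edgeDir_sq (P.vertex_ne (i + 1))
    have s1 := hs (i + 1)
    have s2 := hs (i + 2)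
    have c1 := hc (i + 1)
    have c2 := hc (i + 2)
    have key : 0 ≤ cross (edgeDir P.vertex i) (edgeDir P.vertex (i + 2)) := by
      have : cross (edgeDir P.vertex i) (edgeDir P.vertex (i + 2)) =
          turnCos P.vertex (i + 1) * turnSin P.vertex (i + 2) +
          turnCos P.vertex (i + 2) * turnSin P.vertex (i + 1) := by
        simp only [turnCos, turnSin, e1, e3, cross, dot]
        linear_combination -((edgeDir P.vertex i).re * (edgeDir P.vertex (i + 2)).im -
          (edgeDir P.vertex i).im * (edgeDir P.vertex (i + 2)).re) * n2
      rw [this]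
      positivity
    rw [orient_eq_dist_mul_cross (P.vertex_ne i)]
    refine mul_pos (dist_pos.2 (P.vertex_ne i)) ?_
    have l1 : 0 < dist (P.vertex (i + 1)) (P.vertex (i + 2)) := by
      have := P.vertex_ne (i + 1); rw [e2] at this; exact dist_pos.2 this
    have : supportDist P.vertex (P.vertex (i + 3)) i =
        dist (P.vertex (i + 1)) (P.vertex (i + 2)) * turnSin P.vertex (i + 1) +
        dist (P.vertex (i + 2)) (P.vertex (i + 3)) *
          cross (edgeDir P.vertex i) (edgeDir P.vertex (i + 2)) := by
      have d0 := edgeDir_smul (P.vertex_ne i)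
      have : P.vertex (i + 3) - P.vertex i = dist (P.vertex i) (P.vertex (i + 1)) •
          edgeDir P.vertex i + (dist (P.vertex (i + 1)) (P.vertex (i + 2)) •
          edgeDir P.vertex (i + 1) + dist (P.vertex (i + 2)) (P.vertex (i + 3)) •
          edgeDir P.vertex (i + 2)) := by
        rw [← d0, ← d1, ← d2]; ring
      rw [supportDist, this]
      simp only [turnSin, e1, cross, Complex.add_re, Complex.add_im, Complex.real_smul,
        Complex.mul_re, Complex.mul_im, Complex.ofReal_re, Complex.ofReal_im]
      ring
    rw [this]
    exact add_pos_of_pos_of_nonneg (mul_pos l1 s1) (mul_nonneg dist_nonneg key)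
  · rw [orient_rotate]
    exact hpos i

theorem cross_le_dist {u z w : ℂ} (h : u.re ^ 2 + u.im ^ 2 = 1) : cross u (z - w) ≤ dist z w := by
  rw [Complex.dist_eq]
  have h1 : cross u (z - w) ^ 2 ≤ ‖z - w‖ ^ 2 := by
    rw [← Complex.normSq_eq_norm_sq, Complex.normSq_apply, cross]
    nlinarith [sq_nonneg (u.re * (z - w).re + u.im * (z - w).im)]
  exact (abs_le_of_sq_le_sq' h1 (norm_nonneg _)).2

/-- Equality in Lindelöf's inequality for circumscribed pentagons: all feet of perpendiculars from
the centre are at distance `r * turnTan` from the adjacent vertices. -/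
theorem Pentagon.perimeter_sq_of_circumscribed (P : Pentagon)
    (hP : IsStrictlyConvexPent P.vertex) (hc : P.IsCircumscribed) (hA : P.HasUnitArea) :
    P.perimeter ^ 2 = 4 * ∑ i, halfCot (P.angle i) := by
  obtain ⟨c, r, hr, hball, htan⟩ := hc
  have hreg : P.region = leftRegion P.vertex := hP.pentRegion_eq
  have hsup : ∀ i, supportDist P.vertex c i = r := by
    intro i
    have hu := edgeDir_sq (P.vertex_ne i)
    apply le_antisymm
    · obtain ⟨z, hz, hzr⟩ := htan i
      have h0 := orient_eq_zero_of_mem_segment hz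
      rw [orient_eq_dist_mul_cross (P.vertex_ne i)] at h0
      have h0' := (mul_eq_zero.1 h0).resolve_left (dist_ne_zero.2 (P.vertex_ne i))
      have : supportDist P.vertex c i = cross (edgeDir P.vertex i) (c - z) := by
        unfold supportDist cross at *
        simp only [Complex.sub_re, Complex.sub_im] at *
        linarith
      rw [this, ← hzr, dist_comm]
      exact cross_le_dist hu
    · -- the points of the disk that approach the edge line as much as possible stay left of it
      by_contra hlt
      push Not at hlt
      set s := max (supportDist P.vertex c i) 0 with hs
      have hsr : s < r := max_lt hlt hr
      set t := (s + r) / 2 with ht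
      have ht0 : 0 ≤ t := by have := le_max_right (supportDist P.vertex c i) 0; linarith
      set w : ℂ := c + t • (⟨(edgeDir P.vertex i).im, -(edgeDir P.vertex i).re⟩ : ℂ) with hw
      have hmem : w ∈ Metric.ball c r := by
        rw [Metric.mem_ball, Complex.dist_eq, hw, add_sub_cancel_left, norm_smul]
        have hn : ‖(⟨(edgeDir P.vertex i).im, -(edgeDir P.vertex i).re⟩ : ℂ)‖ = 1 := by
          rw [Complex.norm_def, Complex.normSq_mk, Real.sqrt_eq_one]
          linarith
        rw [hn, mul_one, Real.norm_of_nonneg ht0]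
        linarith
      have h1 : w ∈ leftRegion P.vertex := hreg ▸ hball hmem
      have h2 := h1 i
      rw [orient_eq_dist_mul_cross (P.vertex_ne i)] at h2
      have h3 := nonneg_of_mul_nonneg_right h2 (dist_pos.2 (P.vertex_ne i))
      have h4 : supportDist P.vertex w i = supportDist P.vertex c i - t := by
        simp only [supportDist, hw, cross, Complex.add_re, Complex.add_im, Complex.sub_re,
          Complex.sub_im, Complex.real_smul, Complex.mul_re, Complex.mul_im, Complex.ofReal_re,
          Complex.ofReal_im]
        linear_combination (-t) * hu
      have h5 := le_max_left (supportDist P.vertex c i) 0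
      linarith
  obtain ⟨x, y, hxy, hx, hy⟩ := hP.exists_foot c
  have hx' : ∀ i, x i = r * turnTan P.vertex i := fun i => by
    rw [hx, hsup, hsup, turnTan]; ring
  have hy' : ∀ i, y (i + 4) = r * turnTan P.vertex i := fun i => by
    rw [hy, hsup, hsup, turnTan]; ring
  have hL : P.perimeter = 2 * r * ∑ i, turnTan P.vertex i := by
    unfold Pentagon.perimeter
    simp_rw [← hxy]
    rw [Finset.sum_add_distrib, ← Equiv.sum_comp (Equiv.addRight (4 : Fin 5)) y]
    simp only [Equiv.coe_addRight, hx', hy', ← Finset.mul_sum]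
    ring
  have hA1 : pentSignedArea P.vertex = 1 := by
    have h1 : volume P.region = ENNReal.ofReal (pentSignedArea P.vertex) := hP.volume_pentRegion
    rw [hA] at h1
    have := P.ccw
    exact (ENNReal.ofReal_eq_one.1 h1.symm)
  have hA2 := hP.area_eq_support c
  simp only [hsup, ← Finset.mul_sum] at hA2
  have hA3 : 2 = r * P.perimeter := by
    rw [hA1, mul_one] at hA2; exact hA2
  simp only [← P.turnTan_eq_halfCot hP]
  have : (∑ i, turnTan P.vertex i) * r ^ 2 = 1 := by
    rw [hL] at hA3; linarith
  rw [hL]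
  linear_combination 4 * (∑ i, turnTan P.vertex i) * this

theorem Pentagon.perimeter_sq_of_cairo_or_prismatic (C : Pentagon)
    (hC : C.IsCairo ∨ C.IsPrismatic) (hA : C.HasUnitArea) :
    C.perimeter ^ 2 = 4 * (2 + Real.sqrt 3) := by
  have hpi := Real.pi_pos
  have hall : ∀ k i : Fin 5, i = k ∨ i = k + 1 ∨ i = k + 2 ∨ i = k + 3 ∨ i = k + 4 := by decide
  have hsum : ∀ k, ∑ i, halfCot (C.angle i) = halfCot (C.angle k) + halfCot (C.angle (k + 1)) +
      halfCot (C.angle (k + 2)) + halfCot (C.angle (k + 3)) + halfCot (C.angle (k + 4)) := by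
    intro k
    rw [← Equiv.sum_comp (Equiv.addLeft k)]
    simp [Fin.sum_univ_five]
  have hmem : ∀ x, x = Real.pi / 2 ∨ x = 2 * Real.pi / 3 → Real.pi / 2 ≤ x ∧ x < Real.pi := by
    rintro x (rfl | rfl)
    · exact ⟨le_rfl, by linarith⟩
    · exact ⟨by linarith, by linarith⟩
  rcases hC with ⟨hc, k, h0, h2, h1, h3, h4⟩ | ⟨hc, k, h0, h1, h2, h3, h4⟩
  all_goals
    have hconv : IsStrictlyConvexPent C.vertex := by
      refine C.isStrictlyConvex_of_obtuse fun i => ?_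
      apply hmem
      rcases hall k i with rfl | rfl | rfl | rfl | rfl <;> tauto
    rw [C.perimeter_sq_of_circumscribed hconv hc hA, hsum k, h0, h1, h2, h3, h4,
      halfCot_pi_div_two, halfCot_two_pi_div_three]
    ring

/-! ### Pentagons that are not strictly convex are long -/

theorem Pentagon.perimeter_eq (P : Pentagon) (i : Fin 5) :
    P.perimeter = dist (P.vertex i) (P.vertex (i + 1)) +
      dist (P.vertex (i + 1)) (P.vertex (i + 2)) + dist (P.vertex (i + 2)) (P.vertex (i + 3)) +
      dist (P.vertex (i + 3)) (P.vertex (i + 4)) + dist (P.vertex (i + 4)) (P.vertex i) := by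
  unfold Pentagon.perimeter
  rw [← Equiv.sum_comp (Equiv.addLeft i)]
  simp [Fin.sum_univ_five, add_assoc]

theorem dist_sq (a b : ℂ) : dist a b ^ 2 = (a.re - b.re) ^ 2 + (a.im - b.im) ^ 2 := by
  rw [Complex.dist_eq, ← Complex.normSq_eq_norm_sq, Complex.normSq_apply]
  simp only [Complex.sub_re, Complex.sub_im]; ring

/-- The isoperimetric inequality for triangles. -/
theorem triangle_isoperimetric (a b c : ℂ) :
    108 * orient a b c ^ 2 ≤ (dist a b + dist b c + dist c a) ^ 4 := by
  have hx := dist_sq a b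
  have hy := dist_sq b c
  have hz := dist_sq c a
  have t1 := dist_triangle a b c
  have t2 := dist_triangle b c a
  have t3 := dist_triangle c a b
  rw [dist_comm a c] at t1
  rw [dist_comm b a] at t2
  rw [dist_comm c b] at t3
  set x := dist a b
  set y := dist b c
  set z := dist c a
  -- Heron's formula
  have heron : 4 * orient a b c ^ 2 = (x + y + z) * ((x + y - z) * (y + z - x) * (z + x - y)) := by
    have : 4 * orient a b c ^ 2 = 4 * x ^ 2 * z ^ 2 - (x ^ 2 + z ^ 2 - y ^ 2) ^ 2 := by
      rw [hx, hy, hz]; unfold orient; ring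
    rw [this]; ring
  have amgm : ∀ p q r : ℝ, 0 ≤ p → 0 ≤ q → 0 ≤ r → 27 * (p * q * r) ≤ (p + q + r) ^ 3 := by
    intro p q r hp hq hr
    nlinarith [mul_nonneg hp (sq_nonneg (q - r)), mul_nonneg hq (sq_nonneg (p - r)),
      mul_nonneg hr (sq_nonneg (p - q)), mul_nonneg (add_nonneg (add_nonneg hp hq) hr)
      (add_nonneg (add_nonneg (sq_nonneg (p - q)) (sq_nonneg (q - r))) (sq_nonneg (p - r)))]
  have h := amgm (x + y - z) (y + z - x) (z + x - y) (by linarith) (by linarith) (by linarith)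
  have h0 : 0 ≤ x + y + z := by positivity
  have h1 := mul_le_mul_of_nonneg_left h h0
  have e : x + y - z + (y + z - x) + (z + x - y) = x + y + z := by ring
  rw [e] at h1
  linarith

theorem orient_le_dist_mul_dist (a b c : ℂ) : orient a b c ≤ dist a b * dist b c := by
  have h : orient a b c ^ 2 ≤ (dist a b * dist b c) ^ 2 := by
    rw [mul_pow, dist_sq, dist_sq]
    unfold orient
    nlinarith [sq_nonneg ((a.re - b.re) * (b.re - c.re) + (a.im - b.im) * (b.im - c.im))]
  exact (abs_le_of_sq_le_sq' h (by positivity)).2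

/-- The isoperimetric inequality for quadrilaterals. -/
theorem quadrilateral_isoperimetric (a b c d : ℂ) :
    (orient a b c + orient a c d) / 2 ≤ (dist a b + dist b c + dist c d + dist d a) ^ 2 / 16 := by
  have h1 := orient_le_dist_mul_dist a b c
  have h2 := orient_le_dist_mul_dist c d a
  have h3 := orient_le_dist_mul_dist d a b
  have h4 := orient_le_dist_mul_dist b c d
  have e : orient a b c + orient c d a = orient d a b + orient b c d := by
    unfold orient; ring
  rw [← orient_rotate a c d]
  nlinarith [sq_nonneg (dist a b + dist c d - dist b c - dist d a)]

theorem Pentagon.volume_region_le (P : Pentagon) {s : Set ℂ}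
    (h : Set.range P.vertex ⊆ convexHull ℝ s) : volume P.region ≤ volume (convexHull ℝ s) :=
  measure_mono ((pentRegion_subset_convexHull _).trans (convexHull_min h (convex_convexHull ℝ _)))

/-- A unit-area pentagon inside a triangle whose perimeter it exceeds is longer than the unit-area
equilateral triangle, whose perimeter is about `4.559`. -/
theorem Pentagon.perimeter_of_hull_triangle (P : Pentagon) (hA : P.HasUnitArea) {a b c : ℂ}
    (h : Set.range P.vertex ⊆ convexHull ℝ {a, b, c})
    (hL : dist a b + dist b c + dist c a ≤ P.perimeter) : (91 / 20 : ℝ) ≤ P.perimeter := by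
  have h1 := P.volume_region_le h
  rw [hA, volume_convexHull_triple, ENNReal.one_le_ofReal] at h1
  have h2 : 4 ≤ orient a b c ^ 2 := by
    rw [← sq_abs]; nlinarith [abs_nonneg (orient a b c)]
  have h3 := triangle_isoperimetric a b c
  have h0 : 0 ≤ dist a b + dist b c + dist c a := by positivity
  by_contra hlt
  push Not at hlt
  have h4 : (dist a b + dist b c + dist c a) ^ 4 ≤ (91 / 20) ^ 4 :=
    pow_le_pow_left₀ h0 (by linarith) 4
  norm_num at h4
  linarith

theorem Pentagon.perimeter_of_triangle_shape (P : Pentagon) (hA : P.HasUnitArea)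
    (h : ∃ i, Set.range P.vertex ⊆
        convexHull ℝ {P.vertex i, P.vertex (i + 1), P.vertex (i + 2)} ∨
      Set.range P.vertex ⊆
        convexHull ℝ {P.vertex i, P.vertex (i + 1), P.vertex (i + 3)}) :
    (91 / 20 : ℝ) ≤ P.perimeter := by
  obtain ⟨i, h | h⟩ := h
  · refine P.perimeter_of_hull_triangle hA h ?_
    rw [P.perimeter_eq i]
    have := dist_triangle4 (P.vertex (i + 2)) (P.vertex (i + 3)) (P.vertex (i + 4)) (P.vertex i)
    linarith
  · refine P.perimeter_of_hull_triangle hA h ?_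
    rw [P.perimeter_eq i]
    have := dist_triangle (P.vertex (i + 1)) (P.vertex (i + 2)) (P.vertex (i + 3))
    have := dist_triangle (P.vertex (i + 3)) (P.vertex (i + 4)) (P.vertex i)
    linarith

theorem sqrt_three_bounds : (173 / 100 : ℝ) < Real.sqrt 3 ∧ Real.sqrt 3 < 17321 / 10000 := by
  constructor
  · exact Real.lt_sqrt_of_sq_lt (by norm_num)
  · rw [Real.sqrt_lt' (by norm_num)]; norm_num

theorem Pentagon.IsEfficient.isStrictlyConvex {P : Pentagon} (hP : P.IsEfficient) :
    IsStrictlyConvexPent P.vertex := by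
  obtain ⟨hA, C, hC, hC1, hle⟩ := hP
  have hsq := C.perimeter_sq_of_cairo_or_prismatic (Or.inl hC) hC1
  have hs := sqrt_three_bounds
  have hlt : P.perimeter < 4 := by
    refine lt_of_le_of_lt hle (lt_of_pow_lt_pow_left₀ 2 (by norm_num) ?_)
    rw [hsq]; linarith
  have h0 : 0 ≤ P.perimeter := Finset.sum_nonneg fun _ _ => dist_nonneg
  rcases P.shape with h | ⟨i, hi, h1, h2, h3, h4⟩ | h
  · exact h
  · exfalso
    have hr : Set.range P.vertex ⊆ convexHull ℝ
        {P.vertex (i + 1), P.vertex (i + 2), P.vertex (i + 3), P.vertex (i + 4)} := by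
      rintro _ ⟨j, rfl⟩
      have : ∀ i j : Fin 5, j = i ∨ j = i + 1 ∨ j = i + 2 ∨ j = i + 3 ∨ j = i + 4 := by decide
      rcases this i j with rfl | rfl | rfl | rfl | rfl
      · exact hi
      all_goals exact subset_convexHull ℝ _ (by simp)
    have k1 := (P.volume_region_le hr).trans (volume_convexHull_quadruple_le h1 h2 h3 h4)
    rw [hA, ENNReal.one_le_ofReal] at k1
    have k2 := quadrilateral_isoperimetric (P.vertex (i + 1)) (P.vertex (i + 2))
      (P.vertex (i + 3)) (P.vertex (i + 4))
    have k3 := P.perimeter_eq i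
    have k4 := dist_triangle (P.vertex (i + 4)) (P.vertex i) (P.vertex (i + 1))
    have k5 : dist (P.vertex (i + 1)) (P.vertex (i + 2)) + dist (P.vertex (i + 2))
      (P.vertex (i + 3)) + dist (P.vertex (i + 3)) (P.vertex (i + 4)) +
      dist (P.vertex (i + 4)) (P.vertex (i + 1)) < 4 := by linarith
    have k6 := pow_lt_pow_left₀ k5 (by positivity) two_ne_zero
    linarith
  · have := P.perimeter_of_triangle_shape hA h
    linarith

/-- Two reflex angles force the convex hull to be a triangle. -/
theorem Pentagon.IsType2.perimeter_ge {Q : Pentagon} (hQ : Q.IsType2) (hA : Q.HasUnitArea) :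
    (91 / 20 : ℝ) ≤ Q.perimeter := by
  rcases Q.shape with h | ⟨i, hi, h1, h2, h3, h4⟩ | h
  · exfalso
    have : {i | Real.pi < Q.angle i} = ∅ := by
      ext i
      simp only [Set.mem_ofPred_eq, Set.mem_empty_iff_false, iff_false, not_lt]
      exact (Q.angle_mem_Ioo h i).2.le
    rw [Pentagon.IsType2, this, Set.ncard_empty] at hQ
    omega
  · exfalso
    have e : ∀ i : Fin 5, i + 1 + 4 = i ∧ i + 1 + 1 = i + 2 ∧ i + 2 + 4 = i + 1 ∧
      i + 2 + 1 = i + 3 ∧ i + 3 + 4 = i + 2 ∧ i + 3 + 1 = i + 4 ∧ i + 4 + 4 = i + 3 ∧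
      i + 4 + 1 = i := by decide
    obtain ⟨e1, e2, e3, e4, e5, e6, e7, e8⟩ := e i
    have a1 : Q.angle (i + 1) ≤ Real.pi := by
      apply Q.angle_le_pi
      rw [e1, e2, ← orient_rotate]
      refine orient_nonneg_of_mem_convexHull ?_ hi
      rintro z (rfl | rfl | rfl | rfl) <;> unfold orient at * <;> nlinarith
    have a2 : Q.angle (i + 2) ≤ Real.pi := by
      apply Q.angle_le_pi
      rw [e3, e4]; exact h1.le
    have a3 : Q.angle (i + 3) ≤ Real.pi := by
      apply Q.angle_le_pi
      rw [e5, e6]; exact h4.le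
    have a4 : Q.angle (i + 4) ≤ Real.pi := by
      apply Q.angle_le_pi
      rw [e7, e8]
      refine orient_nonneg_of_mem_convexHull ?_ hi
      rintro z (rfl | rfl | rfl | rfl) <;> unfold orient at * <;> nlinarith
    have hsub : {j | Real.pi < Q.angle j} ⊆ {i} := by
      intro j hj
      have hj : Real.pi < Q.angle j := hj
      have : ∀ i j : Fin 5, j = i ∨ j = i + 1 ∨ j = i + 2 ∨ j = i + 3 ∨ j = i + 4 := by decide
      rcases this i j with rfl | rfl | rfl | rfl | rfl
      · rfl
      all_goals linarith
    have := Set.ncard_le_ncard hsub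
    rw [Set.ncard_singleton, hQ] at this
    omega
  · exact Q.perimeter_of_triangle_shape hA h

/-! ### Areas of small sectors -/

theorem sin_sub_nonpos_iff {t a : ℝ} (ht : t ∈ Set.Ioo (-Real.pi) Real.pi)
    (ha : a ∈ Set.Ioo 0 Real.pi) :
    (0 ≤ Real.sin t ∧ Real.sin (t - a) ≤ 0) ↔ t ∈ Set.Icc 0 a := by
  have hpi := Real.pi_pos
  constructor
  · rintro ⟨h1, h2⟩
    have h0 : 0 ≤ t := by
      by_contra h
      have := Real.sin_neg_of_neg_of_neg_pi_lt (not_le.1 h) ht.1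
      linarith
    refine ⟨h0, ?_⟩
    by_contra h
    have := Real.sin_pos_of_pos_of_lt_pi (show 0 < t - a by linarith) (by linarith [ha.1, ht.2])
    linarith
  · rintro ⟨h1, h2⟩
    exact ⟨Real.sin_nonneg_of_nonneg_of_le_pi h1 ht.2.le,
      Real.sin_nonpos_of_nonpos_of_neg_pi_le (by linarith) (by linarith [ha.2])⟩

theorem volume_sector {a r : ℝ} (ha : a ∈ Set.Ioo 0 Real.pi) (hr : 0 < r) :
    volume {z : ℂ | ‖z‖ < r ∧ 0 ≤ z.im ∧ z.im * Real.cos a - z.re * Real.sin a ≤ 0} =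
      ENNReal.ofReal (a * r ^ 2 / 2) := by
  set S := {z : ℂ | ‖z‖ < r ∧ 0 ≤ z.im ∧ z.im * Real.cos a - z.re * Real.sin a ≤ 0} with hS
  have hpi := Real.pi_pos
  have hSm : MeasurableSet S := by
    have h1 : MeasurableSet {z : ℂ | ‖z‖ < r} := measurableSet_lt measurable_norm measurable_const
    have h2 : MeasurableSet {z : ℂ | 0 ≤ z.im} :=
      measurableSet_le measurable_const Complex.measurable_im
    have h3 : MeasurableSet {z : ℂ | z.im * Real.cos a - z.re * Real.sin a ≤ 0} :=
      measurableSet_le ((Complex.measurable_im.mul_const _).sub (Complex.measurable_re.mul_const _))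
        measurable_const
    exact h1.inter (h2.inter h3)
  rw [← lintegral_indicator_one hSm, ← Complex.lintegral_comp_polarCoord_symm]
  have hprod : MeasurableSet (Set.Ioo 0 r ×ˢ Set.Icc 0 a) := measurableSet_Ioo.prod measurableSet_Icc
  have hsub : Set.Ioo 0 r ×ˢ Set.Icc 0 a ⊆ polarCoord.target := by
    rintro ⟨x, t⟩ ⟨hx, ht⟩
    rw [polarCoord_target]
    exact ⟨hx.1, by linarith [ht.1, show (x, t).2 = t from rfl], lt_of_le_of_lt ht.2 ha.2⟩
  have hfun : ∀ p ∈ polarCoord.target,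
      ENNReal.ofReal p.1 • S.indicator (1 : ℂ → ENNReal) (Complex.polarCoord.symm p) =
      (Set.Ioo 0 r ×ˢ Set.Icc 0 a).indicator (fun p => ENNReal.ofReal p.1) p := by
    rintro ⟨x, t⟩ hp
    rw [polarCoord_target] at hp
    obtain ⟨hx, ht⟩ := hp
    have hx : 0 < x := hx
    have hmem : Complex.polarCoord.symm (x, t) ∈ S ↔ (x, t) ∈ Set.Ioo 0 r ×ˢ Set.Icc 0 a := by
      have e1 : (Complex.polarCoord.symm (x, t)).re = x * Real.cos t := by
        rw [Complex.polarCoord_symm_apply]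
        simp [Complex.cos_ofReal_re, Complex.sin_ofReal_re]
      have e2 : (Complex.polarCoord.symm (x, t)).im = x * Real.sin t := by
        rw [Complex.polarCoord_symm_apply]
        simp [Complex.cos_ofReal_re, Complex.sin_ofReal_re]
      have e3 : ‖Complex.polarCoord.symm (x, t)‖ = x := by
        rw [Complex.norm_polarCoord_symm, abs_of_pos hx]
      rw [hS, Set.mem_ofPred_eq, e1, e2, e3, Set.mem_prod, ← sin_sub_nonpos_iff ht ha, Real.sin_sub]
      have e4 : x * Real.sin t * Real.cos a - x * Real.cos t * Real.sin a =
          x * (Real.sin t * Real.cos a - Real.cos t * Real.sin a) := by ring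
      rw [e4]
      constructor
      · rintro ⟨h1, h2, h3⟩
        exact ⟨⟨hx, h1⟩, nonneg_of_mul_nonneg_right h2 hx, nonpos_of_mul_nonpos_right h3 hx⟩
      · rintro ⟨h1, h2, h3⟩
        exact ⟨h1.2, mul_nonneg hx.le h2, mul_nonpos_of_nonneg_of_nonpos hx.le h3⟩
    by_cases h : Complex.polarCoord.symm (x, t) ∈ S
    · rw [Set.indicator_of_mem h, Set.indicator_of_mem (hmem.1 h)]
      simp
    · rw [Set.indicator_of_notMem h, Set.indicator_of_notMem (fun h' => h (hmem.2 h'))]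
      simp
  rw [setLIntegral_congr_fun polarCoord.open_target.measurableSet hfun,
    lintegral_indicator hprod, Measure.restrict_restrict hprod, Set.inter_eq_left.2 hsub,
    Measure.volume_eq_prod, ← Measure.prod_restrict]
  have hfst := lintegral_prod_mul (μ := volume.restrict (Set.Ioo 0 r))
    (ν := volume.restrict (Set.Icc 0 a)) (f := fun x => ENNReal.ofReal x) (g := fun _ => 1)
    (ENNReal.measurable_ofReal.aemeasurable) aemeasurable_const
  simp only [mul_one] at hfst
  rw [hfst, lintegral_one, Measure.restrict_apply_univ, Real.volume_Icc, sub_zero]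
  have hint : ∫⁻ x in Set.Ioo 0 r, ENNReal.ofReal x = ENNReal.ofReal (r ^ 2 / 2) := by
    rw [← ofReal_integral_eq_lintegral_ofReal]
    · congr 1
      rw [← integral_Ioc_eq_integral_Ioo, ← intervalIntegral.integral_of_le hr.le, integral_id]
      ring
    · exact (continuous_id.integrableOn_Icc (a := 0) (b := r)).mono_set Set.Ioo_subset_Icc_self
    · filter_upwards [self_mem_ae_restrict measurableSet_Ioo] with x hx
      exact hx.1.le
  rw [hint, ← ENNReal.ofReal_mul (by positivity)]
  congr 1
  ring

open Filter Topology in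
/-- Close to a vertex, a strictly convex pentagon is a sector. -/
theorem Pentagon.volume_inter_ball (P : Pentagon) (hP : IsStrictlyConvexPent P.vertex)
    (i : Fin 5) : ∀ᶠ r in 𝓝[>] (0 : ℝ), volume (P.region ∩ Metric.ball (P.vertex i) r) =
      ENNReal.ofReal (P.angle i * r ^ 2 / 2) := by
  have h4 : i + 4 + 1 = i := by clear * -; revert i; decide
  have hnear : ∀ᶠ w in 𝓝 (P.vertex i), ∀ j, j ≠ i → j ≠ i + 4 →
      0 < orient (P.vertex j) (P.vertex (j + 1)) w := by
    rw [eventually_all]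
    intro j
    by_cases hj : j = i
    · exact Eventually.of_forall fun w h => absurd hj h
    by_cases hj4 : j = i + 4
    · exact Eventually.of_forall fun w _ h => absurd hj4 h
    have := hP j i (Ne.symm hj) (by
      intro h; apply hj4; rw [h, add_assoc]; simp [show (1 : Fin 5) + 4 = 0 from rfl])
    filter_upwards [(continuous_orient _ _).continuousAt.eventually (lt_mem_nhds this)] with w hw _ _
    exact hw
  obtain ⟨ε, hε, hball⟩ := Metric.eventually_nhds_iff_ball.1 hnear
  filter_upwards [Ioo_mem_nhdsGT hε] with r hr
  set u := edgeDir P.vertex i with hu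
  have hu1 := edgeDir_sq (P.vertex_ne i)
  rw [← hu] at hu1
  have hnu : ‖u‖ = 1 := by
    rw [Complex.norm_def, Complex.normSq_apply, Real.sqrt_eq_one]; linarith
  have hsin := P.sin_angle i
  have hcos := P.cos_angle i
  set c : Circle := ⟨u, by simp [Submonoid.unitSphere, hnu]⟩ with hc
  -- the rigid motion that takes the vertex to the origin and the edge into the positive real axis
  have himg : P.region ∩ Metric.ball (P.vertex i) r = (fun z => P.vertex i + z) ''
      (rotation c '' {z : ℂ | ‖z‖ < r ∧ 0 ≤ z.im ∧
        z.im * Real.cos (P.angle i) - z.re * Real.sin (P.angle i) ≤ 0}) := by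
    have hmem : ∀ z : ℂ, P.vertex i + u * z ∈ P.region ∩ Metric.ball (P.vertex i) r ↔
        ‖z‖ < r ∧ 0 ≤ z.im ∧
        z.im * Real.cos (P.angle i) - z.re * Real.sin (P.angle i) ≤ 0 := by
      intro z
      have hb : P.vertex i + u * z ∈ Metric.ball (P.vertex i) r ↔ ‖z‖ < r := by
        rw [Metric.mem_ball, Complex.dist_eq, add_sub_cancel_left, norm_mul, hnu, one_mul]
      have e1 : orient (P.vertex i) (P.vertex (i + 1)) (P.vertex i + u * z) =
          dist (P.vertex i) (P.vertex (i + 1)) * z.im := by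
        rw [orient_eq_dist_mul_cross (P.vertex_ne i), supportDist, ← hu, add_sub_cancel_left]
        simp only [cross, Complex.mul_re, Complex.mul_im]
        linear_combination (dist (P.vertex i) (P.vertex (i + 1)) * z.im) * hu1
      have e2 : orient (P.vertex (i + 4)) (P.vertex i) (P.vertex i + u * z) =
          dist (P.vertex (i + 4)) (P.vertex i) *
            -(z.im * Real.cos (P.angle i) - z.re * Real.sin (P.angle i)) := by
        have := orient_eq_dist_mul_cross (P.vertex_ne (i + 4)) (P.vertex i + u * z)
        have d := edgeDir_smul (P.vertex_ne (i + 4))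
        rw [h4] at this d
        rw [this, hsin, hcos, supportDist, turnSin, turnCos, ← hu]
        have : P.vertex i + u * z - P.vertex (i + 4) =
            u * z + dist (P.vertex (i + 4)) (P.vertex i) • edgeDir P.vertex (i + 4) := by
          rw [← d]; ring
        rw [this]
        simp only [cross, dot, Complex.add_re, Complex.add_im, Complex.mul_re, Complex.mul_im,
          Complex.real_smul, Complex.ofReal_re, Complex.ofReal_im]
        ring
      have d1 : 0 < dist (P.vertex i) (P.vertex (i + 1)) := dist_pos.2 (P.vertex_ne i)
      have d2 : 0 < dist (P.vertex (i + 4)) (P.vertex i) := by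
        have := P.vertex_ne (i + 4); rw [h4] at this; exact dist_pos.2 this
      have hreg : P.region = leftRegion P.vertex := hP.pentRegion_eq
      rw [Set.mem_inter_iff, hb, hreg]
      constructor
      · rintro ⟨h1, h2⟩
        have k1 := h1 i
        have k2 := h1 (i + 4)
        rw [h4] at k2
        rw [e1] at k1
        rw [e2] at k2
        refine ⟨h2, nonneg_of_mul_nonneg_right k1 d1, ?_⟩
        have := nonneg_of_mul_nonneg_right k2 d2
        linarith
      · rintro ⟨h1, h2, h3⟩
        refine ⟨fun j => ?_, h1⟩
        by_cases hj : j = i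
        · rw [hj, e1]; exact mul_nonneg d1.le h2
        by_cases hj4 : j = i + 4
        · rw [hj4, h4, e2]; exact mul_nonneg d2.le (by linarith)
        exact (hball _ (Metric.ball_subset_ball hr.2.le (hb.2 h1)) j hj hj4).le
    rw [Set.image_image]
    ext w
    constructor
    · intro hw
      have hu0 : u ≠ 0 := by intro h; rw [h] at hnu; simp at hnu
      have hw' : w = P.vertex i + u * ((w - P.vertex i) / u) := by
        rw [mul_div_cancel₀ _ hu0]; ring
      refine ⟨(w - P.vertex i) / u, ?_, ?_⟩
      · rw [Set.mem_ofPred_eq, ← hmem, ← hw']; exact hw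
      · beta_reduce; rw [rotation_apply]; exact hw'.symm
    · rintro ⟨z, hz, rfl⟩
      beta_reduce
      rw [rotation_apply]
      exact (hmem z).2 hz
  rw [himg, Set.image_add_left, measure_preimage_add,
    (rotation c).image_eq_preimage_symm,
    (rotation c).symm.measurePreserving.measure_preimage_emb
      (rotation c).symm.toHomeomorph.measurableEmbedding,
    volume_sector (P.angle_mem_Ioo hP i) hr.1]

/-! ### Edges and vertices of placed tiles -/

theorem segment_eq_segment {p q r s : ℂ} (h : segment ℝ p q = segment ℝ r s) :
    (p = r ∧ q = s) ∨ (p = s ∧ q = r) := by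
  have hp : p ∈ segment ℝ r s := h ▸ left_mem_segment ℝ p q
  have hq : q ∈ segment ℝ r s := h ▸ right_mem_segment ℝ p q
  have hr : r ∈ segment ℝ p q := h ▸ left_mem_segment ℝ r s
  have hs : s ∈ segment ℝ p q := h ▸ right_mem_segment ℝ r s
  by_cases hrs : r = s
  · subst hrs
    rw [segment_same] at hp hq
    exact Or.inl ⟨hp, hq⟩
  rw [segment_eq_image] at hp hq hr hs
  obtain ⟨t, ht, rfl⟩ := hp
  obtain ⟨t', ht', rfl⟩ := hq
  obtain ⟨a, ha, ha'⟩ := hr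
  obtain ⟨b, hb, hb'⟩ := hs
  have hne : s - r ≠ 0 := sub_ne_zero.2 (Ne.symm hrs)
  have e1 : (1 - a) * t + a * t' = 0 := by
    have : (((1 - a) * t + a * t' : ℝ) : ℂ) * (s - r) = 0 := by
      simp only [Complex.real_smul] at ha'
      push_cast at ha' ⊢
      linear_combination ha'
    exact_mod_cast (mul_eq_zero.1 this).resolve_right hne
  have e2 : (1 - b) * t + b * t' = 1 := by
    have : (((1 - b) * t + b * t' - 1 : ℝ) : ℂ) * (s - r) = 0 := by
      simp only [Complex.real_smul] at hb'
      push_cast at hb' ⊢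
      linear_combination hb'
    have := (mul_eq_zero.1 this).resolve_right hne
    have : (1 - b) * t + b * t' - 1 = 0 := by exact_mod_cast this
    linarith
  have z1 : (1 - a) * t = 0 := by
    nlinarith [mul_nonneg (sub_nonneg.2 ha.2) ht.1, mul_nonneg ha.1 ht'.1]
  have z2 : a * t' = 0 := by linarith
  rcases mul_eq_zero.1 z2 with h0 | h0
  · rw [h0] at z1
    have t0 : t = 0 := by linarith
    rw [t0] at e2
    have t1 : t' = 1 := by nlinarith [hb.1, hb.2, ht'.1, ht'.2]
    left; rw [t0, t1]; simp
  · rw [h0] at e2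
    have t1 : t = 1 := by nlinarith [hb.1, hb.2, ht.1, ht.2]
    right; rw [t1, h0]; simp

theorem IsSimplePent.vertex_mem_edge {v : Fin 5 → ℂ} (hv : IsSimplePent v) {k l : Fin 5}
    (h : v k ∈ pentEdge v l) : k = l ∨ k = l + 1 := by
  have h1 : v k ∈ pentEdge v k := left_mem_segment ℝ _ _
  have : ∀ k l : Fin 5, k = l ∨ k = l + 1 ∨ k = l + 2 ∨ l = k + 2 ∨ l = k + 1 := by decide
  rcases this k l with h2 | h2 | h2 | h2 | h2
  · exact Or.inl h2
  · exact Or.inr h2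
  · rw [h2] at h h1
    exact absurd h1 (Set.disjoint_left.1 (hv.2 l) h)
  · rw [h2] at h
    exact absurd h (Set.disjoint_left.1 (hv.2 k) h1)
  · rw [h2] at h
    have h3 : v k ∈ pentEdge v k ∩ pentEdge v (k + 1) := ⟨h1, h⟩
    rw [hv.1 k] at h3
    have h4 := hv.injective h3
    exact absurd h4 (by clear * -; revert k; decide)

theorem IsSimplePent.edge_injective {v : Fin 5 → ℂ} (hv : IsSimplePent v) {k l : Fin 5}
    (h : pentEdge v k = pentEdge v l) : k = l := by
  have h1 := hv.vertex_mem_edge (h ▸ left_mem_segment ℝ (v k) (v (k + 1)) : v k ∈ pentEdge v l)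
  have h2 := hv.vertex_mem_edge
    (h ▸ right_mem_segment ℝ (v k) (v (k + 1)) : v (k + 1) ∈ pentEdge v l)
  clear * - h1 h2
  revert k l; decide

/-- The determinant of a rigid motion is `1` or `-1`. -/
theorem exists_sign_orient (φ : ℂ ≃ᵃⁱ[ℝ] ℂ) :
    ∃ ε : ℝ, (ε = 1 ∨ ε = -1) ∧ ∀ a b c, orient (φ a) (φ b) (φ c) = ε * orient a b c := by
  obtain ⟨u, hu⟩ := linear_isometry_complex φ.linearIsometryEquiv
  have hsub : ∀ x y, φ x - φ y = φ.linearIsometryEquiv (x - y) := by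
    intro x y
    have := φ.map_vadd y (x - y)
    rw [vadd_eq_add, sub_add_cancel, vadd_eq_add] at this
    rw [this, add_sub_cancel_right]
  have hn : (u : ℂ).re ^ 2 + (u : ℂ).im ^ 2 = 1 := by
    have := u.normSq_coe
    rw [Complex.normSq_apply] at this
    linarith
  rcases hu with hu | hu
  · refine ⟨1, Or.inl rfl, fun a b c => ?_⟩
    rw [orient_eq_cross, hsub, hsub, hu, orient_eq_cross]
    simp only [rotation_apply, cross, Complex.mul_re, Complex.mul_im]
    linear_combination ((b - a).re * (c - a).im - (b - a).im * (c - a).re) * hn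
  · refine ⟨-1, Or.inr rfl, fun a b c => ?_⟩
    rw [orient_eq_cross, hsub, hsub, hu, orient_eq_cross]
    simp only [LinearIsometryEquiv.trans_apply, rotation_apply, cross, Complex.mul_re,
      Complex.mul_im, Complex.conjLIE_apply, Complex.conj_re, Complex.conj_im]
    linear_combination -((b - a).re * (c - a).im - (b - a).im * (c - a).re) * hn

theorem measurePreserving_affineIsometryEquiv (φ : ℂ ≃ᵃⁱ[ℝ] ℂ) :
    MeasurePreserving φ (volume : Measure ℂ) volume := by
  have : (φ : ℂ → ℂ) = (fun z => z + φ 0) ∘ φ.linearIsometryEquiv := by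
    ext z
    have := φ.map_vadd 0 z
    simpa using this
  rw [this]
  exact (measurePreserving_add_right volume (φ 0)).comp φ.linearIsometryEquiv.measurePreserving

/-- Double counting: if no three elements have the same image under `π`, then a sum over the domain
is at most twice the sum over the codomain. -/
theorem sum_le_two_mul_finsum {α β : Type*} [Fintype α] [Finite β] {f : α → ℝ} {g : β → ℝ}
    (π : α → β) (hg : ∀ b, 0 ≤ g b) (hfg : ∀ a, f a = g (π a))
    (h : ∀ a b c, a ≠ b → a ≠ c → b ≠ c → π a = π b → π a = π c → False) :
    ∑ a, f a ≤ 2 * ∑ᶠ b, g b := by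
  classical
  have : Fintype β := Fintype.ofFinite β
  rw [finsum_eq_sum_of_fintype, Finset.mul_sum, ← Finset.sum_fiberwise Finset.univ π f]
  refine Finset.sum_le_sum fun e _ => ?_
  have h1 : ∀ p ∈ Finset.univ.filter (fun p => π p = e), f p = g e := by
    intro p hp
    rw [hfg, (Finset.mem_filter.1 hp).2]
  rw [Finset.sum_congr rfl h1, Finset.sum_const, nsmul_eq_mul]
  refine mul_le_mul_of_nonneg_right ?_ (hg e)
  have h3 : (Finset.univ.filter fun p => π p = e).card ≤ 2 := by
    by_contra hlt
    obtain ⟨p, hp, q, hq, r, hr, hpq, hpr, hqr⟩ := Finset.two_lt_card.1 (not_le.1 hlt)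
    simp only [Finset.mem_filter, Finset.mem_univ, true_and] at hp hq hr
    exact h p q r hpq hpr hqr (hp.trans hq.symm) (hp.trans hr.symm)
  exact_mod_cast h3

namespace TorusTiling

variable {Λ : Submodule ℤ ℂ} {P Q : Pentagon} {n m : ℕ}

/-- The rigid motion that places the tile `a`, as a bundled isometry. -/
def place (T : TorusTiling Λ P Q n m) (a : (Fin n ⊕ Fin m) × Λ) : ℂ ≃ᵃⁱ[ℝ] ℂ :=
  (T.motion a.1).trans (AffineIsometryEquiv.constVAdd ℝ ℂ (a.2 : ℂ))

/-- The lifted tile `a` as a subset of the plane. -/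
abbrev tile (T : TorusTiling Λ P Q n m) (a : (Fin n ⊕ Fin m) × Λ) : Set ℂ :=
  placedRegion Λ P Q T.motion a

/-- The `k`-th vertex of the lifted tile `a`. -/
abbrev tileVertex (T : TorusTiling Λ P Q n m) (a : (Fin n ⊕ Fin m) × Λ) (k : Fin 5) : ℂ :=
  placedVertex Λ P Q T.motion a k

/-- The `k`-th edge of the lifted tile `a`. -/
abbrev tileEdge (T : TorusTiling Λ P Q n m) (a : (Fin n ⊕ Fin m) × Λ) (k : Fin 5) : Set ℂ :=
  placedEdge Λ P Q T.motion a k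

variable (T : TorusTiling Λ P Q n m)

theorem place_apply (a : (Fin n ⊕ Fin m) × Λ) (z : ℂ) :
    T.place a z = placement Λ T.motion a z := by
  simp [place, placement, add_comm]

theorem tile_eq (a : (Fin n ⊕ Fin m) × Λ) :
    T.tile a = T.place a '' (protoTile P Q a.1).region := by
  simp only [tile, placedRegion, ← place_apply]

theorem tileVertex_eq (a : (Fin n ⊕ Fin m) × Λ) (k : Fin 5) :
    T.tileVertex a k = T.place a ((protoTile P Q a.1).vertex k) := (T.place_apply _ _).symm

theorem tileEdge_eq (a : (Fin n ⊕ Fin m) × Λ) (k : Fin 5) :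
    T.tileEdge a k = T.place a '' pentEdge (protoTile P Q a.1).vertex k := by
  have h := image_segment ℝ (T.place a).toAffineEquiv.toAffineMap
    ((protoTile P Q a.1).vertex k) ((protoTile P Q a.1).vertex (k + 1))
  have e1 := T.tileVertex_eq a k
  have e2 := T.tileVertex_eq a (k + 1)
  change segment ℝ (T.tileVertex a k) (T.tileVertex a (k + 1)) = _
  rw [e1, e2]
  exact h.symm

theorem tileVertex_injective (a : (Fin n ⊕ Fin m) × Λ) : Function.Injective (T.tileVertex a) := by
  intro k l h
  rw [tileVertex_eq, tileVertex_eq] at h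
  exact (protoTile P Q a.1).simple.injective ((T.place a).injective h)

theorem tileVertex_mem_tileEdge {a : (Fin n ⊕ Fin m) × Λ} {k l : Fin 5}
    (h : T.tileVertex a k ∈ T.tileEdge a l) : k = l ∨ k = l + 1 := by
  rw [tileVertex_eq, tileEdge_eq, (T.place a).injective.mem_set_image] at h
  exact (protoTile P Q a.1).simple.vertex_mem_edge h

theorem tileEdge_injective {a : (Fin n ⊕ Fin m) × Λ} {k l : Fin 5}
    (h : T.tileEdge a k = T.tileEdge a l) : k = l := by
  rw [tileEdge_eq, tileEdge_eq] at h
  exact (protoTile P Q a.1).simple.edge_injective ((T.place a).injective.image_injective h)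

theorem tileVertex_mem_tile (a : (Fin n ⊕ Fin m) × Λ) (k : Fin 5) :
    T.tileVertex a k ∈ T.tile a := by
  rw [tileVertex_eq, tile_eq]
  exact Set.mem_image_of_mem _ (Or.inl (vertex_mem_pentBoundary _ k))

theorem isClosed_tile (a : (Fin n ⊕ Fin m) × Λ) : IsClosed (T.tile a) := by
  rw [tile_eq]
  exact (T.place a).toHomeomorph.isClosedMap _ (isClosed_pentRegion _)

/-- A vertex of one tile is a vertex of every tile that contains it. -/
theorem exists_tileVertex_eq {a b : (Fin n ⊕ Fin m) × Λ} {k : Fin 5}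
    (h : T.tileVertex a k ∈ T.tile b) : ∃ l, T.tileVertex b l = T.tileVertex a k := by
  by_cases hab : a = b
  · subst hab; exact ⟨k, rfl⟩
  rcases T.edge_to_edge a b hab _ ⟨T.tileVertex_mem_tile a k, h⟩ with ⟨k', l, _, hl⟩ |
    ⟨k', l, he, hk⟩
  · exact ⟨l, hl⟩
  · have hk' : k = k' ∨ k = k' + 1 := T.tileVertex_mem_tileEdge hk
    have hs : segment ℝ (T.tileVertex a k') (T.tileVertex a (k' + 1)) =
        segment ℝ (T.tileVertex b l) (T.tileVertex b (l + 1)) := he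
    rcases segment_eq_segment hs with ⟨h1, h2⟩ | ⟨h1, h2⟩ <;> rcases hk' with rfl | rfl
    exacts [⟨l, h1.symm⟩, ⟨l + 1, h2.symm⟩, ⟨l + 1, h1.symm⟩, ⟨l, h2.symm⟩]

open Filter Topology in
/-- Near an inner point of an edge, a tile contains one side of the edge. -/
theorem exists_side (a : (Fin n ⊕ Fin m) × Λ) (k : Fin 5) {z : ℂ} (hz : z ∈ T.tileEdge a k)
    (h1 : z ≠ T.tileVertex a k) (h2 : z ≠ T.tileVertex a (k + 1)) :
    ∃ σ : ℝ, (σ = 1 ∨ σ = -1) ∧ ∀ᶠ w in 𝓝 z,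
      0 < σ * orient (T.tileVertex a k) (T.tileVertex a (k + 1)) w → w ∈ T.tile a := by
  obtain ⟨ε, hε, hor⟩ := exists_sign_orient (T.place a)
  rw [tileEdge_eq] at hz
  obtain ⟨y, hy, rfl⟩ := hz
  rw [tileVertex_eq] at h1 h2
  have hy1 : y ≠ (protoTile P Q a.1).vertex k := fun h => h1 (by rw [h])
  have hy2 : y ≠ (protoTile P Q a.1).vertex (k + 1) := fun h => h2 (by rw [h])
  have key : ∀ p : ℂ → Prop, (∀ᶠ w in 𝓝 y, p w) →
      ∀ᶠ w in 𝓝 (T.place a y), p ((T.place a).symm w) := by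
    intro p hp
    have hc : Tendsto (T.place a).symm (𝓝 (T.place a y)) (𝓝 y) := by
      have := (T.place a).symm.continuous.tendsto (T.place a y)
      rwa [AffineIsometryEquiv.symm_apply_apply] at this
    exact hc.eventually hp
  have hor' : ∀ w, orient (T.tileVertex a k) (T.tileVertex a (k + 1)) w =
      ε * orient ((protoTile P Q a.1).vertex k) ((protoTile P Q a.1).vertex (k + 1))
        ((T.place a).symm w) := by
    intro w
    rw [tileVertex_eq, tileVertex_eq, ← hor, AffineIsometryEquiv.apply_symm_apply]
  have hεε : ε * ε = 1 := by rcases hε with rfl | rfl <;> norm_num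
  have hmem : ∀ w, (T.place a).symm w ∈ (protoTile P Q a.1).region → w ∈ T.tile a := by
    intro w hw
    rw [tile_eq]
    exact ⟨_, hw, (T.place a).apply_symm_apply w⟩
  rcases (protoTile P Q a.1).simple.exists_side hy hy1 hy2 with h | h
  · refine ⟨ε, hε, ?_⟩
    filter_upwards [key _ h] with w hw hpos
    rw [hor', ← mul_assoc, hεε, one_mul] at hpos
    exact hmem w (hw hpos)
  · refine ⟨-ε, by rcases hε with rfl | rfl <;> norm_num, ?_⟩
    filter_upwards [key _ h] with w hw hpos
    rw [hor', neg_mul, ← mul_assoc, hεε, one_mul] at hpos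
    exact hmem w (hw (by linarith))

open Filter Topology in
/-- Two different tiles with a common edge lie on different sides of it, so there are no three
such tiles. -/
theorem not_three_tiles {a b c : (Fin n ⊕ Fin m) × Λ} {k l j : Fin 5} (hab : a ≠ b) (hac : a ≠ c)
    (hbc : b ≠ c) (h1 : T.tileEdge b l = T.tileEdge a k) (h2 : T.tileEdge c j = T.tileEdge a k) :
    False := by
  set p := T.tileVertex a k with hp
  set q := T.tileVertex a (k + 1) with hq
  have hpq : p ≠ q := by
    intro h
    have := T.tileVertex_injective a h
    clear * - this
    revert k; decide
  have hpq' : q - p ≠ 0 := sub_ne_zero.2 hpq.symm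
  set z : ℂ := (1 / 2 : ℝ) • p + (1 / 2 : ℝ) • q with hz
  have hzseg : z ∈ segment ℝ p q := ⟨1 / 2, 1 / 2, by norm_num, by norm_num, by norm_num, rfl⟩
  have hzp : z ≠ p := by
    intro h
    apply hpq'
    rw [hz] at h
    simp only [Complex.real_smul] at h
    push_cast at h
    linear_combination 2 * h
  have hzq : z ≠ q := by
    intro h
    apply hpq'
    rw [hz] at h
    simp only [Complex.real_smul] at h
    push_cast at h
    linear_combination -2 * h
  have side : ∀ (d : (Fin n ⊕ Fin m) × Λ) (i : Fin 5), T.tileEdge d i = T.tileEdge a k →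
      ∃ σ : ℝ, (σ = 1 ∨ σ = -1) ∧ ∀ᶠ w in 𝓝 z, 0 < σ * orient p q w → w ∈ T.tile d := by
    intro d i hd
    have hs : segment ℝ (T.tileVertex d i) (T.tileVertex d (i + 1)) = segment ℝ p q := hd
    have hzd : z ∈ T.tileEdge d i := by rw [hd]; exact hzseg
    rcases segment_eq_segment hs with ⟨e1, e2⟩ | ⟨e1, e2⟩
    · obtain ⟨σ, hσ, h⟩ := T.exists_side d i hzd (by rwa [e1]) (by rwa [e2])
      rw [e1, e2] at h
      exact ⟨σ, hσ, h⟩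
    · obtain ⟨σ, hσ, h⟩ := T.exists_side d i hzd (by rwa [e1]) (by rwa [e2])
      rw [e1, e2] at h
      refine ⟨-σ, by rcases hσ with rfl | rfl <;> norm_num, ?_⟩
      filter_upwards [h] with w hw hpos
      apply hw
      rw [orient_swap]
      linarith
  have clash : ∀ (d d' : (Fin n ⊕ Fin m) × Λ) (σ : ℝ), d ≠ d' → (σ = 1 ∨ σ = -1) →
      (∀ᶠ w in 𝓝 z, 0 < σ * orient p q w → w ∈ T.tile d) →
      (∀ᶠ w in 𝓝 z, 0 < σ * orient p q w → w ∈ T.tile d') → False := by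
    intro d d' σ hdd hσ h h'
    obtain ⟨r, hr, hball⟩ := Metric.eventually_nhds_iff_ball.1 (h.and h')
    set U := Metric.ball z r ∩ {w | 0 < σ * orient p q w} with hU
    have hUo : IsOpen U := Metric.isOpen_ball.inter
      (isOpen_lt continuous_const (continuous_const.mul (continuous_orient p q)))
    have hUd : U ⊆ interior (T.tile d) :=
      interior_maximal (fun w hw => (hball w hw.1).1 hw.2) hUo
    have hUd' : U ⊆ interior (T.tile d') :=
      interior_maximal (fun w hw => (hball w hw.1).2 hw.2) hUo
    have hne : U.Nonempty := by
      -- a point displaced from `z` at right angles to the edge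
      have hN : 0 < ‖q - p‖ := norm_pos_iff.2 hpq'
      set t := r / (2 * ‖q - p‖) with ht
      have ht0 : 0 < t := by positivity
      have hσ1 : |σ| = 1 := by rcases hσ with rfl | rfl <;> norm_num
      have hσσ : σ * σ = 1 := by rcases hσ with rfl | rfl <;> norm_num
      refine ⟨z + ((σ * t : ℝ) : ℂ) * (Complex.I * (q - p)), ?_, ?_⟩
      · rw [Metric.mem_ball, Complex.dist_eq, add_sub_cancel_left, norm_mul, norm_mul,
          Complex.norm_I, one_mul, Complex.norm_real, Real.norm_eq_abs, abs_mul, hσ1, one_mul,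
          abs_of_pos ht0, ht]
        field_simp
        norm_num
      · have e : orient p q (z + ((σ * t : ℝ) : ℂ) * (Complex.I * (q - p))) =
            σ * t * ((q.re - p.re) ^ 2 + (q.im - p.im) ^ 2) := by
          have h0 := orient_eq_zero_of_mem_segment hzseg
          unfold orient at h0 ⊢
          simp only [Complex.add_re, Complex.add_im, Complex.mul_re, Complex.mul_im,
            Complex.ofReal_re, Complex.ofReal_im, Complex.I_re, Complex.I_im, Complex.sub_re,
            Complex.sub_im]
          linear_combination h0
        have hpos : 0 < (q.re - p.re) ^ 2 + (q.im - p.im) ^ 2 := by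
          have := Complex.normSq_pos.2 hpq'
          rw [Complex.normSq_apply] at this
          simp only [Complex.sub_re, Complex.sub_im] at this
          nlinarith
        rw [Set.mem_ofPred_eq, e]
        have : σ * (σ * t * ((q.re - p.re) ^ 2 + (q.im - p.im) ^ 2)) =
          t * ((q.re - p.re) ^ 2 + (q.im - p.im) ^ 2) := by
          linear_combination (t * ((q.re - p.re) ^ 2 + (q.im - p.im) ^ 2)) * hσσ
        rw [this]
        positivity
    obtain ⟨w, hw⟩ := hne
    exact Set.disjoint_left.1 (T.disjoint d d' hdd) (hUd hw) (hUd' hw)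
  obtain ⟨s, hs, ha⟩ := side a k rfl
  obtain ⟨s', hs', hb⟩ := side b l h1
  obtain ⟨s'', hs'', hc⟩ := side c j h2
  rcases hs with rfl | rfl <;> rcases hs' with rfl | rfl <;> rcases hs'' with rfl | rfl
  all_goals first
    | exact clash a b _ hab (by norm_num) ha hb
    | exact clash a c _ hac (by norm_num) ha hc
    | exact clash b c _ hbc (by norm_num) hb hc

/-- Each edge of the torus is a side of at most two tiles. -/
theorem not_three_sides {p q r : (Fin n ⊕ Fin m) × Fin 5} (hpq : p ≠ q) (hpr : p ≠ r) (hqr : q ≠ r)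
    (h1 : T.lifts q = T.lifts p) (h2 : T.lifts r = T.lifts p) : False := by
  have hmem : T.tileEdge (p.1, 0) p.2 ∈ T.lifts p := ⟨0, rfl⟩
  obtain ⟨l, hl⟩ : T.tileEdge (p.1, 0) p.2 ∈ T.lifts q := h1 ▸ hmem
  obtain ⟨l', hl'⟩ : T.tileEdge (p.1, 0) p.2 ∈ T.lifts r := h2 ▸ hmem
  have hl : T.tileEdge (q.1, l) q.2 = T.tileEdge (p.1, 0) p.2 := hl
  have hl' : T.tileEdge (r.1, l') r.2 = T.tileEdge (p.1, 0) p.2 := hl'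
  refine T.not_three_tiles (a := (p.1, 0)) (b := (q.1, l)) (c := (r.1, l')) ?_ ?_ ?_ hl hl'
  · intro h
    rw [← h] at hl
    exact hpq (Prod.ext (Prod.ext_iff.1 h).1 (T.tileEdge_injective hl).symm)
  · intro h
    rw [← h] at hl'
    exact hpr (Prod.ext (Prod.ext_iff.1 h).1 (T.tileEdge_injective hl').symm)
  · intro h
    rw [← h] at hl'
    exact hqr (Prod.ext (Prod.ext_iff.1 h).1 (T.tileEdge_injective (hl.trans hl'.symm)))

theorem sum_sideLength : ∑ p, T.sideLength p = n * P.perimeter + m * Q.perimeter := by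
  rw [Fintype.sum_prod_type, Fintype.sum_sum_type]
  simp [sideLength, protoTile, Pentagon.perimeter]

/-- Each edge is shared by at most two tiles. -/
theorem perimeters_le : n * P.perimeter + m * Q.perimeter ≤ 2 * T.perimeter := by
  rw [← T.sum_sideLength, TorusTiling.perimeter]
  refine sum_le_two_mul_finsum (fun p => (Quotient.mk T.sameEdge p : T.Edge)) (fun e => ?_)
    (fun p => rfl) fun p q r hpq hpr hqr h1 h2 =>
    T.not_three_sides hpq hpr hqr (Quotient.exact h1.symm) (Quotient.exact h2.symm)
  induction e using Quotient.inductionOn with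
  | h p => exact dist_nonneg

end TorusTiling

/-! ### Angles around the vertices of the tiling -/

namespace TorusTiling

variable {Λ : Submodule ℤ ℂ} {P Q : Pentagon} {n m : ℕ}
variable (T : TorusTiling Λ P Q n m)

/-- The position in the plane of a corner of a tile of the torus, for the chosen lift. -/
def cornerPos (p : (Fin n ⊕ Fin m) × Fin 5) : ℂ := T.motion p.1 ((protoTile P Q p.1).vertex p.2)

/-- The vertex of the tiled torus at a corner of a tile. -/
def cornerClass (p : (Fin n ⊕ Fin m) × Fin 5) : ℂ ⧸ Λ := Submodule.Quotient.mk (T.cornerPos p)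

open Filter Topology in
theorem volume_tile_inter_ball (hP : IsStrictlyConvexPent P.vertex) (i : Fin n) (l : Λ)
    (k : Fin 5) : ∀ᶠ r in 𝓝[>] (0 : ℝ),
      volume (T.tile (Sum.inl i, l) ∩ Metric.ball (T.tileVertex (Sum.inl i, l) k) r) =
        ENNReal.ofReal (P.angle k * r ^ 2 / 2) := by
  filter_upwards [P.volume_inter_ball hP k] with r hr
  have h1 : T.tile (Sum.inl i, l) ∩ Metric.ball (T.tileVertex (Sum.inl i, l) k) r =
      T.place (Sum.inl i, l) '' (P.region ∩ Metric.ball (P.vertex k) r) := by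
    rw [tile_eq, tileVertex_eq, Set.image_inter (T.place _).injective]
    congr 1
    exact ((T.place (Sum.inl i, l)).toIsometryEquiv.image_ball _ _).symm
  rw [h1, ← hr, ← (measurePreserving_affineIsometryEquiv (T.place (Sum.inl i, l))).measure_preimage_emb
    (T.place (Sum.inl i, l)).toHomeomorph.measurableEmbedding]
  congr 1
  exact Set.preimage_image_eq _ (T.place _).injective

theorem convex_tile (hP : IsStrictlyConvexPent P.vertex) (i : Fin n) (l : Λ) :
    Convex ℝ (T.tile (Sum.inl i, l)) := by
  rw [tile_eq]
  have h : Convex ℝ P.region := by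
    have : P.region = leftRegion P.vertex := hP.pentRegion_eq
    rw [this]
    exact convex_leftRegion _
  exact h.affine_image (T.place (Sum.inl i, l)).toAffineEquiv.toAffineMap

open Filter Topology in
/-- Around a point, the angles of the copies of `P` with a corner there sum to at most a full
turn. -/
theorem sum_angle_le (hP : IsStrictlyConvexPent P.vertex) (z : ℂ) (s : Finset (Fin n × Fin 5))
    (l : Fin n × Fin 5 → Λ)
    (hl : ∀ x ∈ s, T.tileVertex (Sum.inl x.1, l x) x.2 = z) :
    ∑ x ∈ s, P.angle x.2 ≤ 2 * Real.pi := by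
  have h1 : ∀ᶠ r in 𝓝[>] (0 : ℝ), ∀ x ∈ s,
      volume (T.tile (Sum.inl x.1, l x) ∩ Metric.ball z r) =
        ENNReal.ofReal (P.angle x.2 * r ^ 2 / 2) := by
    rw [Filter.eventually_all_finset]
    intro x hx
    have := T.volume_tile_inter_ball hP x.1 (l x) x.2
    rwa [hl x hx] at this
  obtain ⟨r, hr, hr0⟩ := (h1.and self_mem_nhdsWithin).exists
  have hr0 : 0 < r := hr0
  have hint : ∀ x ∈ s, volume (interior (T.tile (Sum.inl x.1, l x)) ∩ Metric.ball z r) =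
      ENNReal.ofReal (P.angle x.2 * r ^ 2 / 2) := by
    intro x hx
    rw [← hr x hx]
    exact measure_congr ((interior_ae_eq_of_null_frontier
      ((T.convex_tile hP x.1 (l x)).addHaar_frontier volume)).inter ae_eq_rfl)
  have hdisj : Set.PairwiseDisjoint (s : Set (Fin n × Fin 5))
      fun x => interior (T.tile (Sum.inl x.1, l x)) ∩ Metric.ball z r := by
    intro x hx y hy hxy
    refine Disjoint.mono Set.inter_subset_left Set.inter_subset_left (T.disjoint _ _ fun h => hxy ?_)
    have e1 : x.1 = y.1 := Sum.inl_injective (Prod.ext_iff.1 h).1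
    have e2 := (hl x hx).trans (hl y hy).symm
    rw [← h] at e2
    exact Prod.ext e1 (T.tileVertex_injective _ e2)
  have hsum := measure_biUnion_finset (μ := volume) hdisj
    (fun x _ => isOpen_interior.measurableSet.inter measurableSet_ball)
  have hle : volume (⋃ x ∈ s, interior (T.tile (Sum.inl x.1, l x)) ∩ Metric.ball z r) ≤
      volume (Metric.ball z r) :=
    measure_mono (Set.iUnion₂_subset fun _ _ => Set.inter_subset_right)
  have hpos : ∀ x ∈ s, 0 ≤ P.angle x.2 * r ^ 2 / 2 := fun x _ => by
    have := (P.angle_mem_Ioo hP x.2).1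
    positivity
  have hball : volume (Metric.ball z r) = ENNReal.ofReal (r ^ 2 * Real.pi) := by
    rw [Complex.volume_ball, ENNReal.ofReal_mul (by positivity), ENNReal.ofReal_pow hr0.le,
      ← NNReal.coe_real_pi, ENNReal.ofReal_coe_nnreal]
  rw [hsum, Finset.sum_congr rfl hint, ← ENNReal.ofReal_sum_of_nonneg hpos, hball,
    ENNReal.ofReal_le_ofReal_iff (by positivity), ← Finset.sum_div, ← Finset.sum_mul] at hle
  have hr2 : 0 < r ^ 2 := by positivity
  nlinarith

theorem tile_eq_image_add (i : Fin n ⊕ Fin m) (l : Λ) :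
    T.tile (i, l) = (fun z => z + (l : ℂ)) '' T.tile (i, 0) := by
  have h0 : placement Λ T.motion (i, (0 : Λ)) = T.motion i := by
    funext z
    simp [placement]
  rw [tile, tile, placedRegion, placedRegion, h0, Set.image_image]
  rfl

/-- Only finitely many lifted tiles come close to a given point. -/
theorem finite_tiles_near [DiscreteTopology Λ] (z : ℂ) :
    {a | (T.tile a ∩ Metric.ball z 1).Nonempty}.Finite := by
  have hbd : ∀ i, ∃ R : ℝ, T.tile (i, 0) ⊆ Metric.closedBall 0 R := by
    intro i
    have h : Bornology.IsBounded (T.tile (i, 0)) := by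
      rw [tile_eq]
      exact (T.place _).lipschitz.isBounded_image (isBounded_pentRegion _)
    exact h.subset_closedBall 0
  choose R hR using hbd
  have hfin : ∀ i, {l : Λ | (T.tile (i, l) ∩ Metric.ball z 1).Nonempty}.Finite := by
    intro i
    have h1 : (Metric.closedBall (0 : ℂ) (‖z‖ + 1 + R i) ∩ (Λ : Set ℂ)).Finite := by
      change ((_ : Set ℂ) ∩ Λ.toAddSubgroup).Finite
      have : DiscreteTopology Λ.toAddSubgroup := (inferInstance : DiscreteTopology Λ)
      exact Metric.finite_isBounded_inter_isClosed DiscreteTopology.isDiscrete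
        Metric.isBounded_closedBall inferInstance
    refine Set.Finite.of_finite_image (f := fun l : Λ => (l : ℂ)) (h1.subset ?_)
      Subtype.val_injective.injOn
    rintro _ ⟨l, ⟨w, hw, hwz⟩, rfl⟩
    refine ⟨?_, l.2⟩
    rw [tile_eq_image_add] at hw
    obtain ⟨y, hy, rfl⟩ := hw
    have hy' := hR i hy
    rw [mem_closedBall_zero_iff] at hy' ⊢
    rw [Metric.mem_ball, Complex.dist_eq] at hwz
    have e : (l : ℂ) = (y + l - z) + z - y := by ring
    have h2 : ‖(l : ℂ)‖ ≤ ‖y + l - z‖ + ‖z‖ + ‖y‖ := by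
      conv_lhs => rw [e]
      exact (norm_sub_le _ _).trans (add_le_add_left (norm_add_le _ _) _)
    linarith
  refine (Set.Finite.biUnion (Set.finite_univ (α := Fin n ⊕ Fin m)) fun i _ =>
    (hfin i).image fun l => (i, l)).subset ?_
  rintro ⟨i, l⟩ h
  simp only [Set.mem_univ, Set.iUnion_true, Set.mem_iUnion]
  exact ⟨i, l, h, rfl⟩

open Filter Topology in
/-- Around a vertex at which only copies of `P` meet, their angles fill a full turn. -/
theorem sum_angle_ge [DiscreteTopology Λ] (hP : IsStrictlyConvexPent P.vertex) (z : ℂ)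
    (s : Finset (Fin n × Fin 5)) (hs : s.Nonempty) (l : Fin n × Fin 5 → Λ)
    (hl : ∀ x ∈ s, T.tileVertex (Sum.inl x.1, l x) x.2 = z)
    (hpure : ∀ a k, T.tileVertex a k = z → ∃ x ∈ s, a = (Sum.inl x.1, l x)) :
    2 * Real.pi ≤ ∑ x ∈ s, P.angle x.2 := by
  have h1 : ∀ᶠ r in 𝓝[>] (0 : ℝ), ∀ x ∈ s,
      volume (T.tile (Sum.inl x.1, l x) ∩ Metric.ball z r) =
        ENNReal.ofReal (P.angle x.2 * r ^ 2 / 2) := by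
    rw [Filter.eventually_all_finset]
    intro x hx
    have := T.volume_tile_inter_ball hP x.1 (l x) x.2
    rwa [hl x hx] at this
  set F := {a | (T.tile a ∩ Metric.ball z 1).Nonempty ∧ z ∉ T.tile a} with hF
  have hFfin : F.Finite := (T.finite_tiles_near z).subset fun a h => h.1
  have hFcl : IsClosed (⋃ a ∈ F, T.tile a) := hFfin.isClosed_biUnion fun a _ => T.isClosed_tile a
  have hzF : z ∉ ⋃ a ∈ F, T.tile a := by
    simp only [Set.mem_iUnion, not_exists]
    exact fun a ha => ha.2
  obtain ⟨ε, hε, hεF⟩ := Metric.isOpen_iff.1 hFcl.isOpen_compl z hzF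
  obtain ⟨r, hr, hr1⟩ := (h1.and (Ioo_mem_nhdsGT (lt_min hε one_pos))).exists
  have hr0 : 0 < r := hr1.1
  have hcover : Metric.ball z r ⊆ ⋃ x ∈ s, T.tile (Sum.inl x.1, l x) ∩ Metric.ball z r := by
    intro y hy
    have hyc : y ∈ ⋃ a, T.tile a := T.covers ▸ Set.mem_univ y
    obtain ⟨b, hb⟩ := Set.mem_iUnion.1 hyc
    have hzb : z ∈ T.tile b := by
      by_contra hzb
      have hbF : b ∈ F :=
        ⟨⟨y, hb, Metric.ball_subset_ball (hr1.2.le.trans (min_le_right _ _)) hy⟩, hzb⟩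
      exact hεF (Metric.ball_subset_ball (hr1.2.le.trans (min_le_left _ _)) hy)
        (Set.mem_biUnion hbF hb)
    obtain ⟨x0, hx0⟩ := hs
    rw [← hl x0 hx0] at hzb
    obtain ⟨k, hk⟩ := T.exists_tileVertex_eq hzb
    rw [hl x0 hx0] at hk
    obtain ⟨x, hx, rfl⟩ := hpure b k hk
    exact Set.mem_biUnion hx ⟨hb, hy⟩
  have hle := (measure_mono hcover).trans (measure_biUnion_finset_le (μ := volume) s _)
  have hpos : ∀ x ∈ s, 0 ≤ P.angle x.2 * r ^ 2 / 2 := fun x _ => by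
    have := (P.angle_mem_Ioo hP x.2).1
    positivity
  have hball : volume (Metric.ball z r) = ENNReal.ofReal (r ^ 2 * Real.pi) := by
    rw [Complex.volume_ball, ENNReal.ofReal_mul (by positivity), ENNReal.ofReal_pow hr0.le,
      ← NNReal.coe_real_pi, ENNReal.ofReal_coe_nnreal]
  rw [Finset.sum_congr rfl hr, ← ENNReal.ofReal_sum_of_nonneg hpos, hball,
    ENNReal.ofReal_le_ofReal_iff (Finset.sum_nonneg hpos), ← Finset.sum_div, ← Finset.sum_mul]
    at hle
  have hr2 : 0 < r ^ 2 := by positivity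
  nlinarith

end TorusTiling

/-! ### The weights of the corners -/

/-- The weight of a corner with angle `x`: `halfCot x` minus the affine function that agrees with it
at `π / 2` and at `2π / 3`, the angles at vertices of degrees `4` and `3` whose tiles share the full
turn equally. -/
def cornerWeight (x : ℝ) : ℝ :=
  halfCot x - (4 - Real.sqrt 3) + (12 - 4 * Real.sqrt 3) / (2 * Real.pi) * x

theorem sum_cornerWeight_eq {ι : Type*} (s : Finset ι) (α : ι → ℝ) :
    ∑ x ∈ s, cornerWeight (α x) = ∑ x ∈ s, halfCot (α x) - s.card * (4 - Real.sqrt 3) +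
      (12 - 4 * Real.sqrt 3) / (2 * Real.pi) * ∑ x ∈ s, α x := by
  simp only [cornerWeight]
  rw [Finset.sum_add_distrib, Finset.sum_sub_distrib, Finset.sum_const, nsmul_eq_mul,
    ← Finset.mul_sum]

theorem sum_halfCot_ge_tangents {ι : Type*} (s : Finset ι) (α : ι → ℝ)
    (hα : ∀ x ∈ s, α x ∈ Set.Ioo 0 Real.pi) :
    s.card * (1 + Real.pi / 2) - ∑ x ∈ s, α x ≤ ∑ x ∈ s, halfCot (α x) ∧
    s.card * (Real.sqrt 3 / 3 + 4 * Real.pi / 9) - 2 / 3 * ∑ x ∈ s, α x ≤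
      ∑ x ∈ s, halfCot (α x) := by
  constructor
  · have := Finset.sum_le_sum fun x hx => halfCot_ge_tangent_pi_div_two (hα x hx)
    rwa [Finset.sum_sub_distrib, Finset.sum_const, nsmul_eq_mul] at this
  · have := Finset.sum_le_sum fun x hx => halfCot_ge_tangent_two_pi_div_three (hα x hx)
    rwa [Finset.sum_sub_distrib, Finset.sum_const, nsmul_eq_mul, ← Finset.mul_sum] at this

/-- Angles that fill a full turn have nonnegative total weight. The tangent at `2π / 3` shows this
for at most three angles, the tangent at `π / 2` for at least four. -/
theorem sum_cornerWeight_nonneg {ι : Type*} (s : Finset ι) (α : ι → ℝ)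
    (hα : ∀ x ∈ s, α x ∈ Set.Ioo 0 Real.pi) (hS : ∑ x ∈ s, α x = 2 * Real.pi) :
    0 ≤ ∑ x ∈ s, cornerWeight (α x) := by
  obtain ⟨h1, h2⟩ := sum_halfCot_ge_tangents s α hα
  have hs := sqrt_three_bounds
  have hp1 := Real.pi_gt_d4
  have hp2 := Real.pi_lt_d4
  rw [sum_cornerWeight_eq, hS, div_mul_cancel₀ _ (by positivity)]
  rw [hS] at h1 h2
  rcases Nat.lt_or_ge s.card 4 with h | h
  · have : (s.card : ℝ) ≤ 3 := by exact_mod_cast Nat.lt_succ_iff.1 h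
    nlinarith
  · have : (4 : ℝ) ≤ s.card := by exact_mod_cast h
    nlinarith

/-- However few angles there are around a point, their total weight is at least `-1 / 6`. -/
theorem sum_cornerWeight_ge {ι : Type*} (s : Finset ι) (α : ι → ℝ)
    (hα : ∀ x ∈ s, α x ∈ Set.Ioo 0 Real.pi) (hS : ∑ x ∈ s, α x ≤ 2 * Real.pi) :
    -(1 / 6) ≤ ∑ x ∈ s, cornerWeight (α x) := by
  obtain ⟨h1, h2⟩ := sum_halfCot_ge_tangents s α hα
  have hs := sqrt_three_bounds
  have hp1 := Real.pi_gt_d4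
  have hp2 := Real.pi_lt_d4
  have hS0 : 0 ≤ ∑ x ∈ s, α x := Finset.sum_nonneg fun x hx => (hα x hx).1.le
  have hd : (0 : ℝ) ≤ s.card := Nat.cast_nonneg _
  rw [sum_cornerWeight_eq]
  set q := (12 - 4 * Real.sqrt 3) / (2 * Real.pi) with hq
  have hq1 : q * (2 * Real.pi) = 12 - 4 * Real.sqrt 3 := by
    rw [hq, div_mul_cancel₀ _ (by positivity)]
  have hq2 : q ≤ 5 / 6 := by nlinarith
  -- the average of the two tangents has slope `-5 / 6`
  have h3 : s.card * ((1 + Real.pi / 2 + (Real.sqrt 3 / 3 + 4 * Real.pi / 9)) / 2) -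
      5 / 6 * ∑ x ∈ s, α x ≤ ∑ x ∈ s, halfCot (α x) := by linarith
  have h4 : (s.card : ℝ) * (4 - Real.sqrt 3) ≤
      s.card * ((1 + Real.pi / 2 + (Real.sqrt 3 / 3 + 4 * Real.pi / 9)) / 2) :=
    mul_le_mul_of_nonneg_left (by linarith) hd
  have h5 : (5 / 6 - q) * ∑ x ∈ s, α x ≤ (5 / 6 - q) * (2 * Real.pi) :=
    mul_le_mul_of_nonneg_left hS (by linarith)
  linarith

open Classical in
/-- A sum is at least `-1 / 6` times the number of markers if, over each fibre of `π`, it is at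
least `-1 / 6`, and nonnegative over the fibres without a marker. -/
theorem neg_card_div_six_le_sum {α β γ : Type*} [Fintype α] [Fintype γ] (π : α → β) (ρ : γ → β)
    (f : α → ℝ)
    (h : ∀ c, ∀ s : Finset α, (∀ x, x ∈ s ↔ π x = c) → s.Nonempty →
      -(1 / 6) ≤ ∑ x ∈ s, f x ∧ ((∀ y, ρ y ≠ c) → 0 ≤ ∑ x ∈ s, f x)) :
    -(Fintype.card γ / 6 : ℝ) ≤ ∑ x, f x := by
  set M := Finset.univ.image ρ with hM
  set V := Finset.univ.image π with hV
  rw [← Finset.sum_fiberwise_of_maps_to (s := Finset.univ) (t := V) (g := π)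
    (fun x _ => Finset.mem_image_of_mem _ (Finset.mem_univ x)) f]
  have h3 : ∀ c ∈ V, (if c ∈ M then -(1 / 6) else 0 : ℝ) ≤
      ∑ x ∈ Finset.univ.filter fun x => π x = c, f x := by
    intro c hc
    obtain ⟨x, _, hx⟩ := Finset.mem_image.1 hc
    obtain ⟨h1, h2⟩ := h c (Finset.univ.filter fun x => π x = c) (fun x => by simp)
      ⟨x, Finset.mem_filter.2 ⟨Finset.mem_univ _, hx⟩⟩
    split_ifs with hcM
    · exact h1
    · exact h2 fun y hy => hcM (Finset.mem_image.2 ⟨y, Finset.mem_univ _, hy⟩)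
  refine le_trans ?_ (Finset.sum_le_sum h3)
  rw [← Finset.sum_filter, Finset.sum_const, nsmul_eq_mul]
  have h4 : (V.filter (· ∈ M)).card ≤ Fintype.card γ :=
    (Finset.card_le_card fun c hc => (Finset.mem_filter.1 hc).2).trans Finset.card_image_le
  have h5 : ((V.filter (· ∈ M)).card : ℝ) ≤ Fintype.card γ := by exact_mod_cast h4
  linarith

namespace TorusTiling

variable {Λ : Submodule ℤ ℂ} {P Q : Pentagon} {n m : ℕ}
variable (T : TorusTiling Λ P Q n m)

/-- At a vertex of the torus, the corners of copies of `P` have total weight at least `-1 / 6`,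
and at least `0` if no copy of `Q` has a corner there. -/
theorem sum_cornerWeight_at_vertex [DiscreteTopology Λ] (hP : IsStrictlyConvexPent P.vertex)
    (c : ℂ ⧸ Λ) (s : Finset (Fin n × Fin 5))
    (hs : ∀ x, x ∈ s ↔ T.cornerClass (Sum.inl x.1, x.2) = c) (hne : s.Nonempty) :
    -(1 / 6) ≤ ∑ x ∈ s, cornerWeight (P.angle x.2) ∧
      ((∀ y : Fin m × Fin 5, T.cornerClass (Sum.inr y.1, y.2) ≠ c) →
        0 ≤ ∑ x ∈ s, cornerWeight (P.angle x.2)) := by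
  have hα : ∀ x ∈ s, P.angle x.2 ∈ Set.Ioo 0 Real.pi := fun x _ => P.angle_mem_Ioo hP x.2
  have hcls : ∀ x ∈ s, T.cornerClass (Sum.inl x.1, x.2) = c := fun x hx => (hs x).1 hx
  obtain ⟨x0, hx0⟩ := hne
  set z := T.cornerPos (Sum.inl x0.1, x0.2) with hz
  have hzc : (Submodule.Quotient.mk z : ℂ ⧸ Λ) = c := hcls x0 hx0
  have hex : ∀ x, ∃ l : Λ, x ∈ s → T.cornerPos (Sum.inl x.1, x.2) + (l : ℂ) = z := by
    intro x
    by_cases hx : x ∈ s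
    · have h : (Submodule.Quotient.mk z : ℂ ⧸ Λ) =
        Submodule.Quotient.mk (T.cornerPos (Sum.inl x.1, x.2)) := hzc.trans (hcls x hx).symm
      rw [Submodule.Quotient.eq] at h
      exact ⟨⟨_, h⟩, fun _ => by simp⟩
    · exact ⟨0, fun h => absurd h hx⟩
  choose l hl using hex
  have hl' : ∀ x ∈ s, T.tileVertex (Sum.inl x.1, l x) x.2 = z := fun x hx => hl x hx
  have hle := T.sum_angle_le hP z s l hl'
  refine ⟨sum_cornerWeight_ge _ _ hα hle, fun hpure => ?_⟩
  · refine sum_cornerWeight_nonneg _ _ hα (le_antisymm hle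
      (T.sum_angle_ge hP z _ ⟨x0, hx0⟩ l hl' ?_))
    rintro ⟨i, l'⟩ k hk
    have hk : T.cornerPos (i, k) + (l' : ℂ) = z := hk
    have hkc : T.cornerClass (i, k) = c := by
      rw [← hzc, ← hk]
      refine (Submodule.Quotient.eq Λ).2 ?_
      simp
    rcases i with i | i
    · have hmem : (i, k) ∈ s := (hs (i, k)).2 hkc
      refine ⟨(i, k), hmem, ?_⟩
      have h1 := hl (i, k) hmem
      rw [← h1] at hk
      have h2 : (l' : ℂ) = l (i, k) := add_left_cancel hk
      rw [Subtype.ext h2]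
    · exact absurd hkc (hpure (i, k))

/-- Summing the weights over the vertices of the torus: every copy of `P` contributes the sum of
`halfCot` over its angles minus `2 + √3`, which is the value for Cairo and Prismatic pentagons, and
negative contributions come only from the at most `5 * m` vertices on copies of `Q`. -/
theorem sum_halfCot_ge [DiscreteTopology Λ] (T : TorusTiling Λ P Q n m)
    (hP : IsStrictlyConvexPent P.vertex) :
    -(5 / 6 * m : ℝ) ≤ n * (∑ k, halfCot (P.angle k) - (2 + Real.sqrt 3)) := by
  have h1 : ∑ x : Fin n × Fin 5, cornerWeight (P.angle x.2) =
      n * (∑ k, halfCot (P.angle k) - (2 + Real.sqrt 3)) := by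
    rw [Fintype.sum_prod_type]
    simp only [Finset.sum_const, Finset.card_univ, Fintype.card_fin, nsmul_eq_mul]
    congr 1
    rw [sum_cornerWeight_eq, P.sum_angle hP]
    have := Real.pi_ne_zero
    simp only [Finset.card_univ, Fintype.card_fin]
    field_simp
    push_cast
    ring
  rw [← h1]
  have h2 := neg_card_div_six_le_sum (fun x : Fin n × Fin 5 => T.cornerClass (Sum.inl x.1, x.2))
    (fun y : Fin m × Fin 5 => T.cornerClass (Sum.inr y.1, y.2))
    (fun x => cornerWeight (P.angle x.2)) (T.sum_cornerWeight_at_vertex hP)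
  rw [Fintype.card_prod, Fintype.card_fin, Fintype.card_fin] at h2
  push_cast at h2
  linarith

end TorusTiling

end

theorem theorem4p6 (Λ : Submodule ℤ ℂ) [DiscreteTopology Λ] [IsZLattice ℝ Λ]
    (P Q : Pentagon) (hP : P.IsEfficient) (hQ : Q.IsType2) (hQ1 : Q.HasUnitArea)
    (n m : ℕ) (T : TorusTiling Λ P Q n m)
    (C : Pentagon) (hC : C.IsCairo ∨ C.IsPrismatic) (hC1 : C.HasUnitArea) :
    C.perimeter / 2 ≤ T.perimeterPerTile := by
  have hconv := hP.isStrictlyConvex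
  obtain ⟨hPA, C', hC', hC'1, hPC'⟩ := hP
  have hp0 : 0 ≤ P.perimeter := Finset.sum_nonneg fun _ _ => dist_nonneg
  have hC0 : 0 ≤ C.perimeter := Finset.sum_nonneg fun _ _ => dist_nonneg
  have hC'0 : 0 ≤ C'.perimeter := Finset.sum_nonneg fun _ _ => dist_nonneg
  have hR := C.perimeter_sq_of_cairo_or_prismatic hC hC1
  have hR' := C'.perimeter_sq_of_cairo_or_prismatic (Or.inl hC') hC'1
  have hPC : P.perimeter ≤ C.perimeter := by
    refine hPC'.trans_eq ?_
    exact (pow_left_inj₀ hC'0 hC0 two_ne_zero).1 (hR'.trans hR.symm)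
  have hs := sqrt_three_bounds
  have hpi := Real.pi_gt_three
  -- the isoperimetric inequality for `P`
  have hiso : 4 * ∑ k, halfCot (P.angle k) ≤ P.perimeter ^ 2 := by
    have h1 := hconv.isoperimetric
    have h2 : volume P.region = ENNReal.ofReal (pentSignedArea P.vertex) := hconv.volume_pentRegion
    rw [hPA] at h2
    rw [ENNReal.ofReal_eq_one.1 h2.symm, mul_one] at h1
    simp only [P.turnTan_eq_halfCot hconv] at h1
    exact h1
  have hF : 5 * (Real.sqrt 3 / 3 + 4 * Real.pi / 9) - 2 * Real.pi ≤
      ∑ k, halfCot (P.angle k) := by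
    have h := (sum_halfCot_ge_tangents Finset.univ P.angle
      fun k _ => P.angle_mem_Ioo hconv k).2
    rw [P.sum_angle hconv] at h
    simp only [Finset.card_univ, Fintype.card_fin] at h
    push_cast at h
    linarith
  -- the tangent bound on the angles of `P` keeps its perimeter close to that of `C`
  have hp37 : 37 / 10 ≤ P.perimeter := by
    refine le_of_sq_le_sq ?_ hp0
    nlinarith
  -- `C` has perimeter `2 * √(2 + √3)`, about `3.864`
  have hR387 : C.perimeter ≤ 387 / 100 := by
    refine le_of_sq_le_sq ?_ (by norm_num)
    rw [hR]; linarith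
  have hQp := hQ.perimeter_ge hQ1
  have hangle := T.sum_halfCot_ge hconv
  have hedges := T.perimeters_le
  have hn : (0 : ℝ) ≤ n := Nat.cast_nonneg n
  have hm : (0 : ℝ) ≤ m := Nat.cast_nonneg m
  have hnm : (0 : ℝ) < n + m := by
    have hne : Nonempty (Fin n ⊕ Fin m) := by
      have h : (0 : ℂ) ∈ ⋃ a, placedRegion Λ P Q T.motion a := T.covers ▸ Set.mem_univ 0
      obtain ⟨a, _⟩ := Set.mem_iUnion.1 h
      exact ⟨a.1⟩
    have : 0 < Fintype.card (Fin n ⊕ Fin m) := Fintype.card_pos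
    rw [Fintype.card_sum, Fintype.card_fin, Fintype.card_fin] at this
    exact_mod_cast this
  -- the gain on the copies of `P` is made up for by the copies of `Q`
  have h1 : (n : ℝ) * ((C.perimeter - P.perimeter) * (C.perimeter + P.perimeter)) ≤ 10 / 3 * m := by
    have h2 : (C.perimeter - P.perimeter) * (C.perimeter + P.perimeter) ≤
        4 * ((2 + Real.sqrt 3) - ∑ k, halfCot (P.angle k)) := by nlinarith
    have h3 := mul_le_mul_of_nonneg_left h2 hn
    linarith
  have h2 : (n : ℝ) * (C.perimeter - P.perimeter) ≤ 1 / 2 * m := by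
    have h3 : 0 ≤ (n : ℝ) * (C.perimeter - P.perimeter) := mul_nonneg hn (by linarith)
    have h4 : (n : ℝ) * (C.perimeter - P.perimeter) * (37 / 5) ≤
        (n : ℝ) * (C.perimeter - P.perimeter) * (C.perimeter + P.perimeter) :=
      mul_le_mul_of_nonneg_left (by linarith) h3
    linarith
  have h3 : 1 / 2 * (m : ℝ) ≤ m * (Q.perimeter - C.perimeter) := by nlinarith
  rw [TorusTiling.perimeterPerTile, div_le_div_iff₀ two_pos hnm]
  linarith
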